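/- Let $\gamma,\beta,\mu>0$ be constants. There is a constant $C<\infty$, depending only on $\gamma,\beta,\mu$, with the following property. Let $U=[n,u,E,B]\in C([0,\infty);L^2(\mathbb R^3))$, with $n$ real-valued and $u,E,B$ valued in $\mathbb R^3$, be a solution (with spatial derivatives in the sense of distributions) of the linearized Navier–Stokes–Maxwell system $$\partial_t n+\gamma\nabla\cdot u=0,\qquad \partial_t u+\gamma\nabla n+\beta E-\mu\Delta u=0,$$ $$\partial_t E-\nabla\times B-\beta u=0,\qquad \partial_t B+\nabla\times E=0,$$ $$\nabla\cdot E=-\tfrac{\beta}{\gamma}n,\qquad \nabla\cdot B=0,$$ for $t>0$, $x\in\mathbb R^3$, with initial data $U|_{t=0}=[n_0,u_0,E_0,B_0]$. Write $\|\cdot\|$ for the norm of $L^2(\mathbb R^3)$, $\|f\|_{L^1\cap L^2}=\|f\|_{L^1}+\|f\|$, $\|[f,g]\|_X=\|f\|_X+\|g\|_X$, and let $\|\nabla^j f\|$ be the $L^2$ norm of the tensor of all weak derivatives of order $j$ of $f$; a norm is $+\infty$ if the function (or the weak derivative) does not exist in the space. Then for every $t\ge 0$ $$\|n(t)\|\le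 C(1+t)^{-5/4}\left(\|[u_0,E_0]\|_{L^1}+\|[n_0,u_0]\|\right),$$ $$\|u(t)\|\le C\left[(1+t)^{-5/4}\|n_0\|_{L^1\cap L^2}+(1+t)^{-3/4}\|[u_0,E_0]\|_{L^1\cap L^2}+(1+t)^{-5/8}\|B_0\|_{L^1\cap L^2}\right],$$ $$\|E(t)\|\le C\left[(1+t)^{-3/4}\|u_0\|_{L^1\cap L^2}+(1+t)^{-3/4}\left(\|E_0\|_{L^1\cap L^2}+\|\nabla^2E_0\|\right)+(1+t)^{-9/8}\left(\|B_0\|_{L^1\cap L^2}+\|\nabla^3B_0\|\right)\right],$$ $$\|B(t)\|\le C\left[(1+t)^{-5/8}\|u_0\|_{L^1\cap L^2}+(1+t)^{-9/8}\left(\|E_0\|_{L^1\cap L^2}+\|\nabla^3E_0\|\right)+(1+t)^{-3/8}\left(\|B_0\|_{L^1\cap L^2}+\|\nabla B_0\|\right)\right],$$ and moreover $$\|\nabla B(t)\|\le C\left[(1+t)^{-7/8}\left(\|u_0\|_{L^1\cap L^2}+\|\nabla u_0\|\right)+(1+t)^{-5/8}\left(\|[E_0,B_0]\|_{L^1\cap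 L^2}+\|\nabla^3[E_0,B_0]\|\right)\right].$$ -/

import Mathlib

open MeasureTheory Topology Set
open scoped ENNReal NNReal Distributions

namespace NSMaxwell

/-- Three-dimensional Euclidean space. -/
abbrev R3 : Type := EuclideanSpace ℝ (Fin 3)

/-- `L²(ℝ³; F)` for the Lebesgue measure. -/
abbrev L2 (F : Type) [NormedAddCommGroup F] : Type := Lp F 2 (volume : Measure R3)

/-- Real-valued smooth compactly supported test functions on `ℝ³`. -/
abbrev Test : Type := 𝓓((⊤ : TopologicalSpace.Opens R3), ℝ)

/-- The `i`-th standard basis vector of `ℝ³`. -/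
noncomputable def e (i : Fin 3) : R3 := EuclideanSpace.single i 1

/-- The pairing `⟨f, φ⟩ = ∫ f φ dx`. -/
noncomputable def pair (f : R3 → ℝ) (φ : Test) : ℝ := ∫ x, f x * φ x

/-- The distribution `∂ᵢ f`, evaluated at the test function `φ`: `-∫ f ∂ᵢφ dx`. -/
noncomputable def distPartial (i : Fin 3) (f : R3 → ℝ) (φ : Test) : ℝ :=
  -∫ x, f x * fderiv ℝ φ x (e i)

/-- The distribution `Δ f`, evaluated at the test function `φ`: `∫ f Δφ dx`. -/
noncomputable def distLaplacian (f : R3 → ℝ) (φ : Test) : ℝ :=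
  ∫ x, f x * (Laplacian.laplacian (φ : R3 → ℝ) : R3 → ℝ) x

/-- The distribution `∇ · v`, evaluated at the test function `φ`. -/
noncomputable def distDiv (v : R3 → R3) (φ : Test) : ℝ :=
  ∑ i, distPartial i (fun x => v x i) φ

/-- The `i`-th component of the distribution `∇ × v`, evaluated at the test function `φ`:
`(∇ × v)ᵢ = ∂ᵢ₊₁ vᵢ₊₂ - ∂ᵢ₊₂ vᵢ₊₁`, with indices modulo `3`. -/
noncomputable def distCurl (v : R3 → R3) (i : Fin 3) (φ : Test) : ℝ :=
  distPartial (i + 1) (fun x => v x (i + 2)) φ - distPartial (i + 2) (fun x => v x (i + 1)) φ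

/-- `[n, u, E, B]` is a solution in `C([0, ∞); L²(ℝ³))` of the linearized Navier-Stokes-Maxwell
system
`∂ₜ n + γ ∇·u = 0`,
`∂ₜ u + γ ∇n + β E - μ Δu = 0`,
`∂ₜ E - ∇×B - β u = 0`,
`∂ₜ B + ∇×E = 0`,
`∇·E = -(β/γ) n`, `∇·B = 0`,
with initial data `[n₀, u₀, E₀, B₀]`. Spatial derivatives are taken in the sense of distributions:
each equation is tested against all smooth compactly supported functions of `x`. -/
structure IsSolution (γ β μ : ℝ) (n : ℝ → L2 ℝ) (u E B : ℝ → L2 R3)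
    (n₀ : L2 ℝ) (u₀ E₀ B₀ : L2 R3) : Prop where
  continuousOn_n : ContinuousOn n (Ici 0)
  continuousOn_u : ContinuousOn u (Ici 0)
  continuousOn_E : ContinuousOn E (Ici 0)
  continuousOn_B : ContinuousOn B (Ici 0)
  init_n : n 0 = n₀
  init_u : u 0 = u₀
  init_E : E 0 = E₀
  init_B : B 0 = B₀
  eq_n : ∀ φ : Test, ∀ t : ℝ, 0 < t →
    HasDerivAt (fun s => pair (n s) φ) (-(γ * distDiv (u t) φ)) t
  eq_u : ∀ φ : Test, ∀ i : Fin 3, ∀ t : ℝ, 0 < t →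
    HasDerivAt (fun s => pair (fun x => u s x i) φ)
      (-(γ * distPartial i (n t) φ) - β * pair (fun x => E t x i) φ
        + μ * distLaplacian (fun x => u t x i) φ) t
  eq_E : ∀ φ : Test, ∀ i : Fin 3, ∀ t : ℝ, 0 < t →
    HasDerivAt (fun s => pair (fun x => E s x i) φ)
      (distCurl (B t) i φ + β * pair (fun x => u t x i) φ) t
  eq_B : ∀ φ : Test, ∀ i : Fin 3, ∀ t : ℝ, 0 < t →
    HasDerivAt (fun s => pair (fun x => B s x i) φ) (-distCurl (E t) i φ) t
  div_E : ∀ φ : Test, ∀ t : ℝ, 0 ≤ t → distDiv (E t) φ = -(β / γ) * pair (n t) φ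
  div_B : ∀ φ : Test, ∀ t : ℝ, 0 ≤ t → distDiv (B t) φ = 0

/-- `g` is the weak derivative `∂_{s₁} ⋯ ∂_{sⱼ} v`. -/
def IsWeakDeriv {j : ℕ} (s : Fin j → Fin 3) (v g : R3 → R3) : Prop :=
  ∀ φ : Test, ∫ x, iteratedFDeriv ℝ j φ x (fun a => e (s a)) • v x
    = (-1 : ℝ) ^ j • ∫ x, φ x • g x

/-- `‖∇ʲ v‖`, the `L²` norm of the tensor of all weak derivatives of order `j` of a vector field;
it is `∞` if these derivatives do not all exist in `L²`. (They are unique as elements of `L²`, so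
that the infimum is over at most one family.) -/
noncomputable def gradNorm (j : ℕ) (v : L2 R3) : ℝ≥0∞ :=
  ⨅ (g : (Fin j → Fin 3) → L2 R3) (_ : ∀ s, IsWeakDeriv s v (g s)),
    (∑ s, ‖g s‖ₑ ^ 2) ^ (1 / 2 : ℝ)

/-- `‖f‖_{L¹}`, which is `∞` if `f` is not integrable. -/
noncomputable def norm1 {F : Type} [NormedAddCommGroup F] (f : L2 F) : ℝ≥0∞ :=
  eLpNorm f 1 volume

/-- `‖f‖_{L¹ ∩ L²} = ‖f‖_{L¹} + ‖f‖_{L²}`. -/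
noncomputable def norm12 {F : Type} [NormedAddCommGroup F] (f : L2 F) : ℝ≥0∞ :=
  norm1 f + ‖f‖ₑ

/-- The rate `(1 + t)^{-a}`. -/
noncomputable def rate (a t : ℝ) : ℝ≥0∞ := ENNReal.ofReal ((1 + t) ^ (-a))

end NSMaxwell

/-! After a Fourier transform in space the system is, at each frequency ξ with r = |ξ|, a linear ODE
on ℂ × ℂ³ × ℂ³ × ℂ³ which splits into two blocks.

Longitudinal block: Gauss's law expresses ξ·E through n, so n solves the damped oscillator n'' +
μr²n' + (γ²r² + β²)n = 0. Its energy decays like e^{-cr²t} for small r and exponentially for r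
bounded below. Gauss's law also bounds n₀ by a multiple of r|E₀|; this additional factor r gives the
rate 5/4 for n at low frequencies.

Transverse block: B is already orthogonal to ξ, and applying iξ×/r to E and u turns the curl into
multiplication by r. The resulting 3×3 system has characteristic polynomial λ³ + μr²λ² + (r² + β²)λ
+ μr⁴ = (λ + σ)(λ² + τλ + ω²) with σ, τ > 0. As r → 0, σ is comparable to r⁴ and τ to r²: the
magnetic field diffuses with a fourth-order symbol, hence the eighths in the rates. As r → ∞, σ is
comparable to r² but τ only to 1/r²: high frequencies are damped like e^{-ct/r²}, and decay has to
be paid for with derivatives of the data. The real factor (`Transverse.slow_mode`) and the quadratic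
factor (`Transverse.fast_mode`, a damped oscillator) are treated separately; `Transverse.low_freq`,
`Transverse.mid_freq` and `Transverse.high_freq` recombine them.

Both blocks together give the bounds of `SymbolSol.exists_fiberBound` at each frequency. At low
frequencies they consist of kernels r^a e^{-cr^p(1+t)} multiplying the transformed data. Such a
kernel has L² norm of order (1+t)^{-(2a+3)/(2p)}, and the transformed data are bounded by L¹ norms
(`exists_normLe_low`). At high frequencies e^{-ct/r²} ≤ K r^m (1+t)^{-m/2}, and r^m acts as m
derivatives. Plancherel's theorem then yields the estimates.

To reach the ODE from a distributional solution, `HasSymbol` attaches to a functional on test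
functions the function which is its Fourier transform, with uniqueness almost everywhere. The
equations integrated in time become almost everywhere identities between symbols
(`IsSolution.integrated`), and `ae_eq_exp_of_integrated` identifies the transformed solution with
the matrix exponential applied to the transformed data. -/

namespace NSMaxwell

/-! ### Exponential decay for damped linear oscillators -/

section ODE

variable {V : Type*} [NormedAddCommGroup V] [InnerProductSpace ℝ V]

/-- Grönwall's inequality for a differential inequality with constant rate. -/
theorem le_exp_mul_of_deriv_le {L L' : ℝ → ℝ} {c : ℝ} (hL : ∀ t, HasDerivAt L (L' t) t)
    (h : ∀ t, 0 ≤ t → L' t ≤ -c * L t) {t : ℝ} (ht : 0 ≤ t) : L t ≤ Real.exp (-c * t) * L 0 := by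
  have h1 : ∀ s, HasDerivAt (fun s => Real.exp (c * s) * L s)
      (Real.exp (c * s) * c * L s + Real.exp (c * s) * L' s) s := by
    intro s
    have := ((hasDerivAt_id s).const_mul c).exp
    convert! this.mul (hL s) using 1
    simp
  have h2 : AntitoneOn (fun s => Real.exp (c * s) * L s) (Ici 0) := by
    refine antitoneOn_of_deriv_nonpos (convex_Ici 0)
      (fun s _ => (h1 s).continuousAt.continuousWithinAt)
      (fun s _ => (h1 s).differentiableAt.differentiableWithinAt) fun s hs => ?_
    rw [interior_Ici] at hs
    rw [(h1 s).deriv]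
    have := mul_le_mul_of_nonneg_left (h s (le_of_lt hs)) (Real.exp_pos (c * s)).le
    linarith
  have h3 := h2 self_mem_Ici (mem_Ici.2 ht) ht
  simp only [mul_zero, Real.exp_zero, one_mul] at h3
  calc L t = Real.exp (-c * t) * (Real.exp (c * t) * L t) := by
        rw [← mul_assoc, ← Real.exp_add]; simp
    _ ≤ _ := by gcongr

/-- The energy θ‖x‖² + ‖y‖² is damped only through `y`. Adding the cross term 2δ⟨x, y⟩ produces
damping of `x` as well. The modified functional lies between 1/2 and 3/2 of the energy and decays at
rate 2δ/3; the quotient of these two constants is the factor 3. -/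
theorem oscillator_energy_le {x y : ℝ → V} {θ τ δ : ℝ} (hδ : 0 ≤ δ) (h4 : 4 * δ ≤ τ) (hθ : 0 < θ)
    (h2 : 2 * δ * τ ≤ θ) (hx : ∀ t, HasDerivAt x (y t) t)
    (hy : ∀ t, HasDerivAt y (-τ • y t - θ • x t) t) {t : ℝ} (ht : 0 ≤ t) :
    θ * ‖x t‖ ^ 2 + ‖y t‖ ^ 2
      ≤ 3 * (Real.exp (-(2 / 3 * δ) * t) * (θ * ‖x 0‖ ^ 2 + ‖y 0‖ ^ 2)) := by
  set L : ℝ → ℝ := fun s => θ * inner ℝ (x s) (x s) + inner ℝ (y s) (y s)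
    + 2 * δ * inner ℝ (x s) (y s) with hL
  have hd : 4 * δ ^ 2 ≤ θ := by nlinarith
  have key : ∀ s, (inner ℝ (x s) (y s)) ^ 2 ≤ ‖x s‖ ^ 2 * ‖y s‖ ^ 2 := by
    intro s
    rw [← mul_pow, sq_le_sq, abs_of_nonneg (by positivity : 0 ≤ ‖x s‖ * ‖y s‖)]
    exact abs_real_inner_le_norm _ _
  have hbd : ∀ s, |2 * δ * inner ℝ (x s) (y s)| ≤ (θ * ‖x s‖ ^ 2 + ‖y s‖ ^ 2) / 2 := by
    intro s
    refine abs_le_of_sq_le_sq ?_ (by positivity)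
    have h5 : 0 ≤ ‖x s‖ ^ 2 * ‖y s‖ ^ 2 := by positivity
    have := key s
    nlinarith [sq_nonneg (θ * ‖x s‖ ^ 2 - ‖y s‖ ^ 2), mul_le_mul_of_nonneg_right hd h5,
      mul_le_mul_of_nonneg_left this (by positivity : 0 ≤ δ ^ 2)]
  have hder : ∀ s, HasDerivAt L (2 * θ * inner ℝ (x s) (y s)
      + 2 * (-τ * ‖y s‖ ^ 2 - θ * inner ℝ (x s) (y s))
      + 2 * δ * (‖y s‖ ^ 2 + (-τ * inner ℝ (x s) (y s) - θ * ‖x s‖ ^ 2))) s := by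
    intro s
    have a1 := ((hx s).inner ℝ (hx s)).const_mul θ
    have a2 := (hy s).inner ℝ (hy s)
    have a3 := ((hx s).inner ℝ (hy s)).const_mul (2 * δ)
    convert! (a1.add a2).add a3 using 1
    simp only [inner_sub_right, inner_sub_left, real_inner_smul_right, real_inner_smul_left,
      real_inner_self_eq_norm_sq, real_inner_comm (x s) (y s)]
    ring
  have hineq : ∀ s, 2 * θ * inner ℝ (x s) (y s)
      + 2 * (-τ * ‖y s‖ ^ 2 - θ * inner ℝ (x s) (y s))
      + 2 * δ * (‖y s‖ ^ 2 + (-τ * inner ℝ (x s) (y s) - θ * ‖x s‖ ^ 2))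
      ≤ -(2 / 3 * δ) * L s := by
    intro s
    simp only [hL, real_inner_self_eq_norm_sq]
    have hτ : 0 ≤ τ := by linarith
    have h6 : |2 * δ * τ * inner ℝ (x s) (y s)| ≤ δ * θ * ‖x s‖ ^ 2 + τ / 2 * ‖y s‖ ^ 2 := by
      refine abs_le_of_sq_le_sq ?_ (by positivity)
      have h5 : 0 ≤ ‖x s‖ ^ 2 * ‖y s‖ ^ 2 := by positivity
      have h7 : 4 * δ ^ 2 * τ ^ 2 ≤ 2 * δ * θ * τ := by
        nlinarith [mul_le_mul_of_nonneg_left h2 (by positivity : 0 ≤ 2 * δ * τ)]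
      have := mul_le_mul_of_nonneg_left (key s) (by positivity : 0 ≤ 4 * δ ^ 2 * τ ^ 2)
      nlinarith [sq_nonneg (δ * θ * ‖x s‖ ^ 2 - τ / 2 * ‖y s‖ ^ 2),
        mul_le_mul_of_nonneg_right h7 h5]
    have h8 : |2 * δ * δ * inner ℝ (x s) (y s)| ≤ δ * ((θ * ‖x s‖ ^ 2 + ‖y s‖ ^ 2) / 2) := by
      have := mul_le_mul_of_nonneg_left (hbd s) hδ
      calc _ = δ * |2 * δ * inner ℝ (x s) (y s)| := by
            rw [← abs_of_nonneg hδ, ← abs_mul, abs_of_nonneg hδ]; ring_nf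
        _ ≤ _ := this
    have h9 := (abs_le.1 h6).1
    have h10 := (abs_le.1 h8).2
    have h11 : 4 * δ * ‖y s‖ ^ 2 ≤ τ * ‖y s‖ ^ 2 := by gcongr
    nlinarith [sq_nonneg (‖y s‖), mul_nonneg (mul_nonneg hδ hθ.le) (sq_nonneg ‖x s‖)]
  have hfin := le_exp_mul_of_deriv_le hder (fun s _ => hineq s) ht
  have hb1 := (abs_le.1 (hbd t)).1
  have hb2 := (abs_le.1 (hbd 0)).2
  have hexp := Real.exp_pos (-(2 / 3 * δ) * t)
  simp only [hL, real_inner_self_eq_norm_sq] at hfin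
  have : Real.exp (-(2 / 3 * δ) * t) * (θ * ‖x 0‖ ^ 2 + ‖y 0‖ ^ 2 + 2 * δ * inner ℝ (x 0) (y 0))
      ≤ Real.exp (-(2 / 3 * δ) * t) * (3 / 2 * (θ * ‖x 0‖ ^ 2 + ‖y 0‖ ^ 2)) := by
    gcongr; linarith
  linarith

/-- Exponential decay of the damped oscillator `x'' + τ x' + ω² x = 0`. -/
theorem oscillator_norm_le {x y : ℝ → V} {ω τ δ : ℝ} (hδ : 0 ≤ δ) (h4 : 4 * δ ≤ τ) (hω : 0 < ω)
    (h2 : 2 * δ * τ ≤ ω ^ 2) (hx : ∀ t, HasDerivAt x (y t) t)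
    (hy : ∀ t, HasDerivAt y (-τ • y t - ω ^ 2 • x t) t) {t : ℝ} (ht : 0 ≤ t) :
    ω * ‖x t‖ ≤ 2 * (Real.exp (-(1 / 3 * δ) * t) * (ω * ‖x 0‖ + ‖y 0‖)) ∧
      ‖y t‖ ≤ 2 * (Real.exp (-(1 / 3 * δ) * t) * (ω * ‖x 0‖ + ‖y 0‖)) := by
  have h := oscillator_energy_le hδ h4 (by positivity) h2 hx hy ht
  have he : Real.exp (-(2 / 3 * δ) * t) = Real.exp (-(1 / 3 * δ) * t) ^ 2 := by
    rw [← Real.exp_nat_mul]; congr 1; push_cast; ring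
  rw [he] at h
  set E := Real.exp (-(1 / 3 * δ) * t)
  have hE : 0 < E := Real.exp_pos _
  have hsq : 3 * (E ^ 2 * (ω ^ 2 * ‖x 0‖ ^ 2 + ‖y 0‖ ^ 2))
      ≤ (2 * (E * (ω * ‖x 0‖ + ‖y 0‖))) ^ 2 := by
    have h1 : 0 ≤ E ^ 2 * (ω * ‖x 0‖ * ‖y 0‖) := by positivity
    have h2 : 0 ≤ E ^ 2 * (ω ^ 2 * ‖x 0‖ ^ 2 + ‖y 0‖ ^ 2) := by positivity
    nlinarith
  constructor
  · refine le_of_sq_le_sq ?_ (by positivity)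
    nlinarith [sq_nonneg ‖y t‖]
  · refine le_of_sq_le_sq ?_ (by positivity)
    nlinarith [mul_nonneg (sq_nonneg ω) (sq_nonneg ‖x t‖)]

theorem exp_decay_eq {z : ℝ → V} {σ : ℝ} (hz : ∀ t, HasDerivAt z (-σ • z t) t) (t : ℝ) :
    z t = Real.exp (-σ * t) • z 0 := by
  have h1 : ∀ s, HasDerivAt (fun s => Real.exp (σ * s) • z s) 0 s := by
    intro s
    have h := ((hasDerivAt_id s).const_mul σ).exp.smul (hz s)
    convert! h using 1
    simp [smul_smul]
  have h2 : Real.exp (σ * t) • z t = Real.exp (σ * 0) • z 0 :=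
    is_const_of_deriv_eq_zero (fun s => (h1 s).differentiableAt) (fun s => (h1 s).deriv) t 0
  rw [mul_zero, Real.exp_zero, one_smul] at h2
  rw [← h2, smul_smul, ← Real.exp_add]
  simp

/-- Decay for `b' = -σ b + g` with an exponentially decaying forcing `g`. -/
theorem forced_decay_le {b g : ℝ → V} {σ c G κ : ℝ} (hσ : 0 < σ) (hc : 0 < c) (hG : 0 ≤ G)
    (hκσ : 2 * κ ≤ σ) (hκc : 2 * κ ≤ c)
    (hb : ∀ t, HasDerivAt b (-σ • b t + g t) t)
    (hg : ∀ t, 0 ≤ t → ‖g t‖ ≤ Real.exp (-c * t) * G) {t : ℝ} (ht : 0 ≤ t) :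
    ‖b t‖ ≤ Real.exp (-κ * t) * (‖b 0‖ + (1 + 1 / (σ * c)) * G) := by
  -- The term Q e^{-2ct} is added to ‖b‖² as a reservoir: by Young's inequality the forcing costs
  -- σ‖b‖² + (G²/σ)e^{-2ct}, and c Q = G²/σ is exactly half of the rate at which the reservoir
  -- empties.
  set Q := G ^ 2 / (σ * c) with hQ
  have hQ0 : 0 ≤ Q := by positivity
  have hQc : σ * (c * Q) = G ^ 2 := by rw [hQ]; field_simp
  have hexp : ∀ s, HasDerivAt (fun s => Real.exp (-c * s) ^ 2)
      (-2 * c * Real.exp (-c * s) ^ 2) s := by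
    intro s
    have := (((hasDerivAt_id s).const_mul (-c)).exp).pow 2
    convert! this using 1
    simp; ring
  have hL : ∀ s, HasDerivAt (fun s => inner ℝ (b s) (b s) + Q * Real.exp (-c * s) ^ 2)
      (2 * (-σ * ‖b s‖ ^ 2 + inner ℝ (b s) (g s)) + Q * (-2 * c * Real.exp (-c * s) ^ 2)) s := by
    intro s
    convert! ((hb s).inner ℝ (hb s)).add ((hexp s).const_mul Q) using 1
    simp only [inner_add_right, inner_add_left, real_inner_smul_right, real_inner_smul_left,
      real_inner_self_eq_norm_sq, real_inner_comm (b s) (g s)]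
    ring
  have hineq : ∀ s, 0 ≤ s → 2 * (-σ * ‖b s‖ ^ 2 + inner ℝ (b s) (g s))
      + Q * (-2 * c * Real.exp (-c * s) ^ 2)
      ≤ -(2 * κ) * (inner ℝ (b s) (b s) + Q * Real.exp (-c * s) ^ 2) := by
    intro s hs
    rw [real_inner_self_eq_norm_sq]
    have h1 : inner ℝ (b s) (g s) ≤ ‖b s‖ * (Real.exp (-c * s) * G) :=
      (real_inner_le_norm _ _).trans (by gcongr; exact hg s hs)
    set e := Real.exp (-c * s)
    have h2 : 2 * (‖b s‖ * (e * G)) ≤ σ * ‖b s‖ ^ 2 + e ^ 2 * (c * Q) := by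
      have h3 : σ * (2 * (‖b s‖ * (e * G))) ≤ σ * (σ * ‖b s‖ ^ 2 + e ^ 2 * (c * Q)) := by
        have : σ * (e ^ 2 * (c * Q)) = (e * G) ^ 2 := by rw [mul_pow, ← hQc]; ring
        nlinarith [sq_nonneg (σ * ‖b s‖ - e * G)]
      exact le_of_mul_le_mul_left h3 hσ
    have h4 : 2 * κ * ‖b s‖ ^ 2 ≤ σ * ‖b s‖ ^ 2 := by gcongr
    have h5 : 2 * κ * (Q * e ^ 2) ≤ c * (Q * e ^ 2) := by gcongr
    nlinarith
  have hfin := le_exp_mul_of_deriv_le hL hineq ht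
  simp only [real_inner_self_eq_norm_sq, mul_zero, Real.exp_zero, one_pow, mul_one] at hfin
  have he : Real.exp (-(2 * κ) * t) = Real.exp (-κ * t) ^ 2 := by
    rw [← Real.exp_nat_mul]; congr 1; push_cast; ring
  rw [he] at hfin
  refine le_of_sq_le_sq ?_ (by positivity)
  have h6 : ‖b 0‖ ^ 2 + Q ≤ (‖b 0‖ + (1 + 1 / (σ * c)) * G) ^ 2 := by
    have h7 : Q ≤ ((1 + 1 / (σ * c)) * G) ^ 2 := by
      have : Q = (1 / (σ * c)) * G ^ 2 := by rw [hQ]; ring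
      rw [this, mul_pow]
      have h8 : 0 < 1 / (σ * c) := by positivity
      gcongr
      nlinarith
    have h9 : 0 ≤ ‖b 0‖ * ((1 + 1 / (σ * c)) * G) := by positivity
    nlinarith
  calc ‖b t‖ ^ 2 ≤ ‖b t‖ ^ 2 + Q * Real.exp (-c * t) ^ 2 := by
        have : 0 ≤ Q * Real.exp (-c * t) ^ 2 := by positivity
        linarith
    _ ≤ Real.exp (-κ * t) ^ 2 * (‖b 0‖ ^ 2 + Q) := hfin
    _ ≤ _ := by rw [mul_pow]; gcongr

/-! ### The transverse system -/

/-- The transverse part of the linearized Navier-Stokes-Maxwell system at frequency `r`. -/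
structure Transverse (β μ r : ℝ) (b e u : ℝ → V) : Prop where
  hb : ∀ t, HasDerivAt b (-r • e t) t
  he : ∀ t, HasDerivAt e (r • b t + β • u t) t
  hu : ∀ t, HasDerivAt u (-β • e t - (μ * r ^ 2) • u t) t

/-- `-σ` is the real root of the characteristic polynomial of the transverse system, and
`τ`, `ω ^ 2` are the coefficients of the complementary quadratic factor. -/
structure CharRoot (β μ r σ τ ω : ℝ) : Prop where
  σ_pos : 0 < σ
  τ_pos : 0 < τ
  ω_pos : 0 < ω
  add_eq : σ + τ = μ * r ^ 2
  mul_eq : τ * (σ ^ 2 + r ^ 2) = β ^ 2 * σ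
  sq_eq : ω ^ 2 = r ^ 2 + β ^ 2 - σ * τ

/-- Drop the term τr² ≥ 0 in `mul_eq` and cancel σ. Together with `sq_eq` this gives r² ≤ ω², the
bound from below for ω that is used in every frequency regime. -/
theorem CharRoot.mul_le {β μ r σ τ ω : ℝ} (h : CharRoot β μ r σ τ ω) : σ * τ ≤ β ^ 2 := by
  have h1 := h.σ_pos
  have h2 := h.τ_pos
  have : (σ * τ) * σ ≤ β ^ 2 * σ := by rw [← h.mul_eq]; nlinarith [sq_nonneg r]
  exact le_of_mul_le_mul_right this h1

/-- The characteristic polynomial evaluated at -s equals μr⁴ > 0 at s = 0 and -β²μr² < 0 at s = μr²,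
so it has a root in between; τ is then forced to be μr² - σ. -/
theorem exists_charRoot {β μ r : ℝ} (hβ : 0 < β) (hμ : 0 < μ) (hr : 0 < r) :
    ∃ σ τ ω, CharRoot β μ r σ τ ω := by
  set f : ℝ → ℝ := fun s => (μ * r ^ 2 - s) * (s ^ 2 + r ^ 2) - β ^ 2 * s with hf
  have hc : ContinuousOn f (Icc 0 (μ * r ^ 2)) := by fun_prop
  have h0 : (0 : ℝ) ∈ Ioo (f (μ * r ^ 2)) (f 0) := by
    constructor <;> simp only [hf]
    · have : 0 < β ^ 2 * (μ * r ^ 2) := by positivity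
      linarith
    · have : 0 < μ * r ^ 2 * r ^ 2 := by positivity
      nlinarith
  obtain ⟨σ, ⟨h1, h2⟩, h3⟩ := intermediate_value_Ioo' (by positivity) hc h0
  have h4 : (μ * r ^ 2 - σ) * (σ ^ 2 + r ^ 2) = β ^ 2 * σ := by
    simp only [hf] at h3; linarith
  have h5 : σ * (μ * r ^ 2 - σ) ≤ β ^ 2 := by
    have : (σ * (μ * r ^ 2 - σ)) * σ ≤ β ^ 2 * σ := by
      rw [← h4]; nlinarith [sq_nonneg r]
    exact le_of_mul_le_mul_right this h1
  have h6 : 0 < r ^ 2 + β ^ 2 - σ * (μ * r ^ 2 - σ) := by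
    have : 0 < r ^ 2 := by positivity
    linarith
  exact ⟨σ, μ * r ^ 2 - σ, √(r ^ 2 + β ^ 2 - σ * (μ * r ^ 2 - σ)), h1, by linarith,
    Real.sqrt_pos.2 h6, by ring, h4, Real.sq_sqrt h6.le⟩

section modes

variable {β μ r σ τ ω : ℝ} {b e u : ℝ → V}

/-- This compares the constant terms of the factored characteristic polynomial. Once ω is
controlled, it shows that σ has the size of r⁴ at low frequencies. -/
theorem CharRoot.sq_mul_eq (h : CharRoot β μ r σ τ ω) : ω ^ 2 * σ = μ * r ^ 4 := by
  have h1 := h.sq_eq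
  have h2 := h.mul_eq
  have h3 := h.add_eq
  have : ω ^ 2 * σ = r ^ 2 * (σ + τ) := by rw [h1]; linarith
  rw [this, h3]; ring

/-- The slow mode of the transverse system decays at the rate `σ`. -/
theorem Transverse.slow_mode (H : Transverse β μ r b e u) (h : CharRoot β μ r σ τ ω) (hβ : 0 < β)
    (t : ℝ) :
    r • b t - σ • e t - ((σ ^ 2 + r ^ 2) / β) • u t
      = Real.exp (-σ * t) • (r • b 0 - σ • e 0 - ((σ ^ 2 + r ^ 2) / β) • u 0) := by
  -- The combination is a left eigenvector of the transverse matrix for the eigenvalue -σ.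
  refine exp_decay_eq (z := fun t => r • b t - σ • e t - ((σ ^ 2 + r ^ 2) / β) • u t)
    (fun s => ?_) t
  convert! (((H.hb s).const_smul r).sub ((H.he s).const_smul σ)).sub
    ((H.hu s).const_smul ((σ ^ 2 + r ^ 2) / β)) using 1
  have h2 : σ * ((σ ^ 2 + r ^ 2) / β) = -(σ * β) + (σ ^ 2 + r ^ 2) / β * (μ * r ^ 2) := by
    have := h.mul_eq
    rw [← h.add_eq]
    field_simp
    linarith
  have h3 : σ * σ = -(r * r) + (σ ^ 2 + r ^ 2) / β * β := by field_simp; ring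
  match_scalars
  · ring
  · linarith
  · linarith

/-- Since b' + σb = -r(e - (σ/r)b), the operator d/dt + σ has been applied to `b`, which removes the
root -σ. What remains satisfies the quadratic factor, that is x'' + τx' + ω²x = 0 for x = e -
(σ/r)b, and x' = βu + rb + σe. -/
theorem Transverse.fast_mode (H : Transverse β μ r b e u) (h : CharRoot β μ r σ τ ω) (hr : 0 < r)
    {δ : ℝ} (hδ : 0 ≤ δ) (h4 : 4 * δ ≤ τ) (h2 : 2 * δ * τ ≤ ω ^ 2) {t : ℝ} (ht : 0 ≤ t) :
    ω * ‖e t - (σ / r) • b t‖ ≤ 2 * (Real.exp (-(1 / 3 * δ) * t) *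
        (ω * ‖e 0 - (σ / r) • b 0‖ + ‖β • u 0 + r • b 0 + σ • e 0‖)) ∧
      ‖β • u t + r • b t + σ • e t‖ ≤ 2 * (Real.exp (-(1 / 3 * δ) * t) *
        (ω * ‖e 0 - (σ / r) • b 0‖ + ‖β • u 0 + r • b 0 + σ • e 0‖)) := by
  refine oscillator_norm_le (x := fun t => e t - (σ / r) • b t)
    (y := fun t => β • u t + r • b t + σ • e t) hδ h4 h.ω_pos h2 (fun s => ?_) (fun s => ?_) ht
  · convert! (H.he s).sub ((H.hb s).const_smul (σ / r)) using 1
    match_scalars <;> field_simp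
  · convert! (((H.hu s).const_smul β).add ((H.hb s).const_smul r)).add
      ((H.he s).const_smul σ) using 1
    have h3 := h.add_eq
    have h5 := h.sq_eq
    have h6 := h.sq_mul_eq
    match_scalars
    · rw [← h3]; ring
    · have : ω ^ 2 * (σ / r) = μ * r ^ 3 := by field_simp; linarith
      have h7 : σ * r = μ * r ^ 3 - τ * r := by
        have : (σ + τ) * r = μ * r ^ 2 * r := by rw [h3]
        linarith
      linarith
    · linarith

end modes

end ODE

/-! ### The transverse system at low, high and intermediate frequencies -/

section Regimes

variable {V : Type*} [NormedAddCommGroup V] [InnerProductSpace ℝ V] {β μ : ℝ}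

/-- Reconstruction of the magnetic field from the slow mode `z` and the fast modes `x`, `y`. -/
theorem mul_norm_b_le {r σ K N : ℝ} {b e u : V} (hβ : 0 < β) (hr : 0 < r) (hσ : 0 < σ)
    (hK : K = (σ ^ 2 + r ^ 2) / β) (hN : N = r ^ 2 - σ ^ 2 + K ^ 2) (hN0 : 0 ≤ N) :
    N * ‖b‖ ≤ r * ‖r • b - σ • e - K • u‖ + r * σ * (1 + K / β) * ‖e - (σ / r) • b‖
      + r * K / β * ‖β • u + r • b + σ • e‖ := by
  have hK0 : 0 < K := by rw [hK]; positivity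
  -- This inverts the change to mode coordinates. For a characteristic root, N is K/β times the
  -- value of the quadratic factor at -σ, so it vanishes exactly when -σ is a multiple root.
  have h : N • b = r • (r • b - σ • e - K • u) + (r * σ * (1 - K / β)) • (e - (σ / r) • b)
      + (r * K / β) • (β • u + r • b + σ • e) := by
    have h1 : K * β = σ ^ 2 + r ^ 2 := by rw [hK]; field_simp
    match_scalars
    · rw [hN]
      field_simp
      rw [← sub_eq_zero]
      have : σ ^ 2 = K * β - r ^ 2 := by linarith
      ring_nf
      rw [this]; ring
    · field_simp; ring
    · field_simp; ring
  calc N * ‖b‖ = ‖N • b‖ := by rw [norm_smul, Real.norm_of_nonneg hN0]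
    _ ≤ ‖r • (r • b - σ • e - K • u)‖ + ‖(r * σ * (1 - K / β)) • (e - (σ / r) • b)‖
      + ‖(r * K / β) • (β • u + r • b + σ • e)‖ := by rw [h]; exact norm_add₃_le
    _ ≤ _ := by
      rw [norm_smul, norm_smul, norm_smul, Real.norm_of_nonneg hr.le,
        Real.norm_of_nonneg (by positivity : 0 ≤ r * K / β), norm_mul,
        Real.norm_of_nonneg (by positivity : 0 ≤ r * σ)]
      have : ‖1 - K / β‖ ≤ 1 + K / β := by
        refine (norm_sub_le _ _).trans ?_
        rw [norm_one, Real.norm_of_nonneg (by positivity)]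
      gcongr

theorem norm_e_le {r σ : ℝ} {b e : V} (hr : 0 < r) (hσ : 0 < σ) :
    ‖e‖ ≤ ‖e - (σ / r) • b‖ + σ / r * ‖b‖ := by
  calc ‖e‖ = ‖(e - (σ / r) • b) + (σ / r) • b‖ := by simp
    _ ≤ _ := (norm_add_le _ _).trans (by rw [norm_smul, Real.norm_of_nonneg (by positivity)])

theorem mul_norm_u_le {r σ : ℝ} {b e u : V} (hβ : 0 < β) (hr : 0 < r) (hσ : 0 < σ) :
    β * ‖u‖ ≤ ‖β • u + r • b + σ • e‖ + r * ‖b‖ + σ * ‖e‖ := by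
  calc β * ‖u‖ = ‖(β • u + r • b + σ • e) - r • b - σ • e‖ := by
        rw [show (β • u + r • b + σ • e) - r • b - σ • e = β • u by abel, norm_smul,
          Real.norm_of_nonneg hβ.le]
    _ ≤ ‖β • u + r • b + σ • e‖ + ‖r • b‖ + ‖σ • e‖ :=
        (norm_sub_le _ _).trans (by gcongr; exact norm_sub_le _ _)
    _ = _ := by rw [norm_smul, norm_smul, Real.norm_of_nonneg hr.le, Real.norm_of_nonneg hσ.le]

theorem norm_lin_le {r σ K : ℝ} {b e u : V} (hr : 0 ≤ r) (hσ : 0 ≤ σ) (hK : 0 ≤ K) :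
    ‖r • b - σ • e - K • u‖ ≤ r * ‖b‖ + σ * ‖e‖ + K * ‖u‖ := by
  calc _ ≤ ‖r • b‖ + ‖σ • e‖ + ‖K • u‖ :=
        (norm_sub_le _ _).trans (by gcongr; exact norm_sub_le _ _)
    _ = _ := by
      rw [norm_smul, norm_smul, norm_smul, Real.norm_of_nonneg hr, Real.norm_of_nonneg hσ,
        Real.norm_of_nonneg hK]

theorem norm_lin_le' {r σ : ℝ} {b e u : V} (hβ : 0 ≤ β) (hr : 0 ≤ r) (hσ : 0 ≤ σ) :
    ‖β • u + r • b + σ • e‖ ≤ β * ‖u‖ + r * ‖b‖ + σ * ‖e‖ := by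
  calc _ ≤ ‖β • u‖ + ‖r • b‖ + ‖σ • e‖ := norm_add₃_le
    _ = _ := by
      rw [norm_smul, norm_smul, norm_smul, Real.norm_of_nonneg hr, Real.norm_of_nonneg hσ,
        Real.norm_of_nonneg hβ]

theorem norm_diff_le {r σ : ℝ} {b e : V} (hr : 0 < r) (hσ : 0 < σ) :
    ‖e - (σ / r) • b‖ ≤ ‖e‖ + σ / r * ‖b‖ := by
  refine (norm_sub_le _ _).trans ?_
  rw [norm_smul, Real.norm_of_nonneg (by positivity)]

set_option maxHeartbeats 1000000 in
/-- Low-frequency decay for the transverse system. -/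
theorem Transverse.low_freq (V : Type*) [NormedAddCommGroup V] [InnerProductSpace ℝ V]
    (hβ : 0 < β) (hμ : 0 < μ) :
    ∃ r₀ > 0, r₀ ≤ 1 ∧ ∃ c > 0, ∃ C > 0, ∀ r, 0 < r → r ≤ r₀ → ∀ b e u : ℝ → V,
      Transverse β μ r b e u → ∀ t, 0 ≤ t →
      ‖b t‖ ≤ C * (Real.exp (-(c * r ^ 4) * t) * (‖b 0‖ + r ^ 3 * ‖e 0‖ + r * ‖u 0‖)
          + Real.exp (-(c * r ^ 2) * t) * (r * ‖e 0‖)) ∧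
      ‖e t‖ ≤ C * (Real.exp (-(c * r ^ 4) * t) * (r ^ 3 * ‖b 0‖ + r ^ 3 * ‖e 0‖ + r ^ 3 * ‖u 0‖)
          + Real.exp (-(c * r ^ 2) * t) * (r * ‖b 0‖ + ‖e 0‖ + ‖u 0‖)) ∧
      ‖u t‖ ≤ C * (Real.exp (-(c * r ^ 4) * t) * (r * ‖b 0‖ + r ^ 2 * ‖e 0‖ + r ^ 2 * ‖u 0‖)
          + Real.exp (-(c * r ^ 2) * t) * (‖e 0‖ + ‖u 0‖)) := by
  obtain ⟨s0, hs0⟩ : ∃ x, x = μ / (1 + β ^ 2) := ⟨_, rfl⟩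
  obtain ⟨s1, hs1⟩ : ∃ x, x = 2 * μ / β ^ 2 := ⟨_, rfl⟩
  obtain ⟨k1, hk1⟩ : ∃ x, x = 2 / β := ⟨_, rfl⟩
  obtain ⟨C1, hC1⟩ : ∃ x, x = 2 * s1 * (1 + k1 / β) * (2 / β) + 2 * k1 / β := ⟨_, rfl⟩
  obtain ⟨C2, hC2⟩ : ∃ x, x = 2 * ((1 + β) * (1 + s1) + β + 1 + s1) := ⟨_, rfl⟩
  have ps0 : 0 < s0 := by rw [hs0]; positivity
  have ps1 : 0 < s1 := by rw [hs1]; positivity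
  have pk1 : 0 < k1 := by rw [hk1]; positivity
  have pC1 : 0 < C1 := by rw [hC1]; positivity
  have pC2 : 0 < C2 := by rw [hC2]; positivity
  -- The bound μr₀ ≤ 1/2 gives σ ≤ r/2, hence N ≥ r²/2 and ω² ≥ β²/2. The bound r₀ ≤ β/2 gives σ ≤
  -- μr²/2, so that τ is comparable to μr².
  obtain ⟨r₀, pr₀, hr₀1, hr₀μ, hr₀β⟩ :
      ∃ r₀ : ℝ, 0 < r₀ ∧ r₀ ≤ 1 ∧ μ * r₀ ≤ 1 / 2 ∧ r₀ ≤ β / 2 := by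
    refine ⟨min 1 (min (1 / 2 / μ) (β / 2)), by positivity, min_le_left _ _, ?_,
      (min_le_right _ _).trans (min_le_right _ _)⟩
    calc μ * min 1 (min (1 / 2 / μ) (β / 2)) ≤ μ * (1 / 2 / μ) := by
          gcongr; exact (min_le_right _ _).trans (min_le_left _ _)
      _ = 1 / 2 := by field_simp
  obtain ⟨C3, hC3⟩ : ∃ x, x = 2 + 2 * s1 + 2 * k1 + C1 * C2 := ⟨_, rfl⟩
  have pC3 : 0 < C3 := by rw [hC3]; positivity
  obtain ⟨C4, hC4⟩ : ∃ x, x = 2 / β * C2 + s1 * C3 := ⟨_, rfl⟩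
  have pC4 : 0 < C4 := by rw [hC4]; positivity
  obtain ⟨C5, hC5⟩ : ∃ x, x = (C2 + C3 + s1 * C4) / β := ⟨_, rfl⟩
  have pC5 : 0 < C5 := by rw [hC5]; positivity
  -- Here s0·r⁴ bounds σ from below, and μ/24 comes from the rate δ/3 of the fast modes with δ =
  -- μr²/8.
  refine ⟨r₀, pr₀, hr₀1, min s0 (μ / 24), by positivity, C3 + C4 + 2 * C5, by positivity, ?_⟩
  intro r hr hrr b e u H t ht
  obtain ⟨σ, τ, ω, h⟩ := exists_charRoot hβ hμ hr
  have pσ := h.σ_pos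
  have pτ := h.τ_pos
  have pω := h.ω_pos
  have hr1 : r ≤ 1 := hrr.trans hr₀1
  have hμr : μ * r ≤ 1 / 2 := (by gcongr : μ * r ≤ μ * r₀).trans hr₀μ
  have hrβ : r ≤ β / 2 := hrr.trans hr₀β
  have hσμ : σ ≤ μ * r ^ 2 := by linarith [h.add_eq]
  have hσr : σ ≤ r / 2 := by
    have : μ * r * r ≤ 1 / 2 * r := by gcongr
    linarith
  have hr2 : 0 < r ^ 2 := by positivity
  have hr3 : r ^ 3 ≤ r := pow_le_of_le_one hr.le hr1 (by norm_num)
  have hr41 : r ^ 4 ≤ 1 := pow_le_one₀ hr.le hr1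
  have hr21 : r ^ 2 ≤ 1 := pow_le_one₀ hr.le hr1
  have hrr1 : r * r ≤ 1 := by rw [← sq]; exact hr21
  have hr42 : r ^ 4 ≤ r ^ 2 := pow_le_pow_of_le_one hr.le hr1 (by norm_num)
  have hσr2 : σ ^ 2 ≤ r ^ 2 / 2 := by
    have : σ ^ 2 ≤ (r / 2) ^ 2 := by gcongr
    linarith
  -- bounds for the characteristic exponents
  have hστ : σ * τ ≤ β ^ 2 / 2 := by
    have h1 := h.mul_eq
    have h2 : σ * τ * r ^ 2 ≤ β ^ 2 * σ ^ 2 := by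
      have h3 := mul_nonneg (mul_nonneg pσ.le pτ.le) (sq_nonneg σ)
      have h4 : σ * (τ * (σ ^ 2 + r ^ 2)) = σ * (β ^ 2 * σ) := by rw [h1]
      linarith
    have h4 : σ * τ * r ^ 2 ≤ β ^ 2 / 2 * r ^ 2 := by
      have := mul_le_mul_of_nonneg_left hσr2 (sq_nonneg β)
      linarith
    exact le_of_mul_le_mul_right h4 hr2
  have hω1 : β ^ 2 / 2 ≤ ω ^ 2 := by rw [h.sq_eq]; linarith
  have hω1' : r ^ 2 ≤ ω ^ 2 := by rw [h.sq_eq]; linarith [h.mul_le]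
  have hω2 : ω ^ 2 ≤ 1 + β ^ 2 := by
    rw [h.sq_eq]; linarith [mul_pos pσ pτ, pow_le_one₀ hr.le hr1 (n := 2)]
  have hω3 : β / 2 ≤ ω := by
    refine le_of_sq_le_sq ?_ pω.le
    linarith [sq_nonneg β]
  have hω4 : ω ≤ 1 + β := le_of_sq_le_sq (by linarith) (by positivity)
  have hσ1 : σ ≤ s1 * r ^ 4 := by
    have h1 := h.sq_mul_eq
    have h2 : β ^ 2 / 2 * σ ≤ μ * r ^ 4 := by rw [← h1]; gcongr
    rw [hs1, div_mul_eq_mul_div, le_div_iff₀ (by positivity)]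
    linarith
  have hσ0 : s0 * r ^ 4 ≤ σ := by
    have h1 := h.sq_mul_eq
    have h2 : μ * r ^ 4 ≤ (1 + β ^ 2) * σ := by rw [← h1]; gcongr
    rw [hs0, div_mul_eq_mul_div, div_le_iff₀ (by positivity)]
    linarith
  have hσ2 : σ ≤ μ * r ^ 2 / 2 := by
    refine hσ1.trans ?_
    rw [hs1]
    have h1 : r ^ 2 ≤ β ^ 2 / 4 := by
      have : r ^ 2 ≤ (β / 2) ^ 2 := by gcongr
      linarith
    calc 2 * μ / β ^ 2 * r ^ 4 = 2 * μ / β ^ 2 * r ^ 2 * r ^ 2 := by ring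
      _ ≤ 2 * μ / β ^ 2 * r ^ 2 * (β ^ 2 / 4) := by gcongr
      _ = _ := by field_simp; ring
  have hτ1 : μ * r ^ 2 / 2 ≤ τ := by linarith [h.add_eq]
  have hτ2 : τ ≤ μ * r ^ 2 := by linarith [h.add_eq]
  obtain ⟨K, hK⟩ : ∃ x, x = (σ ^ 2 + r ^ 2) / β := ⟨_, rfl⟩
  have pK : 0 < K := by rw [hK]; positivity
  have hK1 : K ≤ k1 * r ^ 2 := by
    rw [hK, hk1, div_mul_eq_mul_div]; gcongr; linarith
  obtain ⟨N, hN⟩ : ∃ x, x = r ^ 2 - σ ^ 2 + K ^ 2 := ⟨_, rfl⟩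
  have hN1 : r ^ 2 / 2 ≤ N := by rw [hN]; linarith [sq_nonneg K]
  -- the modes
  obtain ⟨hx, hy⟩ := H.fast_mode h hr (δ := μ * r ^ 2 / 8) (by positivity) (by linarith)
    (by
      calc 2 * (μ * r ^ 2 / 8) * τ ≤ 2 * (μ * r ^ 2 / 8) * (μ * r ^ 2) := by gcongr
        _ = (μ * r) ^ 2 * r ^ 2 / 4 := by ring
        _ ≤ 1 * r ^ 2 / 4 := by gcongr; exact pow_le_one₀ (by positivity) (by linarith)
        _ ≤ ω ^ 2 := by linarith) ht
  have hz := H.slow_mode h hβ t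
  rw [← hK] at hz
  have hz' : ‖r • b t - σ • e t - K • u t‖ ≤ Real.exp (-(min s0 (μ / 24) * r ^ 4) * t)
      * (r * ‖b 0‖ + s1 * r ^ 4 * ‖e 0‖ + k1 * r ^ 2 * ‖u 0‖) := by
    rw [hz, norm_smul, Real.norm_of_nonneg (Real.exp_pos _).le]
    gcongr
    · exact le_trans (by gcongr; exact min_le_left _ _) hσ0
    · exact (norm_lin_le hr.le pσ.le pK.le).trans (by gcongr)
  set E4 := Real.exp (-(min s0 (μ / 24) * r ^ 4) * t)
  set E2 := Real.exp (-(min s0 (μ / 24) * r ^ 2) * t)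
  have hE24 : E2 ≤ E4 := by
    apply Real.exp_le_exp.2
    have : r ^ 4 ≤ r ^ 2 := pow_le_pow_of_le_one hr.le hr1 (by norm_num)
    gcongr
  have pE2 : 0 < E2 := Real.exp_pos _
  have pE4 : 0 < E4 := Real.exp_pos _
  have hσr3 : σ / r ≤ s1 * r ^ 3 := by
    rw [div_le_iff₀ hr]; linarith [hσ1, (by ring : s1 * r ^ 3 * r = s1 * r ^ 4)]
  have hD : 2 * (Real.exp (-(1 / 3 * (μ * r ^ 2 / 8)) * t) *
        (ω * ‖e 0 - (σ / r) • b 0‖ + ‖β • u 0 + r • b 0 + σ • e 0‖))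
      ≤ C2 * (E2 * (r * ‖b 0‖ + ‖e 0‖ + ‖u 0‖)) := by
    have h1 : Real.exp (-(1 / 3 * (μ * r ^ 2 / 8)) * t) ≤ E2 := by
      apply Real.exp_le_exp.2
      have : min s0 (μ / 24) * r ^ 2 ≤ μ / 24 * r ^ 2 := by gcongr; exact min_le_right _ _
      have := mul_le_mul_of_nonneg_right this ht
      linarith
    have h2 : ω * ‖e 0 - (σ / r) • b 0‖ ≤ (1 + β) * (‖e 0‖ + s1 * (r * ‖b 0‖)) := by
      gcongr
      refine (norm_diff_le hr pσ).trans ?_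
      have : σ / r * ‖b 0‖ ≤ s1 * r ^ 3 * ‖b 0‖ := by gcongr
      have h5 : s1 * r ^ 3 * ‖b 0‖ ≤ s1 * r * ‖b 0‖ := by gcongr
      linarith
    have h3 : ‖β • u 0 + r • b 0 + σ • e 0‖ ≤ β * ‖u 0‖ + r * ‖b 0‖ + s1 * ‖e 0‖ := by
      refine (norm_lin_le' hβ.le hr.le pσ.le).trans ?_
      gcongr
      exact hσ1.trans (mul_le_of_le_one_right ps1.le hr41)
    calc _ ≤ 2 * (E2 * ((1 + β) * (‖e 0‖ + s1 * (r * ‖b 0‖))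
          + (β * ‖u 0‖ + r * ‖b 0‖ + s1 * ‖e 0‖))) := by gcongr
      _ ≤ _ := by
        rw [← sub_nonneg, hC2]
        have : 2 * ((1 + β) * (1 + s1) + β + 1 + s1) * (E2 * (r * ‖b 0‖ + ‖e 0‖ + ‖u 0‖))
          - 2 * (E2 * ((1 + β) * (‖e 0‖ + s1 * (r * ‖b 0‖))
          + (β * ‖u 0‖ + r * ‖b 0‖ + s1 * ‖e 0‖))) =
          2 * E2 * ((1 + β) * r * ‖b 0‖ + (1 + β) * s1 * ‖e 0‖ + (1 + β) * (1 + s1) * ‖u 0‖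
            + (1 + s1) * ‖u 0‖ + (β + s1) * (r * ‖b 0‖) + (β + 1) * ‖e 0‖) := by ring
        rw [this]; positivity
  have hx' := hx.trans hD
  have hy' := hy.trans hD
  set D := E2 * (r * ‖b 0‖ + ‖e 0‖ + ‖u 0‖) with hDdef
  have pD : 0 ≤ D := by positivity
  have hX : ‖e t - (σ / r) • b t‖ ≤ 2 / β * (C2 * D) := by
    have h1 : β / 2 * ‖e t - (σ / r) • b t‖ ≤ C2 * D := le_trans (by gcongr) hx'
    rw [div_mul_eq_mul_div, le_div_iff₀ hβ]; linarith
  have hb := mul_norm_b_le (b := b t) (e := e t) (u := u t) hβ hr pσ hK hN (by linarith [hr2])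
  have hb1 : ‖b t‖ ≤ C3 * (E4 * (‖b 0‖ + r ^ 3 * ‖e 0‖ + r * ‖u 0‖) + E2 * (r * ‖e 0‖)) := by
    have h1 : r ^ 2 / 2 * ‖b t‖ ≤ r ^ 2 / 2 * (2 * (E4 * (‖b 0‖ + s1 * r ^ 3 * ‖e 0‖
        + k1 * r * ‖u 0‖)) + C1 * (r * (C2 * D))) := by
      calc _ ≤ N * ‖b t‖ := by gcongr
        _ ≤ _ := hb
        _ ≤ r * (E4 * (r * ‖b 0‖ + s1 * r ^ 4 * ‖e 0‖ + k1 * r ^ 2 * ‖u 0‖))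
            + r * (s1 * r ^ 2) * (1 + k1 / β) * (2 / β * (C2 * D))
            + r * (k1 * r ^ 2) / β * (C2 * D) := by
          have h2 : s1 * r ^ 4 ≤ s1 * r ^ 2 := by gcongr 1
          have h3 : K ≤ k1 := hK1.trans (mul_le_of_le_one_right pk1.le hr21)
          gcongr
          exact hσ1.trans h2
        _ = _ := by rw [hC1]; ring
    have h2 := le_of_mul_le_mul_left h1 (by positivity)
    -- The fast contributions of `b 0` and `u 0` can be charged to the slower exponential, whose
    -- coefficients there are 1 and r. This is impossible for `e 0`, whose slow coefficient is only
    -- r³; its fast term r‖e 0‖ is therefore kept.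
    have h3 : r * D ≤ E4 * (‖b 0‖ + r * ‖u 0‖) + E2 * (r * ‖e 0‖) := by
      have h4 : E2 * (r * r) * ‖b 0‖ ≤ E4 * 1 * ‖b 0‖ := by gcongr
      have h5 : E2 * (r * ‖u 0‖) ≤ E4 * (r * ‖u 0‖) := by gcongr
      rw [hDdef]; linarith
    have h4 := mul_le_mul_of_nonneg_left h3 (by positivity : 0 ≤ C1 * C2)
    refine h2.trans ?_
    calc _ ≤ 2 * (E4 * (‖b 0‖ + s1 * r ^ 3 * ‖e 0‖ + k1 * r * ‖u 0‖))
          + C1 * C2 * (E4 * (‖b 0‖ + r * ‖u 0‖) + E2 * (r * ‖e 0‖)) := by linarith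
      _ ≤ _ := by
        rw [← sub_nonneg, hC3]
        have : (2 + 2 * s1 + 2 * k1 + C1 * C2) * (E4 * (‖b 0‖ + r ^ 3 * ‖e 0‖ + r * ‖u 0‖)
            + E2 * (r * ‖e 0‖)) - (2 * (E4 * (‖b 0‖ + s1 * r ^ 3 * ‖e 0‖ + k1 * r * ‖u 0‖))
          + C1 * C2 * (E4 * (‖b 0‖ + r * ‖u 0‖) + E2 * (r * ‖e 0‖))) =
          (2 * s1 + 2 * k1) * E4 * ‖b 0‖ + (2 + 2 * k1 + C1 * C2) * E4 * r ^ 3 * ‖e 0‖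
            + (2 + 2 * s1) * E4 * r * ‖u 0‖ + (2 + 2 * s1 + 2 * k1) * E2 * r * ‖e 0‖ := by ring
        rw [this]; positivity
  have he1 : ‖e t‖ ≤ C4 * (E4 * (r ^ 3 * ‖b 0‖ + r ^ 3 * ‖e 0‖ + r ^ 3 * ‖u 0‖) + D) := by
    have h1 : r ^ 3 * (E4 * (‖b 0‖ + r ^ 3 * ‖e 0‖ + r * ‖u 0‖) + E2 * (r * ‖e 0‖))
        ≤ E4 * (r ^ 3 * ‖b 0‖ + r ^ 3 * ‖e 0‖ + r ^ 3 * ‖u 0‖) + D := by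
      have h2 : E4 * r ^ 3 * (r ^ 3 * ‖e 0‖) ≤ E4 * r ^ 3 * (1 * ‖e 0‖) := by
        gcongr; exact hr3.trans hr1
      have h3 : E4 * r ^ 3 * (r * ‖u 0‖) ≤ E4 * r ^ 3 * (1 * ‖u 0‖) := by gcongr
      have h4 : E2 * r ^ 4 * ‖e 0‖ ≤ E2 * 1 * ‖e 0‖ := by gcongr
      have h5 : 0 ≤ E2 * (r * ‖b 0‖ + ‖u 0‖) := by positivity
      rw [hDdef]; linarith
    calc ‖e t‖ ≤ _ := norm_e_le (b := b t) hr pσ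
      _ ≤ 2 / β * (C2 * D) + s1 * r ^ 3 * (C3 * (E4 * (‖b 0‖ + r ^ 3 * ‖e 0‖ + r * ‖u 0‖)
          + E2 * (r * ‖e 0‖))) := by gcongr
      _ ≤ 2 / β * C2 * D + s1 * C3 * (E4 * (r ^ 3 * ‖b 0‖ + r ^ 3 * ‖e 0‖ + r ^ 3 * ‖u 0‖)
          + D) := by
        have := mul_le_mul_of_nonneg_left h1 (by positivity : 0 ≤ s1 * C3)
        linarith
      _ ≤ _ := by
        rw [hC4]
        have : 0 ≤ 2 / β * C2 * (E4 * (r ^ 3 * ‖b 0‖ + r ^ 3 * ‖e 0‖ + r ^ 3 * ‖u 0‖)) := by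
          positivity
        linarith
  have hu1 : ‖u t‖ ≤ 2 * C5 * (E4 * (r * ‖b 0‖ + r ^ 2 * ‖e 0‖ + r ^ 2 * ‖u 0‖)
          + E2 * (‖e 0‖ + ‖u 0‖)) := by
    set W := E4 * (r * ‖b 0‖ + r ^ 2 * ‖e 0‖ + r ^ 2 * ‖u 0‖) + E2 * (‖e 0‖ + ‖u 0‖) with hW
    have hDW : D ≤ W := by
      have h2 : E2 * (r * ‖b 0‖) ≤ E4 * (r * ‖b 0‖) := by gcongr
      have h3 : 0 ≤ E4 * (r ^ 2 * ‖e 0‖ + r ^ 2 * ‖u 0‖) := by positivity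
      rw [hDdef, hW]; linarith
    have h1 : r * ‖b t‖ ≤ C3 * W := by
      have h5 : r * (E4 * (‖b 0‖ + r ^ 3 * ‖e 0‖ + r * ‖u 0‖) + E2 * (r * ‖e 0‖)) ≤ W := by
        have h2 : E4 * r ^ 2 * (r ^ 2 * ‖e 0‖) ≤ E4 * r ^ 2 * (1 * ‖e 0‖) := by
          gcongr
        have h4 : E2 * (r * r) * ‖e 0‖ ≤ E2 * 1 * ‖e 0‖ := by gcongr
        have h5 : 0 ≤ E2 * ‖u 0‖ := by positivity
        rw [hW]; linarith
      calc r * ‖b t‖ ≤ r * _ := mul_le_mul_of_nonneg_left hb1 hr.le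
        _ ≤ C3 * W := by
          have := mul_le_mul_of_nonneg_left h5 pC3.le
          linarith
    have h2 : σ * ‖e t‖ ≤ s1 * (C4 * (2 * W)) := by
      have h5 : E4 * (r ^ 3 * ‖b 0‖ + r ^ 3 * ‖e 0‖ + r ^ 3 * ‖u 0‖) ≤ W := by
        have h6 : r ^ 3 ≤ r ^ 2 := pow_le_pow_of_le_one hr.le hr1 (by norm_num)
        have h7 : E4 * (r ^ 3 * ‖b 0‖ + r ^ 3 * ‖e 0‖ + r ^ 3 * ‖u 0‖) ≤
          E4 * (r * ‖b 0‖ + r ^ 2 * ‖e 0‖ + r ^ 2 * ‖u 0‖) := by gcongr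
        have h8 : 0 ≤ E2 * (‖e 0‖ + ‖u 0‖) := by positivity
        rw [hW]; linarith
      have h9 : σ ≤ s1 := hσ1.trans (mul_le_of_le_one_right ps1.le hr41)
      gcongr
      exact he1.trans (by gcongr; linarith)
    have h3 := mul_norm_u_le (b := b t) (e := e t) (u := u t) hβ hr pσ
    have h4 : β * ‖u t‖ ≤ β * (2 * C5 * W) := by
      have pW : 0 ≤ W := pD.trans hDW
      have h6 : C2 * D ≤ C2 * W := by gcongr
      have h7 : β * (2 * C5 * W) = 2 * (C2 + C3 + s1 * C4) * W := by rw [hC5]; field_simp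
      have h8 : 0 ≤ (C2 + C3) * W := by positivity
      rw [h7]; linarith
    exact le_of_mul_le_mul_left h4 hβ
  refine ⟨hb1.trans ?_, he1.trans ?_, hu1.trans ?_⟩ <;> gcongr <;> linarith

set_option maxHeartbeats 1000000 in
/-- High-frequency decay for the transverse system, with the loss of regularity. -/
theorem Transverse.high_freq (V : Type*) [NormedAddCommGroup V] [InnerProductSpace ℝ V]
    (hβ : 0 < β) (hμ : 0 < μ) :
    ∃ R ≥ 1, ∃ c > 0, ∃ C > 0, ∀ r, R ≤ r → ∀ b e u : ℝ → V,
      Transverse β μ r b e u → ∀ t, 0 ≤ t →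
      r ^ 2 * ‖b t‖ ≤ C * (Real.exp (-(c / r ^ 2) * t)
          * (r ^ 2 * ‖b 0‖ + r ^ 2 * ‖e 0‖ + ‖u 0‖)) ∧
      r ^ 2 * ‖e t‖ ≤ C * (Real.exp (-(c / r ^ 2) * t)
          * (r ^ 2 * ‖b 0‖ + r ^ 2 * ‖e 0‖ + ‖u 0‖)) ∧
      r ^ 4 * ‖u t‖ ≤ C * (Real.exp (-(c / r ^ 2) * t)
          * (r ^ 2 * ‖b 0‖ + r ^ 2 * ‖e 0‖ + ‖u 0‖) + Real.exp (-c * t) * (r ^ 4 * ‖u 0‖)) := by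
  obtain ⟨c1, hc1⟩ : ∃ x, x = β ^ 2 * μ / (2 * (μ ^ 2 + 1)) := ⟨_, rfl⟩
  obtain ⟨k2, hk2⟩ : ∃ x, x = (μ ^ 2 + 1) / β := ⟨_, rfl⟩
  obtain ⟨k0, hk0⟩ : ∃ x, x = μ ^ 2 / (8 * β) := ⟨_, rfl⟩
  obtain ⟨n0, hn0⟩ : ∃ x, x = μ ^ 4 / (32 * β ^ 2) := ⟨_, rfl⟩
  have pc1 : 0 < c1 := by rw [hc1]; positivity
  have pk2 : 0 < k2 := by rw [hk2]; positivity
  have pk0 : 0 < k0 := by rw [hk0]; positivity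
  have pn0 : 0 < n0 := by rw [hn0]; positivity
  obtain ⟨a, ha⟩ : ∃ x, x = μ * (1 + k2 / β) + k2 / β := ⟨_, rfl⟩
  have pa : 0 < a := by rw [ha]; positivity
  obtain ⟨C2, hC2⟩ : ∃ x, x = 2 * ((1 + β) * (1 + μ) + β + 1 + μ) := ⟨_, rfl⟩
  have pC2 : 0 < C2 := by rw [hC2]; positivity
  obtain ⟨C3, hC3⟩ : ∃ x, x = 1 + μ + k2 := ⟨_, rfl⟩
  have pC3 : 0 < C3 := by rw [hC3]; positivity
  obtain ⟨C4, hC4⟩ : ∃ x, x = (C3 + a * C2) / n0 := ⟨_, rfl⟩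
  have pC4 : 0 < C4 := by rw [hC4]; positivity
  obtain ⟨C6, hC6⟩ : ∃ x, x = (2 * C4 + C2 + C3) / k0 := ⟨_, rfl⟩
  have pC6 : 0 < C6 := by rw [hC6]; positivity
  obtain ⟨C7, hC7⟩ : ∃ x, x = (C2 + β * (2 * C6) + C4) / (μ / 2) := ⟨_, rfl⟩
  have pC7 : 0 < C7 := by rw [hC7]; positivity
  -- The summands ensure r ≥ 1; β² ≤ μr, so that σ ≥ μr²/2; β² ≤ r, so that τ ≤ r; and 4β ≤ μr, so
  -- that 2β ≤ σ and hence 2σ ≤ K. The last makes N of order r⁸.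
  refine ⟨1 + β ^ 2 / μ + β ^ 2 + 4 * β / μ, ?_, min (c1 / 12) (μ / 2), by positivity,
    C4 + C6 + C7, by positivity, ?_⟩
  · have : 0 < β ^ 2 / μ + β ^ 2 + 4 * β / μ := by positivity
    linarith
  intro r hrR b e u H t ht
  have q1 : 0 < β ^ 2 / μ := by positivity
  have q2 : 0 < β ^ 2 := by positivity
  have q3 : 0 < 4 * β / μ := by positivity
  have hr1 : 1 ≤ r := by linarith
  have hr : 0 < r := by linarith
  have hR1 : β ^ 2 ≤ μ * r := by
    have : β ^ 2 / μ ≤ r := by linarith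
    rw [div_le_iff₀ hμ] at this; linarith
  have hR2 : β ^ 2 ≤ r := by linarith
  have hR3 : 4 * β ≤ μ * r := by
    have : 4 * β / μ ≤ r := by linarith
    rw [div_le_iff₀ hμ] at this; linarith
  obtain ⟨σ, τ, ω, h⟩ := exists_charRoot hβ hμ hr
  have pσ := h.σ_pos
  have pτ := h.τ_pos
  have pω := h.ω_pos
  have hr2 : 0 < r ^ 2 := by positivity
  have hr4 : 0 < r ^ 4 := by positivity
  have hr12 : r ≤ r ^ 2 := le_self_pow₀ hr1 (by norm_num)
  have hr24 : r ^ 2 ≤ r ^ 4 := pow_le_pow_right₀ hr1 (by norm_num)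
  have hr02 : 1 ≤ r ^ 2 := one_le_pow₀ hr1
  have hr04 : 1 ≤ r ^ 4 := one_le_pow₀ hr1
  have hr05 : 1 ≤ r ^ 5 := one_le_pow₀ hr1
  have hσμ : σ ≤ μ * r ^ 2 := by linarith [h.add_eq]
  have hτr : 2 * r * τ ≤ β ^ 2 := by
    have h1 := h.mul_eq
    have h2 : τ * (2 * σ * r) ≤ τ * (σ ^ 2 + r ^ 2) := by
      gcongr; nlinarith [sq_nonneg (σ - r)]
    have h3 : (2 * r * τ) * σ ≤ β ^ 2 * σ := by linarith
    exact le_of_mul_le_mul_right h3 pσ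
  have hτ2 : τ ≤ μ * r ^ 2 / 2 := by
    have h1 : 2 * 1 * τ ≤ 2 * r * τ := by gcongr
    have h2 : μ * r ≤ μ * r ^ 2 := by gcongr
    linarith
  have hσ1 : μ * r ^ 2 / 2 ≤ σ := by linarith [h.add_eq]
  have hσ0 : μ / 2 ≤ σ := le_trans (by
    have : μ * 1 ≤ μ * r ^ 2 := by gcongr
    linarith) hσ1
  have hσsq : σ ^ 2 ≤ μ ^ 2 * r ^ 4 := by
    calc σ ^ 2 ≤ (μ * r ^ 2) ^ 2 := by gcongr
      _ = _ := by ring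
  have hσsq' : μ ^ 2 * r ^ 4 / 4 ≤ σ ^ 2 := by
    calc μ ^ 2 * r ^ 4 / 4 = (μ * r ^ 2 / 2) ^ 2 := by ring
      _ ≤ _ := by gcongr
  have hτ1 : c1 / r ^ 2 ≤ τ := by
    have h1 := h.mul_eq
    have h2 : τ * (σ ^ 2 + r ^ 2) ≤ τ * ((μ ^ 2 + 1) * r ^ 4) := by gcongr; linarith
    have h3 : β ^ 2 * (μ * r ^ 2 / 2) ≤ β ^ 2 * σ := by gcongr
    have h4 : β ^ 2 * μ * r ^ 2 ≤ τ * r ^ 2 * (2 * (μ ^ 2 + 1)) * r ^ 2 := by linarith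
    have h5 := le_of_mul_le_mul_right h4 hr2
    rw [div_le_iff₀ hr2, hc1, div_le_iff₀ (by positivity)]
    exact h5
  have hω1 : r ^ 2 ≤ ω ^ 2 := by rw [h.sq_eq]; linarith [h.mul_le]
  have hω1' : r ≤ ω := le_of_sq_le_sq hω1 pω.le
  have hω2 : ω ≤ (1 + β) * r := by
    refine le_of_sq_le_sq ?_ (by positivity)
    rw [h.sq_eq]
    have h1 : β ^ 2 * 1 ≤ β ^ 2 * r ^ 2 := by gcongr
    have h2 : 0 < σ * τ := by positivity
    have h3 : 0 < β * r ^ 2 := by positivity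
    linarith
  obtain ⟨K, hK⟩ : ∃ x, x = (σ ^ 2 + r ^ 2) / β := ⟨_, rfl⟩
  have pK : 0 < K := by rw [hK]; positivity
  have hKβ : K * β = σ ^ 2 + r ^ 2 := by rw [hK]; field_simp
  have hK1 : K ≤ k2 * r ^ 4 := by
    rw [hK, hk2, div_mul_eq_mul_div]; gcongr; linarith
  have hK0 : 2 * k0 * r ^ 4 ≤ K := by
    have : 2 * k0 * r ^ 4 = μ ^ 2 * r ^ 4 / 4 / β := by rw [hk0]; field_simp; ring
    rw [this, hK]; gcongr; linarith
  have hσβ : 2 * β ≤ σ := by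
    have : μ * r ≤ μ * r ^ 2 := by gcongr
    linarith
  have hKσ : 2 * σ ≤ K := by
    have h1 : 2 * β * σ ≤ σ * σ := by gcongr
    have h2 : 2 * σ * β ≤ K * β := by rw [hKβ]; linarith
    exact le_of_mul_le_mul_right h2 hβ
  have hK2β : k0 * r ^ 4 ≤ K - β := by linarith
  obtain ⟨N, hN⟩ : ∃ x, x = r ^ 2 - σ ^ 2 + K ^ 2 := ⟨_, rfl⟩
  have hN1 : n0 * r ^ 8 ≤ N := by
    have h1 : (2 * σ) ^ 2 ≤ K ^ 2 := by gcongr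
    have h2 : (2 * k0 * r ^ 4) ^ 2 ≤ K ^ 2 := by gcongr
    have h3 : (2 * k0 * r ^ 4) ^ 2 / 2 = n0 * r ^ 8 := by rw [hk0, hn0]; field_simp; norm_num
    rw [hN]; linarith [sq_nonneg σ]
  have hKβ1 : 1 + K / β ≤ (1 + k2 / β) * r ^ 4 := by
    have : K / β ≤ k2 * r ^ 4 / β := by gcongr
    have h2 : k2 * r ^ 4 / β = k2 / β * r ^ 4 := by ring
    linarith
  -- the modes
  obtain ⟨hx, hy⟩ := H.fast_mode h hr (δ := τ / 4) (by positivity) (by linarith)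
    (by
      have h1 : τ ≤ r := by
        have h1 : 2 * 1 * τ ≤ 2 * r * τ := by gcongr
        linarith
      have h2 : τ * τ ≤ r * r := by gcongr
      linarith) ht
  have hz := H.slow_mode h hβ t
  rw [← hK] at hz
  obtain ⟨c, hc⟩ : ∃ x, x = min (c1 / 12) (μ / 2) := ⟨_, rfl⟩
  have pc : 0 < c := by rw [hc]; positivity
  rw [← hc]
  have hz' : ‖r • b t - σ • e t - K • u t‖ ≤ Real.exp (-c * t)
      * (C3 * (r ^ 2 * ‖b 0‖ + r ^ 2 * ‖e 0‖ + r ^ 4 * ‖u 0‖)) := by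
    rw [hz, norm_smul, Real.norm_of_nonneg (Real.exp_pos _).le]
    have h1 : c ≤ σ := by rw [hc]; exact (min_le_right _ _).trans hσ0
    gcongr
    calc _ ≤ r * ‖b 0‖ + σ * ‖e 0‖ + K * ‖u 0‖ := norm_lin_le hr.le pσ.le pK.le
      _ ≤ r ^ 2 * ‖b 0‖ + μ * r ^ 2 * ‖e 0‖ + k2 * r ^ 4 * ‖u 0‖ := by gcongr
      _ ≤ _ := by
        rw [← sub_nonneg, hC3]
        have : (1 + μ + k2) * (r ^ 2 * ‖b 0‖ + r ^ 2 * ‖e 0‖ + r ^ 4 * ‖u 0‖)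
          - (r ^ 2 * ‖b 0‖ + μ * r ^ 2 * ‖e 0‖ + k2 * r ^ 4 * ‖u 0‖)
          = (μ + k2) * (r ^ 2 * ‖b 0‖) + (1 + k2) * (r ^ 2 * ‖e 0‖)
            + (1 + μ) * (r ^ 4 * ‖u 0‖) := by ring
        rw [this]; positivity
  set S := r ^ 2 * ‖b 0‖ + r ^ 2 * ‖e 0‖ + ‖u 0‖ with hS
  have pS : 0 ≤ S := by positivity
  have hD : 2 * (Real.exp (-(1 / 3 * (τ / 4)) * t) *
        (ω * ‖e 0 - (σ / r) • b 0‖ + ‖β • u 0 + r • b 0 + σ • e 0‖))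
      ≤ C2 * (Real.exp (-(c / r ^ 2) * t) * S) := by
    have h1 : Real.exp (-(1 / 3 * (τ / 4)) * t) ≤ Real.exp (-(c / r ^ 2) * t) := by
      apply Real.exp_le_exp.2
      have h2 : c / r ^ 2 ≤ 1 / 3 * (τ / 4) := by
        calc c / r ^ 2 ≤ c1 / 12 / r ^ 2 := by rw [hc]; gcongr; exact min_le_left _ _
          _ = c1 / r ^ 2 / 12 := by ring
          _ ≤ _ := by linarith
      gcongr
    have h2 : ω * ‖e 0 - (σ / r) • b 0‖ ≤ (1 + β) * (r ^ 2 * ‖e 0‖ + μ * (r ^ 2 * ‖b 0‖)) := by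
      calc _ ≤ ((1 + β) * r) * (‖e 0‖ + σ / r * ‖b 0‖) := by gcongr; exact norm_diff_le hr pσ
        _ = (1 + β) * (r * ‖e 0‖ + σ * ‖b 0‖) := by field_simp
        _ ≤ (1 + β) * (r ^ 2 * ‖e 0‖ + μ * r ^ 2 * ‖b 0‖) := by gcongr
        _ = _ := by ring
    have h3 : ‖β • u 0 + r • b 0 + σ • e 0‖ ≤ β * ‖u 0‖ + r ^ 2 * ‖b 0‖ + μ * r ^ 2 * ‖e 0‖ := by
      refine (norm_lin_le' hβ.le hr.le pσ.le).trans ?_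
      gcongr
    calc _ ≤ 2 * (Real.exp (-(c / r ^ 2) * t) * ((1 + β) * (r ^ 2 * ‖e 0‖ + μ * (r ^ 2 * ‖b 0‖))
          + (β * ‖u 0‖ + r ^ 2 * ‖b 0‖ + μ * r ^ 2 * ‖e 0‖))) := by gcongr
      _ ≤ _ := by
        rw [← sub_nonneg, hC2, hS]
        have : 2 * ((1 + β) * (1 + μ) + β + 1 + μ) * (Real.exp (-(c / r ^ 2) * t) *
            (r ^ 2 * ‖b 0‖ + r ^ 2 * ‖e 0‖ + ‖u 0‖))
          - 2 * (Real.exp (-(c / r ^ 2) * t) * ((1 + β) * (r ^ 2 * ‖e 0‖ + μ * (r ^ 2 * ‖b 0‖))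
          + (β * ‖u 0‖ + r ^ 2 * ‖b 0‖ + μ * r ^ 2 * ‖e 0‖))) =
          2 * Real.exp (-(c / r ^ 2) * t) * ((1 + β) * (r ^ 2 * ‖b 0‖)
            + (1 + β) * μ * (r ^ 2 * ‖e 0‖) + ((1 + β) * (1 + μ) + 1 + μ) * ‖u 0‖
            + (β + μ) * (r ^ 2 * ‖b 0‖) + (β + 1) * (r ^ 2 * ‖e 0‖)) := by ring
        rw [this]; positivity
  have hx' := hx.trans hD
  have hy' := hy.trans hD
  have hEE : Real.exp (-c * t) ≤ Real.exp (-(c / r ^ 2) * t) := by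
    apply Real.exp_le_exp.2
    have : c / r ^ 2 ≤ c := div_le_self pc.le hr02
    have := mul_le_mul_of_nonneg_right this ht
    linarith
  set Ee := Real.exp (-c * t)
  set Eh := Real.exp (-(c / r ^ 2) * t)
  have pEe : 0 < Ee := Real.exp_pos _
  have pEh : 0 < Eh := Real.exp_pos _
  set D := Eh * S with hDdef
  have pD : 0 ≤ D := by positivity
  have hX : r * ‖e t - (σ / r) • b t‖ ≤ C2 * D := le_trans (by gcongr) hx'
  have hZ4 : ‖r • b t - σ • e t - K • u t‖ ≤ r ^ 4 * (C3 * D) := by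
    refine hz'.trans ?_
    calc Ee * (C3 * (r ^ 2 * ‖b 0‖ + r ^ 2 * ‖e 0‖ + r ^ 4 * ‖u 0‖))
        ≤ Eh * (C3 * (r ^ 4 * (r ^ 2 * ‖b 0‖) + r ^ 4 * (r ^ 2 * ‖e 0‖) + r ^ 4 * ‖u 0‖)) := by
          gcongr <;> exact le_mul_of_one_le_left (by positivity) hr02
      _ = _ := by rw [hDdef, hS]; ring
  have hb := mul_norm_b_le (b := b t) (e := e t) (u := u t) hβ hr pσ hK hN
    (le_trans (by positivity) hN1)
  have hb1 : r ^ 2 * ‖b t‖ ≤ C4 * D := by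
    have h1 : n0 * r ^ 6 * (r ^ 2 * ‖b t‖) ≤ r ^ 6 * ((C3 + a * C2) * D) := by
      calc n0 * r ^ 6 * (r ^ 2 * ‖b t‖) = n0 * r ^ 8 * ‖b t‖ := by ring
        _ ≤ N * ‖b t‖ := by gcongr
        _ ≤ _ := hb
        _ ≤ r * (r ^ 4 * (C3 * D)) + r * (μ * r ^ 2) * ((1 + k2 / β) * r ^ 4)
            * ‖e t - (σ / r) • b t‖ + r * (k2 * r ^ 4) / β * (C2 * D) := by gcongr
        _ = r ^ 5 * (C3 * D) + r ^ 6 * (μ * (1 + k2 / β)) * (r * ‖e t - (σ / r) • b t‖)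
            + r ^ 5 * (k2 / β * (C2 * D)) := by ring
        _ ≤ r ^ 6 * (C3 * D) + r ^ 6 * (μ * (1 + k2 / β)) * (C2 * D)
            + r ^ 6 * (k2 / β * (C2 * D)) := by
          have : r ^ 5 ≤ r ^ 6 := pow_le_pow_right₀ hr1 (by norm_num)
          gcongr
        _ = _ := by rw [ha]; ring
    have h2 : n0 * r ^ 6 * (r ^ 2 * ‖b t‖) ≤ n0 * r ^ 6 * (C4 * D) := by
      refine h1.trans (le_of_eq ?_)
      rw [hC4]; field_simp
    exact le_of_mul_le_mul_left h2 (by positivity)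
  have hu1 : r ^ 4 * ‖u t‖ ≤ C6 * (D + Ee * (r ^ 4 * ‖u 0‖)) := by
    -- Adding the slow mode and βu + rb + σe eliminates `e`. As K - β is of order r⁴, this gains the
    -- full weight r⁴ for `u`.
    have hid : (K - β) • u t = (2 * r) • b t - (β • u t + r • b t + σ • e t)
        - (r • b t - σ • e t - K • u t) := by
      match_scalars <;> ring
    have h1 : (K - β) * ‖u t‖ ≤ 2 * r * ‖b t‖ + C2 * D
        + Ee * (C3 * (r ^ 2 * ‖b 0‖ + r ^ 2 * ‖e 0‖ + r ^ 4 * ‖u 0‖)) := by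
      calc (K - β) * ‖u t‖ = ‖(K - β) • u t‖ := by
            rw [norm_smul, Real.norm_of_nonneg (le_trans (by positivity) hK2β)]
        _ ≤ ‖(2 * r) • b t‖ + ‖β • u t + r • b t + σ • e t‖
          + ‖r • b t - σ • e t - K • u t‖ := by
            rw [hid]
            exact (norm_sub_le _ _).trans (by gcongr; exact norm_sub_le _ _)
        _ ≤ _ := by
          rw [norm_smul, Real.norm_of_nonneg (by positivity : 0 ≤ 2 * r)]
          gcongr
    have h2 : Ee * (C3 * (r ^ 2 * ‖b 0‖ + r ^ 2 * ‖e 0‖ + r ^ 4 * ‖u 0‖))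
        ≤ C3 * (D + Ee * (r ^ 4 * ‖u 0‖)) := by
      have h3 : Ee * (r ^ 2 * ‖b 0‖ + r ^ 2 * ‖e 0‖) ≤ D := by
        rw [hDdef, hS]
        have : 0 ≤ ‖u 0‖ := norm_nonneg _
        exact mul_le_mul hEE (by linarith) (by positivity) pEh.le
      have := mul_le_mul_of_nonneg_left h3 pC3.le
      linarith
    have h3 : 2 * r * ‖b t‖ ≤ 2 * (C4 * D) := by
      have : r * ‖b t‖ ≤ r ^ 2 * ‖b t‖ := by gcongr
      linarith
    have h4 : k0 * (r ^ 4 * ‖u t‖) ≤ k0 * (C6 * (D + Ee * (r ^ 4 * ‖u 0‖))) := by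
      have h5 : k0 * (C6 * (D + Ee * (r ^ 4 * ‖u 0‖)))
          = (2 * C4 + C2 + C3) * (D + Ee * (r ^ 4 * ‖u 0‖)) := by rw [hC6]; field_simp
      have h6 : k0 * r ^ 4 * ‖u t‖ ≤ (K - β) * ‖u t‖ := by gcongr
      have h7 : 0 ≤ (2 * C4 + C2) * (Ee * (r ^ 4 * ‖u 0‖)) := by positivity
      rw [h5]; linarith
    exact le_of_mul_le_mul_left h4 pk0
  have he1 : r ^ 2 * ‖e t‖ ≤ C7 * D := by
    -- The bound on x = e - (σ/r)b carries only the weight r. Using βu + rb + σe instead, and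
    -- dividing by σ of order r², gives the weight r².
    have hid : σ • e t = (β • u t + r • b t + σ • e t) - β • u t - r • b t := by abel
    have h1 : σ * ‖e t‖ ≤ C2 * D + β * ‖u t‖ + r * ‖b t‖ := by
      calc σ * ‖e t‖ = ‖σ • e t‖ := by rw [norm_smul, Real.norm_of_nonneg pσ.le]
        _ ≤ ‖β • u t + r • b t + σ • e t‖ + ‖β • u t‖ + ‖r • b t‖ := by
            conv_lhs => rw [hid]
            exact (norm_sub_le _ _).trans (by gcongr; exact norm_sub_le _ _)
        _ ≤ _ := by
          rw [norm_smul, norm_smul, Real.norm_of_nonneg hβ.le, Real.norm_of_nonneg hr.le]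
          gcongr
    have h2 : ‖u t‖ ≤ C6 * (2 * D) := by
      have h3 : r ^ 4 * ‖u t‖ ≤ r ^ 4 * (C6 * (2 * D)) := by
        refine hu1.trans ?_
        have h9 : Ee * (r ^ 4 * ‖u 0‖) ≤ r ^ 4 * D := by
          have h10 : Ee * (r ^ 4 * ‖u 0‖) ≤ Eh * (r ^ 4 * S) := by
            gcongr
            rw [hS]
            have : 0 ≤ r ^ 2 * ‖b 0‖ + r ^ 2 * ‖e 0‖ := by positivity
            linarith
          rw [hDdef]; linarith
        have h10 : D ≤ r ^ 4 * D := le_mul_of_one_le_left pD hr04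
        calc C6 * (D + Ee * (r ^ 4 * ‖u 0‖)) ≤ C6 * (r ^ 4 * D + r ^ 4 * D) :=
              mul_le_mul_of_nonneg_left (add_le_add h10 h9) pC6.le
          _ = _ := by ring
      exact le_of_mul_le_mul_left h3 hr4
    have h3 : r * ‖b t‖ ≤ C4 * D := le_trans (by gcongr) hb1
    have h4 : μ / 2 * (r ^ 2 * ‖e t‖) ≤ μ / 2 * (C7 * D) := by
      have h5 : μ / 2 * (C7 * D) = (C2 + β * (2 * C6) + C4) * D := by rw [hC7]; field_simp
      have h6 : μ * r ^ 2 / 2 * ‖e t‖ ≤ σ * ‖e t‖ := by gcongr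
      have h7 := mul_le_mul_of_nonneg_left h2 hβ.le
      rw [h5]; linarith
    exact le_of_mul_le_mul_left h4 (by positivity)
  refine ⟨hb1.trans ?_, he1.trans ?_, hu1.trans ?_⟩ <;> gcongr <;> linarith

set_option maxHeartbeats 1000000 in
/-- Exponential decay for the transverse system at intermediate frequencies. -/
theorem Transverse.mid_freq (V : Type*) [NormedAddCommGroup V] [InnerProductSpace ℝ V]
    (hβ : 0 < β) (hμ : 0 < μ) {r₀ R : ℝ} (hr₀ : 0 < r₀) (hR : r₀ ≤ R) :
    ∃ c > 0, ∃ C > 0, ∀ r, r₀ ≤ r → r ≤ R → ∀ b e u : ℝ → V,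
      Transverse β μ r b e u → ∀ t, 0 ≤ t →
      ‖b t‖ ≤ C * (Real.exp (-c * t) * (‖b 0‖ + ‖e 0‖ + ‖u 0‖)) ∧
      ‖e t‖ ≤ C * (Real.exp (-c * t) * (‖b 0‖ + ‖e 0‖ + ‖u 0‖)) ∧
      ‖u t‖ ≤ C * (Real.exp (-c * t) * (‖b 0‖ + ‖e 0‖ + ‖u 0‖)) := by
  have pR : 0 < R := hr₀.trans_le hR
  obtain ⟨s0, hs0⟩ : ∃ x, x = μ * r₀ ^ 4 / (R ^ 2 + β ^ 2) := ⟨_, rfl⟩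
  obtain ⟨s1, hs1⟩ : ∃ x, x = μ * R ^ 2 := ⟨_, rfl⟩
  have ps0 : 0 < s0 := by rw [hs0]; positivity
  have ps1 : 0 < s1 := by rw [hs1]; positivity
  obtain ⟨t0, ht0⟩ : ∃ x, x = β ^ 2 * s0 / (s1 ^ 2 + R ^ 2) := ⟨_, rfl⟩
  have pt0 : 0 < t0 := by rw [ht0]; positivity
  obtain ⟨δ, pδ, hδ1, hδ2⟩ : ∃ δ > 0, 4 * δ ≤ t0 ∧ 2 * δ * s1 ≤ r₀ ^ 2 := by
    refine ⟨min (t0 / 4) (r₀ ^ 2 / (2 * s1)), by positivity, ?_, ?_⟩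
    · linarith [min_le_left (t0 / 4) (r₀ ^ 2 / (2 * s1))]
    · calc 2 * min (t0 / 4) (r₀ ^ 2 / (2 * s1)) * s1 ≤ 2 * (r₀ ^ 2 / (2 * s1)) * s1 := by
            gcongr; exact min_le_right _ _
        _ = _ := by field_simp
  obtain ⟨w, hw⟩ : ∃ x, x = R + β := ⟨_, rfl⟩
  have pw : 0 < w := by rw [hw]; positivity
  obtain ⟨C2, hC2⟩ : ∃ x, x = 2 * (w * (1 + s1 / r₀) + β + R + s1) := ⟨_, rfl⟩
  have pC2 : 0 < C2 := by rw [hC2]; positivity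
  obtain ⟨C3, hC3⟩ : ∃ x, x = R * (C2 / r₀) := ⟨_, rfl⟩
  have pC3 : 0 < C3 := by rw [hC3]; positivity
  obtain ⟨κ, pκ, hκ1, hκ2⟩ : ∃ κ > 0, 2 * κ ≤ s0 ∧ 2 * κ ≤ 1 / 3 * δ :=
    ⟨min (s0 / 2) (δ / 6), by positivity, by linarith [min_le_left (s0 / 2) (δ / 6)],
      by linarith [min_le_right (s0 / 2) (δ / 6)]⟩
  obtain ⟨C4, hC4⟩ : ∃ x, x = 1 + (1 + 1 / (s0 * (1 / 3 * δ))) * C3 := ⟨_, rfl⟩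
  have pC4 : 0 < C4 := by rw [hC4]; positivity
  obtain ⟨C5, hC5⟩ : ∃ x, x = C2 / r₀ + s1 / r₀ * C4 := ⟨_, rfl⟩
  have pC5 : 0 < C5 := by rw [hC5]; positivity
  obtain ⟨C6, hC6⟩ : ∃ x, x = (C2 + R * C4 + s1 * C5) / β := ⟨_, rfl⟩
  have pC6 : 0 < C6 := by rw [hC6]; positivity
  refine ⟨κ, pκ, C4 + C5 + C6, by positivity, ?_⟩
  intro r hr0 hrR b e u H t ht
  have hr : 0 < r := hr₀.trans_le hr0
  obtain ⟨σ, τ, ω, h⟩ := exists_charRoot hβ hμ hr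
  have pσ := h.σ_pos
  have pτ := h.τ_pos
  have pω := h.ω_pos
  have hr02 : r₀ ^ 2 ≤ r ^ 2 := by gcongr
  have hrR2 : r ^ 2 ≤ R ^ 2 := by gcongr
  have hμ2 : μ * r ^ 2 ≤ s1 := by rw [hs1]; gcongr
  have hσ1 : σ ≤ s1 := by linarith [h.add_eq]
  have hτ1 : τ ≤ s1 := by linarith [h.add_eq]
  have hω1 : r ^ 2 ≤ ω ^ 2 := by rw [h.sq_eq]; linarith [h.mul_le]
  have hω1' : r ≤ ω := le_of_sq_le_sq hω1 pω.le
  have hω2 : ω ^ 2 ≤ R ^ 2 + β ^ 2 := by rw [h.sq_eq]; linarith [mul_pos pσ pτ]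
  have hω3 : ω ≤ w := by
    rw [hw]; exact le_of_sq_le_sq (by linarith [mul_pos pR hβ]) (by positivity)
  have hσ0 : s0 ≤ σ := by
    have h1 := h.sq_mul_eq
    have h2 : ω ^ 2 * σ ≤ (R ^ 2 + β ^ 2) * σ := by gcongr
    have h3 : μ * r₀ ^ 4 ≤ μ * r ^ 4 := by gcongr
    rw [hs0, div_le_iff₀ (by positivity)]; linarith
  have hτ0 : t0 ≤ τ := by
    have h1 := h.mul_eq
    have h2 : τ * (σ ^ 2 + r ^ 2) ≤ τ * (s1 ^ 2 + R ^ 2) := by gcongr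
    have h3 : β ^ 2 * s0 ≤ β ^ 2 * σ := by gcongr
    rw [ht0, div_le_iff₀ (by positivity)]; linarith
  set S := ‖b 0‖ + ‖e 0‖ + ‖u 0‖ with hS
  have hbS : ‖b 0‖ ≤ S := by rw [hS]; linarith [norm_nonneg (e 0), norm_nonneg (u 0)]
  have heS : ‖e 0‖ ≤ S := by rw [hS]; linarith [norm_nonneg (b 0), norm_nonneg (u 0)]
  have huS : ‖u 0‖ ≤ S := by rw [hS]; linarith [norm_nonneg (e 0), norm_nonneg (b 0)]
  have pS : 0 ≤ S := by positivity
  have hfast : ∀ s, 0 ≤ s → ω * ‖e s - (σ / r) • b s‖ ≤ Real.exp (-(1 / 3 * δ) * s) * (C2 * S) ∧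
      ‖β • u s + r • b s + σ • e s‖ ≤ Real.exp (-(1 / 3 * δ) * s) * (C2 * S) := by
    intro s hs
    obtain ⟨hx, hy⟩ := H.fast_mode h hr (δ := δ) pδ.le (by linarith) (by
      have : 2 * δ * τ ≤ 2 * δ * s1 := by gcongr
      linarith) hs
    have hD : 2 * (ω * ‖e 0 - (σ / r) • b 0‖ + ‖β • u 0 + r • b 0 + σ • e 0‖) ≤ C2 * S := by
      have h2 : ω * ‖e 0 - (σ / r) • b 0‖ ≤ w * (S + s1 / r₀ * S) := by
        gcongr
        refine (norm_diff_le hr pσ).trans ?_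
        gcongr
      have h3 : ‖β • u 0 + r • b 0 + σ • e 0‖ ≤ β * S + R * S + s1 * S := by
        refine (norm_lin_le' hβ.le hr.le pσ.le).trans ?_
        gcongr
      rw [hC2]; linarith
    have hE := Real.exp_pos (-(1 / 3 * δ) * s)
    have := mul_le_mul_of_nonneg_left hD hE.le
    exact ⟨by linarith, by linarith⟩
  have hx : ∀ s, 0 ≤ s → ‖e s - (σ / r) • b s‖ ≤ Real.exp (-(1 / 3 * δ) * s) * (C2 / r₀ * S) := by
    intro s hs
    have h1 : r₀ * ‖e s - (σ / r) • b s‖ ≤ ω * ‖e s - (σ / r) • b s‖ := by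
      gcongr; exact hr0.trans hω1'
    have h2 := h1.trans (hfast s hs).1
    have h3 : r₀ * (Real.exp (-(1 / 3 * δ) * s) * (C2 / r₀ * S))
        = Real.exp (-(1 / 3 * δ) * s) * (C2 * S) := by field_simp
    exact le_of_mul_le_mul_left (by linarith) hr₀
  have hb1 : ‖b t‖ ≤ Real.exp (-κ * t) * (C4 * S) := by
    -- In this range N can vanish, because -σ may be a multiple root, so the mode coordinates are
    -- not inverted. Instead b' = -σb - rx is regarded as an equation forced by the decaying
    -- quantity x = e - (σ/r)b.
    have h1 := forced_decay_le (b := b) (g := fun s => -r • (e s - (σ / r) • b s)) (σ := σ)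
      (c := 1 / 3 * δ) (G := C3 * S) (κ := κ) pσ (by positivity) (by positivity)
      (by linarith) hκ2 (fun s => by
        convert! H.hb s using 1
        match_scalars
        · field_simp; ring
        · ring) (fun s hs => by
        rw [norm_smul, norm_neg, Real.norm_of_nonneg hr.le]
        calc r * ‖e s - (σ / r) • b s‖ ≤ R * (Real.exp (-(1 / 3 * δ) * s) * (C2 / r₀ * S)) := by
              gcongr; exact hx s hs
          _ = _ := by rw [hC3]; ring) ht
    refine h1.trans ?_
    gcongr
    have h2 : 1 / (σ * (1 / 3 * δ)) ≤ 1 / (s0 * (1 / 3 * δ)) := by gcongr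
    calc ‖b 0‖ + (1 + 1 / (σ * (1 / 3 * δ))) * (C3 * S)
        ≤ S + (1 + 1 / (s0 * (1 / 3 * δ))) * (C3 * S) := by gcongr
      _ = _ := by rw [hC4]; ring
  have hEE : Real.exp (-(1 / 3 * δ) * t) ≤ Real.exp (-κ * t) := by
    apply Real.exp_le_exp.2
    have : κ ≤ 1 / 3 * δ := by linarith
    gcongr
  have he1 : ‖e t‖ ≤ Real.exp (-κ * t) * (C5 * S) := by
    calc ‖e t‖ ≤ _ := norm_e_le (b := b t) hr pσ
      _ ≤ Real.exp (-κ * t) * (C2 / r₀ * S) + s1 / r₀ * (Real.exp (-κ * t) * (C4 * S)) := by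
        gcongr
        exact (hx t ht).trans (by gcongr)
      _ = _ := by rw [hC5]; ring
  have hu1 : ‖u t‖ ≤ Real.exp (-κ * t) * (C6 * S) := by
    have h3 := mul_norm_u_le (b := b t) (e := e t) (u := u t) hβ hr pσ
    have h4 : β * ‖u t‖ ≤ β * (Real.exp (-κ * t) * (C6 * S)) := by
      calc _ ≤ _ := h3
        _ ≤ Real.exp (-κ * t) * (C2 * S) + R * (Real.exp (-κ * t) * (C4 * S))
            + s1 * (Real.exp (-κ * t) * (C5 * S)) := by
          gcongr
          exact (hfast t ht).2.trans (by gcongr)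
        _ = _ := by rw [hC6]; field_simp
    exact le_of_mul_le_mul_left h4 hβ
  have pE := Real.exp_pos (-κ * t)
  have p4 : 0 ≤ C4 * (Real.exp (-κ * t) * S) := by positivity
  have p5 : 0 ≤ C5 * (Real.exp (-κ * t) * S) := by positivity
  have p6 : 0 ≤ C6 * (Real.exp (-κ * t) * S) := by positivity
  exact ⟨by linarith, by linarith, by linarith⟩

theorem exp_neg_mul_le {a b t : ℝ} (h : a ≤ b) (ht : 0 ≤ t) :
    Real.exp (-b * t) ≤ Real.exp (-a * t) := by
  apply Real.exp_le_exp.2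
  have := mul_le_mul_of_nonneg_right h ht
  linarith

/-- Decay for the transverse system away from the zero frequency. -/
theorem Transverse.away_from_zero (V : Type*) [NormedAddCommGroup V] [InnerProductSpace ℝ V]
    (hβ : 0 < β) (hμ : 0 < μ) {r₀ : ℝ} (hr₀ : 0 < r₀) :
    ∃ c > 0, ∃ C > 0, ∀ r, r₀ ≤ r → ∀ b e u : ℝ → V,
      Transverse β μ r b e u → ∀ t, 0 ≤ t →
      r ^ 2 * ‖b t‖ ≤ C * (Real.exp (-(c / r ^ 2) * t)
          * (r ^ 2 * ‖b 0‖ + r ^ 2 * ‖e 0‖ + ‖u 0‖)) ∧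
      r ^ 2 * ‖e t‖ ≤ C * (Real.exp (-(c / r ^ 2) * t)
          * (r ^ 2 * ‖b 0‖ + r ^ 2 * ‖e 0‖ + ‖u 0‖)) ∧
      r ^ 4 * ‖u t‖ ≤ C * (Real.exp (-(c / r ^ 2) * t)
          * (r ^ 2 * ‖b 0‖ + r ^ 2 * ‖e 0‖ + ‖u 0‖) + Real.exp (-c * t) * (r ^ 4 * ‖u 0‖)) := by
  obtain ⟨R₁, hR1, c₁, hc1, C₁, hC1, h1⟩ := Transverse.high_freq V hβ hμ
  obtain ⟨R, hR⟩ : ∃ x, x = max R₁ r₀ := ⟨_, rfl⟩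
  have hRR : R₁ ≤ R := hR ▸ le_max_left _ _
  have hRr : r₀ ≤ R := hR ▸ le_max_right _ _
  have hR1' : 1 ≤ R := le_trans hR1 hRR
  obtain ⟨c₂, hc2, C₂, hC2, h2⟩ := Transverse.mid_freq V hβ hμ hr₀ hRr
  -- The entry c₂r₀² makes c/r² ≤ c₂ for r ≥ r₀, so the uniform exponential rate of intermediate
  -- frequencies also fits the form e^{-(c/r²)t}.
  obtain ⟨c, hc⟩ : ∃ x, x = min c₁ (min c₂ (c₂ * r₀ ^ 2)) := ⟨_, rfl⟩
  have pc : 0 < c := by rw [hc]; positivity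
  have hcc1 : c ≤ c₁ := hc ▸ min_le_left _ _
  have hcc2 : c ≤ c₂ * r₀ ^ 2 := hc ▸ (min_le_right _ _).trans (min_le_right _ _)
  obtain ⟨C, hC⟩ : ∃ x, x = C₁ + R ^ 4 * (C₂ * (1 + 1 / r₀ ^ 2)) := ⟨_, rfl⟩
  have hCC1 : C₁ ≤ C := by
    have : 0 < R ^ 4 * (C₂ * (1 + 1 / r₀ ^ 2)) := by positivity
    linarith
  have pC : 0 < C := hC1.trans_le hCC1
  refine ⟨c, pc, C, pC, ?_⟩
  intro r hr b e u H t ht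
  have pr : 0 < r := hr₀.trans_le hr
  set S := r ^ 2 * ‖b 0‖ + r ^ 2 * ‖e 0‖ + ‖u 0‖ with hS
  have pS : 0 ≤ S := by positivity
  rcases le_total R r with hRle | hRle
  · obtain ⟨hb, he, hu⟩ := h1 r (hRR.trans hRle) b e u H t ht
    have e1 : Real.exp (-(c₁ / r ^ 2) * t) ≤ Real.exp (-(c / r ^ 2) * t) :=
      exp_neg_mul_le (by gcongr) ht
    have e2 := exp_neg_mul_le hcc1 ht
    refine ⟨hb.trans ?_, he.trans ?_, hu.trans ?_⟩ <;> gcongr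
  · obtain ⟨hb, he, hu⟩ := h2 r hr hRle b e u H t ht
    have e1 : Real.exp (-c₂ * t) ≤ Real.exp (-(c / r ^ 2) * t) := by
      refine exp_neg_mul_le ?_ ht
      rw [div_le_iff₀ (by positivity)]
      refine hcc2.trans (by gcongr)
    have hs : ‖b 0‖ + ‖e 0‖ + ‖u 0‖ ≤ (1 + 1 / r₀ ^ 2) * S := by
      have h3 : ∀ x : ℝ, 0 ≤ x → x ≤ (1 / r₀ ^ 2) * (r ^ 2 * x) := by
        intro x hx
        have : r₀ ^ 2 * x ≤ r ^ 2 * x := by gcongr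
        rw [one_div, ← div_eq_inv_mul, le_div_iff₀ (by positivity)]
        linarith
      have h4 := h3 ‖b 0‖ (norm_nonneg _)
      have h5 := h3 ‖e 0‖ (norm_nonneg _)
      have h6 : 0 ≤ r ^ 2 * ‖b 0‖ + r ^ 2 * ‖e 0‖ + (1 / r₀ ^ 2) * ‖u 0‖ := by positivity
      rw [hS]; linarith
    have hmain : R ^ 4 * (C₂ * (Real.exp (-c₂ * t) * (‖b 0‖ + ‖e 0‖ + ‖u 0‖)))
        ≤ C * (Real.exp (-(c / r ^ 2) * t) * S) := by
      calc _ ≤ R ^ 4 * (C₂ * (Real.exp (-(c / r ^ 2) * t) * ((1 + 1 / r₀ ^ 2) * S))) := by gcongr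
        _ = (R ^ 4 * (C₂ * (1 + 1 / r₀ ^ 2))) * (Real.exp (-(c / r ^ 2) * t) * S) := by ring
        _ ≤ _ := by gcongr; linarith
    have hr24 : r ^ 2 ≤ R ^ 4 := by
      calc r ^ 2 ≤ R ^ 2 := by gcongr
        _ ≤ R ^ 4 := pow_le_pow_right₀ hR1' (by norm_num)
    refine ⟨le_trans (by gcongr) hmain, le_trans (by gcongr) hmain, ?_⟩
    refine le_trans (b := C * (Real.exp (-(c / r ^ 2) * t) * S)) (le_trans (by gcongr) hmain) ?_
    gcongr
    exact le_add_of_nonneg_right (by positivity)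

end Regimes

/-! ### The symbol of the system -/

/-- Three-dimensional complex Euclidean space. -/
abbrev C3 : Type := EuclideanSpace ℂ (Fin 3)

/-- The bilinear product `ξ · v` of a real and a complex vector. -/
noncomputable def dot (ξ : R3) : C3 →ₗ[ℂ] ℂ where
  toFun v := ∑ i, (ξ i : ℂ) * v i
  map_add' v w := by simp [mul_add, Finset.sum_add_distrib]
  map_smul' c v := by simp [Finset.mul_sum, mul_left_comm]

/-- The cross product `ξ × v` of a real and a complex vector. -/
noncomputable def cross (ξ : R3) : C3 →ₗ[ℂ] C3 where
  toFun v := WithLp.toLp 2 fun i => (ξ (i + 1) : ℂ) * v (i + 2) - (ξ (i + 2) : ℂ) * v (i + 1)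
  map_add' v w := by ext i; simp; ring
  map_smul' c v := by ext i; simp; ring

/-- The complexification of a real vector. -/
noncomputable def cvec (ξ : R3) : C3 := WithLp.toLp 2 fun i => (ξ i : ℂ)

theorem dot_apply (ξ : R3) (v : C3) : dot ξ v = ∑ i, (ξ i : ℂ) * v i := rfl

theorem cross_apply (ξ : R3) (v : C3) (i : Fin 3) :
    cross ξ v i = (ξ (i + 1) : ℂ) * v (i + 2) - (ξ (i + 2) : ℂ) * v (i + 1) := rfl

theorem norm_sq_eq_sum (ξ : R3) : ‖ξ‖ ^ 2 = ξ 0 ^ 2 + ξ 1 ^ 2 + ξ 2 ^ 2 := by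
  rw [EuclideanSpace.norm_sq_eq]; simp [Fin.sum_univ_three]

theorem dot_cross (ξ : R3) (v : C3) : dot ξ (cross ξ v) = 0 := by
  simp [dot_apply, cross_apply, Fin.sum_univ_three]; ring_nf

theorem dot_cvec (ξ : R3) : dot ξ (cvec ξ) = ((‖ξ‖ ^ 2 : ℝ) : ℂ) := by
  rw [norm_sq_eq_sum]; simp [dot_apply, cvec, Fin.sum_univ_three]; ring

theorem cross_cvec (ξ : R3) : cross ξ (cvec ξ) = 0 := by
  ext i; simp [cross_apply, cvec]; ring

theorem cross_cross (ξ : R3) (v : C3) :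
    cross ξ (cross ξ v) = dot ξ v • cvec ξ - ((‖ξ‖ ^ 2 : ℝ) : ℂ) • v := by
  rw [norm_sq_eq_sum]
  ext i
  fin_cases i <;> simp [cross_apply, dot_apply, cvec, Fin.sum_univ_three] <;> ring

theorem norm_cvec (ξ : R3) : ‖cvec ξ‖ = ‖ξ‖ := by
  simp [EuclideanSpace.norm_eq, cvec]

theorem norm_coord_le (ξ : R3) (i : Fin 3) : |ξ i| ≤ ‖ξ‖ := PiLp.norm_apply_le ξ i

theorem norm_dot_le (ξ : R3) (v : C3) : ‖dot ξ v‖ ≤ 3 * (‖ξ‖ * ‖v‖) := by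
  rw [dot_apply]
  refine (norm_sum_le _ _).trans ?_
  calc ∑ i, ‖(ξ i : ℂ) * v i‖ ≤ ∑ _i : Fin 3, ‖ξ‖ * ‖v‖ := by
        refine Finset.sum_le_sum fun i _ => ?_
        rw [norm_mul, Complex.norm_real]
        gcongr
        · exact norm_coord_le ξ i
        · exact PiLp.norm_apply_le v i
    _ = _ := by simp

theorem norm_le_sum_coord (v : C3) : ‖v‖ ≤ ∑ i, ‖v i‖ := by
  rw [EuclideanSpace.norm_eq]
  refine Real.sqrt_le_iff.2 ⟨by positivity, ?_⟩
  exact Finset.sum_sq_le_sq_sum_of_nonneg fun i _ => norm_nonneg _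

theorem norm_cross_le (ξ : R3) (v : C3) : ‖cross ξ v‖ ≤ 6 * (‖ξ‖ * ‖v‖) := by
  refine (norm_le_sum_coord _).trans ?_
  calc ∑ i, ‖cross ξ v i‖ ≤ ∑ _i : Fin 3, 2 * (‖ξ‖ * ‖v‖) := by
        refine Finset.sum_le_sum fun i _ => ?_
        rw [cross_apply]
        refine (norm_sub_le _ _).trans ?_
        rw [norm_mul, norm_mul, Complex.norm_real, Complex.norm_real, two_mul]
        gcongr
        · exact norm_coord_le ξ _
        · exact PiLp.norm_apply_le v _
        · exact norm_coord_le ξ _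
        · exact PiLp.norm_apply_le v _
    _ = _ := by simp; ring

/-- A solution of the Fourier-transformed system at the frequency `ξ`. -/
structure SymbolSol (γ β μ : ℝ) (ξ : R3) (n : ℝ → ℂ) (u E B : ℝ → C3) : Prop where
  hn : ∀ t, HasDerivAt n (-(γ * (Complex.I * dot ξ (u t)))) t
  hu : ∀ t, HasDerivAt u (-(γ * (Complex.I * n t)) • cvec ξ - (β : ℂ) • E t
    - ((μ * ‖ξ‖ ^ 2 : ℝ) : ℂ) • u t) t
  hE : ∀ t, HasDerivAt E (Complex.I • cross ξ (B t) + (β : ℂ) • u t) t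
  hB : ∀ t, HasDerivAt B (-(Complex.I • cross ξ (E t))) t
  div_E : γ * (Complex.I * dot ξ (E 0)) = -(β * n 0)
  div_B : dot ξ (B 0) = 0

/-- The operator `v ↦ iξ × v / |ξ|`. -/
noncomputable def curlDir (ξ : R3) (v : C3) : C3 := (Complex.I / ‖ξ‖) • cross ξ v

theorem HasDerivAt.dot {ξ : R3} {f : ℝ → C3} {f' : C3} {t : ℝ} (h : HasDerivAt f f' t) :
    HasDerivAt (fun t => NSMaxwell.dot ξ (f t)) (NSMaxwell.dot ξ f') t :=
  ((LinearMap.toContinuousLinearMap (NSMaxwell.dot ξ)).restrictScalars ℝ).hasFDerivAt.comp_hasDerivAt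
    t h

theorem HasDerivAt.cross {ξ : R3} {f : ℝ → C3} {f' : C3} {t : ℝ} (h : HasDerivAt f f' t) :
    HasDerivAt (fun t => NSMaxwell.cross ξ (f t)) (NSMaxwell.cross ξ f') t :=
  ((LinearMap.toContinuousLinearMap
    (NSMaxwell.cross ξ)).restrictScalars ℝ).hasFDerivAt.comp_hasDerivAt t h

theorem norm_curlDir {ξ : R3} (hξ : 0 < ‖ξ‖) (v : C3) : ‖ξ‖ * ‖curlDir ξ v‖ = ‖cross ξ v‖ := by
  rw [curlDir, norm_smul, norm_div, Complex.norm_I, Complex.norm_real, norm_norm]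
  field_simp

theorem norm_curlDir_le {ξ : R3} (hξ : 0 < ‖ξ‖) (v : C3) : ‖curlDir ξ v‖ ≤ 6 * ‖v‖ := by
  have := norm_cross_le ξ v
  rw [← norm_curlDir hξ] at this
  exact le_of_mul_le_mul_left (by linarith) hξ

/-- By the identity for the double cross product, |ξ|²v = (ξ·v)ξ - ξ×(ξ×v). It therefore suffices to
estimate the longitudinal component and `curlDir` separately; the constant 6 is not optimal. -/
theorem norm_le_dot_add_curlDir {ξ : R3} (hξ : 0 < ‖ξ‖) (v : C3) :
    ‖v‖ ≤ ‖dot ξ v‖ / ‖ξ‖ + 6 * ‖curlDir ξ v‖ := by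
  have h1 : ((‖ξ‖ ^ 2 : ℝ) : ℂ) • v = dot ξ v • cvec ξ - cross ξ (cross ξ v) := by
    rw [cross_cross]; abel
  have h2 : ‖ξ‖ ^ 2 * ‖v‖ ≤ ‖dot ξ v‖ * ‖ξ‖ + 6 * (‖ξ‖ * (‖ξ‖ * ‖curlDir ξ v‖)) := by
    calc ‖ξ‖ ^ 2 * ‖v‖ = ‖((‖ξ‖ ^ 2 : ℝ) : ℂ) • v‖ := by
          rw [norm_smul, Complex.norm_real, Real.norm_of_nonneg (by positivity)]
      _ ≤ ‖dot ξ v • cvec ξ‖ + ‖cross ξ (cross ξ v)‖ := by rw [h1]; exact norm_sub_le _ _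
      _ ≤ _ := by
        rw [norm_smul, norm_cvec, norm_curlDir hξ]
        gcongr
        exact norm_cross_le ξ _
  have h3 : ‖ξ‖ ^ 2 * (‖dot ξ v‖ / ‖ξ‖ + 6 * ‖curlDir ξ v‖)
      = ‖dot ξ v‖ * ‖ξ‖ + 6 * (‖ξ‖ * (‖ξ‖ * ‖curlDir ξ v‖)) := by field_simp
  exact le_of_mul_le_mul_left (h2.trans_eq h3.symm) (by positivity)

section

variable {γ β μ : ℝ} {ξ : R3} {n : ℝ → ℂ} {u E B : ℝ → C3}

/-- The divergence of a curl vanishes, so the constraint propagates from time 0. -/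
theorem SymbolSol.dot_B (H : SymbolSol γ β μ ξ n u E B) (t : ℝ) : dot ξ (B t) = 0 := by
  have h : ∀ s, HasDerivAt (fun s => dot ξ (B s)) 0 s := by
    intro s
    convert! HasDerivAt.dot (ξ := ξ) (H.hB s) using 1
    rw [map_neg, map_smul, dot_cross]; simp
  have := is_const_of_deriv_eq_zero (fun s => (h s).differentiableAt) (fun s => (h s).deriv) t 0
  rw [this, H.div_B]

/-- Gauss's law propagates from time 0: the divergence of the equation for `E` and the continuity
equation for `n` cancel. -/
theorem SymbolSol.dot_E (H : SymbolSol γ β μ ξ n u E B) (t : ℝ) :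
    γ * (Complex.I * dot ξ (E t)) = -(β * n t) := by
  have h : ∀ s, HasDerivAt (fun s => γ * (Complex.I * dot ξ (E s)) + β * n s) 0 s := by
    intro s
    convert! (((HasDerivAt.dot (ξ := ξ) (H.hE s)).const_mul Complex.I).const_mul (γ : ℂ)).add
      ((H.hn s).const_mul (β : ℂ)) using 1
    rw [map_add, map_smul, map_smul, dot_cross]
    simp; ring
  have := is_const_of_deriv_eq_zero (fun s => (h s).differentiableAt) (fun s => (h s).deriv) t 0
  rw [H.div_E, neg_add_cancel] at this
  exact eq_neg_of_add_eq_zero_left this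

theorem SymbolSol.norm_dot_E (H : SymbolSol γ β μ ξ n u E B) (hγ : 0 < γ) (hβ : 0 < β) (t : ℝ) :
    γ * ‖dot ξ (E t)‖ = β * ‖n t‖ := by
  have := congrArg norm (H.dot_E t)
  simpa [abs_of_pos hγ, abs_of_pos hβ] using this

/-- On vectors orthogonal to ξ, `curlDir` is an involution, so applying it to `E` and `u` but not to
`B` replaces both curls by the scalar ‖ξ‖. The term along ξ in the equation for `u` is annihilated.
-/
theorem SymbolSol.transverse (H : SymbolSol γ β μ ξ n u E B) (hξ : 0 < ‖ξ‖) :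
    Transverse β μ ‖ξ‖ B (fun t => curlDir ξ (E t)) (fun t => curlDir ξ (u t)) where
  hb t := by
    convert! H.hB t using 1
    rw [curlDir, ← Complex.coe_smul, smul_smul, ← neg_smul]
    congr 1
    have : (‖ξ‖ : ℂ) ≠ 0 := by exact_mod_cast hξ.ne'
    push_cast
    field_simp
  he t := by
    convert! (HasDerivAt.cross (ξ := ξ) (H.hE t)).const_smul (Complex.I / (‖ξ‖ : ℂ)) using 1
    have : (‖ξ‖ : ℂ) ≠ 0 := by exact_mod_cast hξ.ne'
    rw [curlDir, map_add, map_smul, map_smul, cross_cross, H.dot_B t, ← Complex.coe_smul,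
      ← Complex.coe_smul]
    match_scalars
    · field_simp
      rw [Complex.I_sq]; ring
    · ring
    · ring
  hu t := by
    convert! (HasDerivAt.cross (ξ := ξ) (H.hu t)).const_smul (Complex.I / (‖ξ‖ : ℂ)) using 1
    have : (‖ξ‖ : ℂ) ≠ 0 := by exact_mod_cast hξ.ne'
    rw [curlDir, curlDir, map_sub, map_sub, map_smul, map_smul, map_smul, cross_cvec,
      ← Complex.coe_smul, ← Complex.coe_smul]
    match_scalars
    · ring
    · ring

/-- The density and the divergence of the velocity form a damped oscillator. -/
theorem SymbolSol.longitudinal (H : SymbolSol γ β μ ξ n u E B) (hγ : 0 < γ)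
    {ω δ : ℝ} (hω : 0 < ω) (hω2 : ω ^ 2 = γ ^ 2 * ‖ξ‖ ^ 2 + β ^ 2) (hδ : 0 ≤ δ)
    (h4 : 4 * δ ≤ μ * ‖ξ‖ ^ 2) (h2 : 2 * δ * (μ * ‖ξ‖ ^ 2) ≤ ω ^ 2) {t : ℝ} (ht : 0 ≤ t) :
    ω * ‖n t‖ ≤ 2 * (Real.exp (-(1 / 3 * δ) * t) * (ω * ‖n 0‖ + γ * ‖dot ξ (u 0)‖)) ∧
      γ * ‖dot ξ (u t)‖
        ≤ 2 * (Real.exp (-(1 / 3 * δ) * t) * (ω * ‖n 0‖ + γ * ‖dot ξ (u 0)‖)) := by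
  have hnorm : ∀ s, ‖-(γ * (Complex.I * dot ξ (u s)))‖ = γ * ‖dot ξ (u s)‖ := by
    intro s; simp [abs_of_pos hγ]
  have := oscillator_norm_le (x := n) (y := fun t => -(γ * (Complex.I * dot ξ (u t)))) hδ h4 hω h2
    H.hn (fun s => by
      convert! (((HasDerivAt.dot (ξ := ξ) (H.hu s)).const_mul Complex.I).const_mul (γ : ℂ)).neg
        using 1
      have hE := H.dot_E s
      rw [map_sub, map_sub, map_smul, map_smul, map_smul, dot_cvec, hω2]
      simp only [smul_eq_mul, Complex.real_smul]
      push_cast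
      linear_combination (-(β : ℂ)) * hE + (-(γ : ℂ) ^ 2 * n s * ‖ξ‖ ^ 2) * Complex.I_sq) ht
  simp only [hnorm] at this
  exact this

end

/-- The longitudinal oscillator and the transverse low-frequency bounds are added. The initial
density does not appear on the right because Gauss's law bounds it by ‖ξ‖‖E 0‖. -/
theorem SymbolSol.low_freq {γ β μ : ℝ} (hγ : 0 < γ) (hβ : 0 < β) (hμ : 0 < μ) :
    ∃ r₀ > 0, r₀ ≤ 1 ∧ ∃ c > 0, ∃ C > 0, ∀ ξ : R3, 0 < ‖ξ‖ → ‖ξ‖ ≤ r₀ →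
      ∀ (n : ℝ → ℂ) (u E B : ℝ → C3), SymbolSol γ β μ ξ n u E B → ∀ t, 0 ≤ t →
      ‖n t‖ ≤ C * (Real.exp (-(c * ‖ξ‖ ^ 2) * t) * (‖ξ‖ * ‖E 0‖ + ‖ξ‖ * ‖u 0‖)) ∧
      ‖u t‖ ≤ C * (Real.exp (-(c * ‖ξ‖ ^ 4) * t)
            * (‖ξ‖ * ‖B 0‖ + ‖ξ‖ ^ 2 * ‖E 0‖ + ‖ξ‖ ^ 2 * ‖u 0‖)
          + Real.exp (-(c * ‖ξ‖ ^ 2) * t) * (‖E 0‖ + ‖u 0‖)) ∧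
      ‖E t‖ ≤ C * (Real.exp (-(c * ‖ξ‖ ^ 4) * t)
            * (‖ξ‖ ^ 3 * ‖B 0‖ + ‖ξ‖ ^ 3 * ‖E 0‖ + ‖ξ‖ ^ 3 * ‖u 0‖)
          + Real.exp (-(c * ‖ξ‖ ^ 2) * t) * (‖ξ‖ * ‖B 0‖ + ‖E 0‖ + ‖u 0‖)) ∧
      ‖B t‖ ≤ C * (Real.exp (-(c * ‖ξ‖ ^ 4) * t)
            * (‖B 0‖ + ‖ξ‖ ^ 3 * ‖E 0‖ + ‖ξ‖ * ‖u 0‖)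
          + Real.exp (-(c * ‖ξ‖ ^ 2) * t) * (‖ξ‖ * ‖E 0‖)) := by
  obtain ⟨r₀, pr₀, hr₀, c₁, hc1, C₁, hC1, hT⟩ := Transverse.low_freq C3 hβ hμ
  obtain ⟨d, pd, hd1, hd2⟩ : ∃ d > 0, 4 * d ≤ μ ∧ 2 * d * μ ≤ β ^ 2 := by
    refine ⟨min (μ / 4) (β ^ 2 / (2 * μ)), by positivity, ?_, ?_⟩
    · linarith [min_le_left (μ / 4) (β ^ 2 / (2 * μ))]
    · calc 2 * min (μ / 4) (β ^ 2 / (2 * μ)) * μ ≤ 2 * (β ^ 2 / (2 * μ)) * μ := by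
            gcongr; exact min_le_right _ _
        _ = _ := by field_simp
  obtain ⟨c, hc⟩ : ∃ x, x = min c₁ (1 / 3 * d) := ⟨_, rfl⟩
  have pc : 0 < c := by rw [hc]; positivity
  have hcc1 : c ≤ c₁ := hc ▸ min_le_left _ _
  have hcd : c ≤ 1 / 3 * d := hc ▸ min_le_right _ _
  -- the longitudinal constant
  obtain ⟨L, hL⟩ : ∃ x, x = 2 * ((γ + β) * (3 * γ / β) + 3 * γ) := ⟨_, rfl⟩
  have pL : 0 < L := by rw [hL]; positivity
  obtain ⟨A, hA⟩ : ∃ x, x = L / β + L / γ := ⟨_, rfl⟩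
  have pA : 0 < A := by rw [hA]; positivity
  -- In 36 = 6·6, one factor bounds `curlDir` of the data and the other recovers a vector from its
  -- two components.
  refine ⟨r₀, pr₀, hr₀, c, pc, 36 * C₁ + A, by positivity, ?_⟩
  intro ξ hξ hξr n u E B H t ht
  set r := ‖ξ‖ with hr
  have hr1 : r ≤ 1 := hξr.trans hr₀
  obtain ⟨hb, he, hu⟩ := hT r hξ hξr _ _ _ (H.transverse hξ) t ht
  have e4 : Real.exp (-(c₁ * r ^ 4) * t) ≤ Real.exp (-(c * r ^ 4) * t) :=
    exp_neg_mul_le (by gcongr) ht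
  have e2 : Real.exp (-(c₁ * r ^ 2) * t) ≤ Real.exp (-(c * r ^ 2) * t) :=
    exp_neg_mul_le (by gcongr) ht
  set ω := √(γ ^ 2 * r ^ 2 + β ^ 2) with hω
  have hω2 : ω ^ 2 = γ ^ 2 * r ^ 2 + β ^ 2 := Real.sq_sqrt (by positivity)
  have pω : 0 < ω := Real.sqrt_pos.2 (by positivity)
  have hωβ : β ≤ ω := le_of_sq_le_sq (by rw [hω2]; linarith [(by positivity : 0 ≤ γ ^ 2 * r ^ 2)])
    pω.le
  have hr21 : r ^ 2 ≤ 1 := pow_le_one₀ hξ.le hr1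
  have hωγ : ω ≤ γ + β := by
    refine le_of_sq_le_sq ?_ (by positivity)
    rw [hω2]
    have : γ ^ 2 * r ^ 2 ≤ γ ^ 2 * 1 := by gcongr
    linarith [mul_pos hγ hβ]
  obtain ⟨hn, ha⟩ := H.longitudinal hγ (δ := d * r ^ 2) pω hω2 (by positivity)
    (by
      have := mul_le_mul_of_nonneg_right hd1 (sq_nonneg r)
      linarith)
    (by
      rw [hω2]
      calc 2 * (d * r ^ 2) * (μ * r ^ 2) = (2 * d * μ) * (r ^ 2 * r ^ 2) := by ring
        _ ≤ β ^ 2 * (1 * 1) := by gcongr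
        _ ≤ _ := by linarith [(by positivity : 0 ≤ γ ^ 2 * r ^ 2)]) ht
  have eL : Real.exp (-(1 / 3 * (d * r ^ 2)) * t) ≤ Real.exp (-(c * r ^ 2) * t) := by
    refine exp_neg_mul_le ?_ ht
    have := mul_le_mul_of_nonneg_right hcd (sq_nonneg r)
    linarith
  have h0 : ω * ‖n 0‖ + γ * ‖dot ξ (u 0)‖ ≤ L / 2 * (r * ‖E 0‖ + r * ‖u 0‖) := by
    have h1 : β * ‖n 0‖ ≤ 3 * γ * (r * ‖E 0‖) := by
      rw [← H.norm_dot_E hγ hβ 0]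
      have := mul_le_mul_of_nonneg_left (norm_dot_le ξ (E 0)) hγ.le
      linarith
    have h2 : ‖n 0‖ ≤ 3 * γ / β * (r * ‖E 0‖) := by
      rw [div_mul_eq_mul_div, le_div_iff₀ hβ]; linarith
    have h3 := norm_dot_le ξ (u 0)
    calc _ ≤ (γ + β) * (3 * γ / β * (r * ‖E 0‖)) + γ * (3 * (r * ‖u 0‖)) := by gcongr
      _ ≤ _ := by
        have h5 : 0 ≤ (γ + β) * (3 * γ / β) * (r * ‖u 0‖) := by positivity
        have h6 : 0 ≤ γ * (r * ‖E 0‖) := by positivity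
        rw [hL]; linarith
  set E4 := Real.exp (-(c * r ^ 4) * t)
  set E2 := Real.exp (-(c * r ^ 2) * t)
  have hD : 2 * (Real.exp (-(1 / 3 * (d * r ^ 2)) * t) * (ω * ‖n 0‖ + γ * ‖dot ξ (u 0)‖))
      ≤ L * (E2 * (r * ‖E 0‖ + r * ‖u 0‖)) := by
    calc _ ≤ 2 * (E2 * (L / 2 * (r * ‖E 0‖ + r * ‖u 0‖))) := by gcongr
      _ = _ := by ring
  have hn' : ‖n t‖ ≤ L / β * (E2 * (r * ‖E 0‖ + r * ‖u 0‖)) := by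
    rw [div_mul_eq_mul_div, le_div_iff₀ hβ, mul_comm]
    exact le_trans (by gcongr) (hn.trans hD)
  have ha' : ‖dot ξ (u t)‖ / r ≤ L / γ * (E2 * (‖E 0‖ + ‖u 0‖)) := by
    rw [div_le_iff₀ hξ, div_mul_eq_mul_div, div_mul_eq_mul_div, le_div_iff₀ hγ]
    have := ha.trans hD
    linarith
  have hE' : ‖dot ξ (E t)‖ / r ≤ L / γ * (E2 * (‖E 0‖ + ‖u 0‖)) := by
    rw [div_le_iff₀ hξ, div_mul_eq_mul_div, div_mul_eq_mul_div, le_div_iff₀ hγ]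
    have h1 := H.norm_dot_E hγ hβ t
    have h2 : β * ‖n t‖ ≤ ω * ‖n t‖ := by gcongr
    have := hn.trans hD
    linarith
  have je := norm_curlDir_le hξ (E 0)
  have ju := norm_curlDir_le hξ (u 0)
  have hA1 : L / β ≤ A := by rw [hA]; linarith [(by positivity : 0 < L / γ)]
  have hA2 : L / γ ≤ A := by rw [hA]; linarith [(by positivity : 0 < L / β)]
  refine ⟨?_, ?_, ?_, ?_⟩
  · refine hn'.trans ?_
    gcongr; linarith
  · refine (norm_le_dot_add_curlDir hξ (u t)).trans ?_
    calc _ ≤ A * (E2 * (‖E 0‖ + ‖u 0‖)) + 6 * (C₁ * (E4 * (r * (6 * ‖B 0‖) + r ^ 2 * (6 * ‖E 0‖)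
            + r ^ 2 * (6 * ‖u 0‖)) + E2 * (6 * ‖E 0‖ + 6 * ‖u 0‖))) := by
          gcongr
          · exact ha'.trans (by gcongr)
          · refine hu.trans ?_
            gcongr
            linarith [norm_nonneg (B 0)]
      _ ≤ _ := by
        have : 0 ≤ A * (E4 * (r * ‖B 0‖ + r ^ 2 * ‖E 0‖ + r ^ 2 * ‖u 0‖)) := by positivity
        linarith
  · refine (norm_le_dot_add_curlDir hξ (E t)).trans ?_
    calc _ ≤ A * (E2 * (‖E 0‖ + ‖u 0‖)) + 6 * (C₁ * (E4 * (r ^ 3 * (6 * ‖B 0‖)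
            + r ^ 3 * (6 * ‖E 0‖) + r ^ 3 * (6 * ‖u 0‖))
            + E2 * (r * (6 * ‖B 0‖) + 6 * ‖E 0‖ + 6 * ‖u 0‖))) := by
          gcongr
          · exact hE'.trans (by gcongr)
          · refine he.trans ?_
            gcongr <;> linarith [norm_nonneg (B 0)]
      _ ≤ _ := by
        have : 0 ≤ A * (E4 * (r ^ 3 * ‖B 0‖ + r ^ 3 * ‖E 0‖ + r ^ 3 * ‖u 0‖)) := by positivity
        have : 0 ≤ A * (E2 * (r * ‖B 0‖)) := by positivity
        linarith
  · calc ‖B t‖ ≤ C₁ * (E4 * (6 * ‖B 0‖ + r ^ 3 * (6 * ‖E 0‖) + r * (6 * ‖u 0‖))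
            + E2 * (r * (6 * ‖E 0‖))) := by
          refine hb.trans ?_
          gcongr
          linarith [norm_nonneg (B 0)]
      _ ≤ _ := by
        have : 0 ≤ (30 * C₁ + A) * (E4 * (‖B 0‖ + r ^ 3 * ‖E 0‖ + r * ‖u 0‖)
          + E2 * (r * ‖E 0‖)) := by positivity
        linarith

/-- For ‖ξ‖ ≥ r₀ the longitudinal damping μ‖ξ‖² is bounded below, so this block decays like e^{-ct}
without loss. Only the transverse block contributes the degenerate factor e^{-(c/‖ξ‖²)t}. -/
theorem SymbolSol.away_from_zero {γ β μ : ℝ} (hγ : 0 < γ) (hβ : 0 < β) (hμ : 0 < μ) {r₀ : ℝ}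
    (hr₀ : 0 < r₀) :
    ∃ c > 0, ∃ C > 0, ∀ ξ : R3, r₀ ≤ ‖ξ‖ →
      ∀ (n : ℝ → ℂ) (u E B : ℝ → C3), SymbolSol γ β μ ξ n u E B → ∀ t, 0 ≤ t →
      ‖n t‖ ≤ C * (Real.exp (-c * t) * (‖n 0‖ + ‖u 0‖)) ∧
      ‖ξ‖ ^ 4 * ‖u t‖ ≤ C * (Real.exp (-(c / ‖ξ‖ ^ 2) * t)
            * (‖ξ‖ ^ 2 * ‖B 0‖ + ‖ξ‖ ^ 2 * ‖E 0‖ + ‖u 0‖)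
          + Real.exp (-c * t) * (‖ξ‖ ^ 4 * (‖n 0‖ + ‖u 0‖))) ∧
      ‖ξ‖ ^ 2 * ‖E t‖ ≤ C * (Real.exp (-(c / ‖ξ‖ ^ 2) * t)
            * (‖ξ‖ ^ 2 * ‖B 0‖ + ‖ξ‖ ^ 2 * ‖E 0‖ + ‖u 0‖)
          + Real.exp (-c * t) * (‖ξ‖ ^ 2 * (‖E 0‖ + ‖u 0‖))) ∧
      ‖ξ‖ ^ 2 * ‖B t‖ ≤ C * (Real.exp (-(c / ‖ξ‖ ^ 2) * t)
            * (‖ξ‖ ^ 2 * ‖B 0‖ + ‖ξ‖ ^ 2 * ‖E 0‖ + ‖u 0‖)) := by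
  obtain ⟨c₁, hc1, C₁, hC1, hT⟩ := Transverse.away_from_zero C3 hβ hμ hr₀
  obtain ⟨d, pd, hd1, hd2⟩ : ∃ d > 0, 4 * d ≤ μ * r₀ ^ 2 ∧ 2 * d * μ ≤ γ ^ 2 := by
    refine ⟨min (μ * r₀ ^ 2 / 4) (γ ^ 2 / (2 * μ)), by positivity, ?_, ?_⟩
    · linarith [min_le_left (μ * r₀ ^ 2 / 4) (γ ^ 2 / (2 * μ))]
    · calc 2 * min (μ * r₀ ^ 2 / 4) (γ ^ 2 / (2 * μ)) * μ ≤ 2 * (γ ^ 2 / (2 * μ)) * μ := by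
            gcongr; exact min_le_right _ _
        _ = _ := by field_simp
  obtain ⟨c, hc⟩ : ∃ x, x = min c₁ (1 / 3 * d) := ⟨_, rfl⟩
  have pc : 0 < c := by rw [hc]; positivity
  have hcc1 : c ≤ c₁ := hc ▸ min_le_left _ _
  have hcd : c ≤ 1 / 3 * d := hc ▸ min_le_right _ _
  obtain ⟨L, hL⟩ : ∃ x, x = 2 * ((γ + β / r₀) + 3 * γ) := ⟨_, rfl⟩
  have pL : 0 < L := by rw [hL]; positivity
  obtain ⟨A, hA⟩ : ∃ x, x = L / γ + (β / γ) * (L / γ) * (3 * γ / β + 1 / r₀) := ⟨_, rfl⟩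
  have pA : 0 < A := by rw [hA]; positivity
  refine ⟨c, pc, 36 * C₁ + A, by positivity, ?_⟩
  intro ξ hξr n u E B H t ht
  set r := ‖ξ‖ with hr
  have hξ : 0 < r := hr₀.trans_le hξr
  obtain ⟨hb, he, hu⟩ := hT r hξr _ _ _ (H.transverse hξ) t ht
  have eh : Real.exp (-(c₁ / r ^ 2) * t) ≤ Real.exp (-(c / r ^ 2) * t) :=
    exp_neg_mul_le (by gcongr) ht
  have ee : Real.exp (-c₁ * t) ≤ Real.exp (-c * t) := exp_neg_mul_le hcc1 ht
  set ω := √(γ ^ 2 * r ^ 2 + β ^ 2) with hω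
  have hω2 : ω ^ 2 = γ ^ 2 * r ^ 2 + β ^ 2 := Real.sq_sqrt (by positivity)
  have pω : 0 < ω := Real.sqrt_pos.2 (by positivity)
  have hω1 : γ * r ≤ ω := le_of_sq_le_sq (by rw [hω2]; linarith [sq_nonneg β]) pω.le
  have hωγ : ω ≤ (γ + β / r₀) * r := by
    have h1 : ω ≤ γ * r + β := by
      refine le_of_sq_le_sq ?_ (by positivity)
      rw [hω2]
      linarith [(by positivity : 0 ≤ γ * r * β)]
    have h2 : β ≤ β / r₀ * r := by
      rw [div_mul_eq_mul_div, le_div_iff₀ hr₀]; gcongr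
    linarith
  have hr02 : r₀ ^ 2 ≤ r ^ 2 := by gcongr
  obtain ⟨hn, ha⟩ := H.longitudinal hγ (δ := d) pω hω2 pd.le
    (hd1.trans (by gcongr))
    (by
      rw [hω2]
      have := mul_le_mul_of_nonneg_right hd2 (sq_nonneg r)
      linarith [sq_nonneg β]) ht
  have eL : Real.exp (-(1 / 3 * d) * t) ≤ Real.exp (-c * t) := exp_neg_mul_le hcd ht
  have h0 : ω * ‖n 0‖ + γ * ‖dot ξ (u 0)‖ ≤ L / 2 * (r * (‖n 0‖ + ‖u 0‖)) := by
    have h3 := norm_dot_le ξ (u 0)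
    calc _ ≤ (γ + β / r₀) * r * ‖n 0‖ + γ * (3 * (r * ‖u 0‖)) := by gcongr
      _ ≤ _ := by
        have h5 : 0 ≤ (γ + β / r₀) * (r * ‖u 0‖) := by positivity
        have h6 : 0 ≤ γ * (r * ‖n 0‖) := by positivity
        rw [hL]; linarith
  set Eh := Real.exp (-(c / r ^ 2) * t)
  set Ee := Real.exp (-c * t)
  have hD : 2 * (Real.exp (-(1 / 3 * d) * t) * (ω * ‖n 0‖ + γ * ‖dot ξ (u 0)‖))
      ≤ L * (Ee * (r * (‖n 0‖ + ‖u 0‖))) := by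
    calc _ ≤ 2 * (Ee * (L / 2 * (r * (‖n 0‖ + ‖u 0‖)))) := by gcongr
      _ = _ := by ring
  have hn' : ‖n t‖ ≤ L / γ * (Ee * (‖n 0‖ + ‖u 0‖)) := by
    have h1 : γ * r * ‖n t‖ ≤ γ * r * (L / γ * (Ee * (‖n 0‖ + ‖u 0‖))) := by
      calc γ * r * ‖n t‖ ≤ ω * ‖n t‖ := by gcongr
        _ ≤ _ := hn.trans hD
        _ = _ := by field_simp
    exact le_of_mul_le_mul_left h1 (by positivity)
  have ha' : ‖dot ξ (u t)‖ / r ≤ L / γ * (Ee * (‖n 0‖ + ‖u 0‖)) := by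
    rw [div_le_iff₀ hξ, div_mul_eq_mul_div, div_mul_eq_mul_div, le_div_iff₀ hγ]
    have := ha.trans hD
    linarith
  -- Gauss's law is used at both times: at time t to pass from `E` to `n`, and at time 0 to replace
  -- ‖n 0‖/r by ‖E 0‖. Hence no norm of the initial density enters the bound for `E`.
  have hE' : ‖dot ξ (E t)‖ / r ≤ A * (Ee * (‖E 0‖ + ‖u 0‖)) := by
    have h1 : ‖dot ξ (E t)‖ = β / γ * ‖n t‖ := by
      rw [div_mul_eq_mul_div, eq_div_iff hγ.ne', mul_comm, H.norm_dot_E hγ hβ t]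
    have h2 : β * ‖n 0‖ ≤ 3 * γ * (r * ‖E 0‖) := by
      rw [← H.norm_dot_E hγ hβ 0]
      have := mul_le_mul_of_nonneg_left (norm_dot_le ξ (E 0)) hγ.le
      linarith
    have h3 : ‖n 0‖ / r ≤ 3 * γ / β * ‖E 0‖ := by
      rw [div_le_iff₀ hξ, div_mul_eq_mul_div, div_mul_eq_mul_div, le_div_iff₀ hβ]; linarith
    have h4 : ‖u 0‖ / r ≤ 1 / r₀ * ‖u 0‖ := by
      rw [div_eq_inv_mul, one_div]; gcongr
    have h5 : (‖n 0‖ + ‖u 0‖) / r ≤ (3 * γ / β + 1 / r₀) * (‖E 0‖ + ‖u 0‖) := by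
      rw [add_div]
      have h6 : 0 ≤ 1 / r₀ * ‖E 0‖ := by positivity
      have h7 : 0 ≤ 3 * γ / β * ‖u 0‖ := by positivity
      linarith
    calc ‖dot ξ (E t)‖ / r = β / γ * ‖n t‖ / r := by rw [h1]
      _ ≤ β / γ * (L / γ * (Ee * (‖n 0‖ + ‖u 0‖))) / r := by gcongr
      _ = β / γ * (L / γ) * Ee * ((‖n 0‖ + ‖u 0‖) / r) := by ring
      _ ≤ β / γ * (L / γ) * Ee * ((3 * γ / β + 1 / r₀) * (‖E 0‖ + ‖u 0‖)) := by gcongr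
      _ = (β / γ * (L / γ) * (3 * γ / β + 1 / r₀)) * (Ee * (‖E 0‖ + ‖u 0‖)) := by ring
      _ ≤ _ := by
        gcongr
        rw [hA]
        linarith [(by positivity : 0 < L / γ)]
  have je := norm_curlDir_le hξ (E 0)
  have ju := norm_curlDir_le hξ (u 0)
  have hA1 : L / γ ≤ A := by
    rw [hA]; linarith [(by positivity : 0 < (β / γ) * (L / γ) * (3 * γ / β + 1 / r₀))]
  have hS : r ^ 2 * ‖B 0‖ + r ^ 2 * ‖curlDir ξ (E 0)‖ + ‖curlDir ξ (u 0)‖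
      ≤ 6 * (r ^ 2 * ‖B 0‖ + r ^ 2 * ‖E 0‖ + ‖u 0‖) := by
    have h1 : r ^ 2 * ‖curlDir ξ (E 0)‖ ≤ r ^ 2 * (6 * ‖E 0‖) := by gcongr
    have h2 : 0 ≤ r ^ 2 * ‖B 0‖ := by positivity
    linarith
  set S := r ^ 2 * ‖B 0‖ + r ^ 2 * ‖E 0‖ + ‖u 0‖ with hSdef
  have pS : 0 ≤ S := by positivity
  refine ⟨?_, ?_, ?_, ?_⟩
  · refine hn'.trans ?_
    gcongr; linarith
  · calc r ^ 4 * ‖u t‖ ≤ r ^ 4 * (‖dot ξ (u t)‖ / r + 6 * ‖curlDir ξ (u t)‖) := by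
          gcongr; exact norm_le_dot_add_curlDir hξ (u t)
      _ = r ^ 4 * (‖dot ξ (u t)‖ / r) + 6 * (r ^ 4 * ‖curlDir ξ (u t)‖) := by ring
      _ ≤ r ^ 4 * (A * (Ee * (‖n 0‖ + ‖u 0‖)))
          + 6 * (C₁ * (Eh * (6 * S) + Ee * (r ^ 4 * (6 * ‖u 0‖)))) := by
        have h1 : ‖dot ξ (u t)‖ / r ≤ A * (Ee * (‖n 0‖ + ‖u 0‖)) := ha'.trans (by gcongr)
        have h2 : r ^ 4 * ‖curlDir ξ (u t)‖ ≤ C₁ * (Eh * (6 * S) + Ee * (r ^ 4 * (6 * ‖u 0‖))) :=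
          hu.trans (by gcongr)
        exact add_le_add (mul_le_mul_of_nonneg_left h1 (by positivity))
          (mul_le_mul_of_nonneg_left h2 (by norm_num))
      _ ≤ _ := by
        have h1 : 0 ≤ A * (Eh * S) := by positivity
        have h2 : 0 ≤ C₁ * (Ee * (r ^ 4 * ‖n 0‖)) := by positivity
        linarith
  · calc r ^ 2 * ‖E t‖ ≤ r ^ 2 * (‖dot ξ (E t)‖ / r + 6 * ‖curlDir ξ (E t)‖) := by
          gcongr; exact norm_le_dot_add_curlDir hξ (E t)
      _ = r ^ 2 * (‖dot ξ (E t)‖ / r) + 6 * (r ^ 2 * ‖curlDir ξ (E t)‖) := by ring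
      _ ≤ r ^ 2 * (A * (Ee * (‖E 0‖ + ‖u 0‖))) + 6 * (C₁ * (Eh * (6 * S))) := by
        have h2 : r ^ 2 * ‖curlDir ξ (E t)‖ ≤ C₁ * (Eh * (6 * S)) := he.trans (by gcongr)
        exact add_le_add (mul_le_mul_of_nonneg_left hE' (by positivity))
          (mul_le_mul_of_nonneg_left h2 (by norm_num))
      _ ≤ _ := by
        have h1 : 0 ≤ A * (Eh * S) := by positivity
        have h2 : 0 ≤ C₁ * (Ee * (r ^ 2 * (‖E 0‖ + ‖u 0‖))) := by positivity
        linarith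
  · calc r ^ 2 * ‖B t‖ ≤ C₁ * (Eh * (6 * S)) := hb.trans (by gcongr)
      _ ≤ _ := by
        have h1 : 0 ≤ (30 * C₁ + A) * (Eh * S) := by positivity
        linarith

section Density

open SchwartzMap Filter
open scoped ContDiff

/-- A bounded smooth function vanishing near the origin, dilated by a large factor, is small
against Schwartz functions. -/
theorem exists_iteratedFDeriv_comp_smul_le {h : R3 → ℂ} (hh : ContDiff ℝ ∞ h)
    (h0 : ∀ x, ‖h x‖ ≤ ‖x‖) (hb : ∀ i : ℕ, 1 ≤ i → ∃ M : ℝ, ∀ x, ‖iteratedFDeriv ℝ i h x‖ ≤ M)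
    (n : ℕ) :
    ∃ M : ℝ, 0 ≤ M ∧ ∀ ε : ℝ, 0 ≤ ε → ε ≤ 1 → ∀ i ≤ n, ∀ x,
      ‖iteratedFDeriv ℝ i (fun y => h (ε • y)) x‖ ≤ ε * M * (1 + ‖x‖) := by
  have key : ∀ i : ℕ, ∃ M : ℝ, 0 ≤ M ∧ ∀ ε : ℝ, 0 ≤ ε → ε ≤ 1 → ∀ x,
      ‖iteratedFDeriv ℝ i (fun y => h (ε • y)) x‖ ≤ ε * M * (1 + ‖x‖) := by
    intro i
    rcases Nat.eq_zero_or_pos i with rfl | hi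
    · refine ⟨1, zero_le_one, fun ε hε _ x => ?_⟩
      rw [norm_iteratedFDeriv_zero]
      have := h0 (ε • x)
      rw [norm_smul, Real.norm_of_nonneg hε] at this
      linarith
    · obtain ⟨M, hM⟩ := hb i hi
      have hM0 : 0 ≤ M := (norm_nonneg _).trans (hM 0)
      refine ⟨M, hM0, fun ε hε hε1 x => ?_⟩
      have hi : ContDiff ℝ i h := hh.of_le (by exact_mod_cast le_top)
      rw [iteratedFDeriv_comp_const_smul ε hi]
      simp only [norm_smul, norm_pow, Real.norm_of_nonneg hε]
      have h1 : ε ^ i ≤ ε := pow_le_of_le_one hε hε1 (by omega)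
      calc ε ^ i * ‖iteratedFDeriv ℝ i h (ε • x)‖ ≤ ε * M :=
            mul_le_mul h1 (hM _) (norm_nonneg _) hε
        _ ≤ ε * M * (1 + ‖x‖) := le_mul_of_one_le_right (by positivity) (by linarith [norm_nonneg x])
  choose M hM0 hM using key
  refine ⟨∑ i ∈ Finset.range (n + 1), M i, Finset.sum_nonneg fun i _ => hM0 i,
    fun ε hε hε1 i hi x => (hM i ε hε hε1 x).trans ?_⟩
  have : M i ≤ ∑ i ∈ Finset.range (n + 1), M i :=
    Finset.single_le_sum (f := M) (fun i _ => hM0 i) (Finset.mem_range.2 (by omega))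
  gcongr

/-- By the Leibniz rule each Schwartz seminorm of `g m` is O(1/(m+1)). The linear growth 1 + ‖x‖ of
the dilated factor is absorbed by the seminorm with one more power of ‖x‖. -/
theorem tendsto_smul_dilation {h : R3 → ℂ} (hh : ContDiff ℝ ∞ h)
    (h0 : ∀ x, ‖h x‖ ≤ ‖x‖) (hb : ∀ i : ℕ, 1 ≤ i → ∃ M : ℝ, ∀ x, ‖iteratedFDeriv ℝ i h x‖ ≤ M)
    (ψ : 𝓢(R3, ℂ)) (g : ℕ → 𝓢(R3, ℂ))
    (hg : ∀ m x, g m x = h ((1 / ((m : ℝ) + 1)) • x) * ψ x) : Tendsto g atTop (𝓝 0) := by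
  refine ((schwartz_withSeminorms ℂ R3 ℂ).tendsto_nhds_atTop _ _).2 ?_
  rintro ⟨k, n⟩ δ hδ
  obtain ⟨M, hM0, hM⟩ := exists_iteratedFDeriv_comp_smul_le hh h0 hb n
  set K : ℝ := ∑ i ∈ Finset.range (n + 1), (n.choose i : ℝ) * M *
    (SchwartzMap.seminorm ℂ k (n - i) ψ + SchwartzMap.seminorm ℂ (k + 1) (n - i) ψ) with hK
  have hK0 : 0 ≤ K := Finset.sum_nonneg fun i _ => by positivity
  have hbound : ∀ m, SchwartzMap.seminorm ℂ k n (g m) ≤ 1 / ((m : ℝ) + 1) * K := by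
    intro m
    set ε : ℝ := 1 / ((m : ℝ) + 1) with hε
    have hε0 : 0 ≤ ε := by positivity
    have hε1 : ε ≤ 1 := by
      rw [hε, div_le_one (by positivity)]; linarith [(Nat.cast_nonneg m : (0 : ℝ) ≤ m)]
    refine SchwartzMap.seminorm_le_bound ℂ k n _ (by positivity) fun x => ?_
    have hgm : (g m : R3 → ℂ) = fun x => h (ε • x) • ψ x := by ext x; simp [hg m x, hε]
    rw [hgm]
    have := norm_iteratedFDeriv_smul_le (𝕜 := ℝ) (f := fun y => h (ε • y)) (g := ψ) (N := ∞)
      (hh.comp (contDiff_const_smul ε)) (ψ.smooth ⊤) x (n := n) (by exact_mod_cast le_top)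
    refine (mul_le_mul_of_nonneg_left this (by positivity)).trans ?_
    rw [Finset.mul_sum, hK, Finset.mul_sum]
    refine Finset.sum_le_sum fun i hi => ?_
    have h1 := hM ε hε0 hε1 i (by simpa [Nat.lt_succ_iff] using hi) x
    have h2 := SchwartzMap.le_seminorm ℂ k (n - i) ψ x
    have h3 := SchwartzMap.le_seminorm ℂ (k + 1) (n - i) ψ x
    calc ‖x‖ ^ k * ((n.choose i : ℝ) * ‖iteratedFDeriv ℝ i (fun y => h (ε • y)) x‖ *
          ‖iteratedFDeriv ℝ (n - i) ψ x‖)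
        ≤ ‖x‖ ^ k * ((n.choose i : ℝ) * (ε * M * (1 + ‖x‖)) * ‖iteratedFDeriv ℝ (n - i) ψ x‖) := by
          gcongr
      _ = ε * ((n.choose i : ℝ) * M * (‖x‖ ^ k * ‖iteratedFDeriv ℝ (n - i) ψ x‖
          + ‖x‖ ^ (k + 1) * ‖iteratedFDeriv ℝ (n - i) ψ x‖)) := by ring
      _ ≤ _ := by gcongr
  have hlim : Tendsto (fun m : ℕ => 1 / ((m : ℝ) + 1) * K) atTop (𝓝 0) := by
    simpa using tendsto_one_div_add_atTop_nhds_zero_nat.mul_const K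
  obtain ⟨N, hN⟩ := (hlim.eventually (gt_mem_nhds hδ)).exists_forall_of_atTop
  exact ⟨N, fun m hm => by
    simpa using (hbound m).trans_lt (hN m hm)⟩

/-- A continuous functional on Schwartz functions is determined by its values on real test
functions. -/
theorem clm_eq_zero_of_test (T : 𝓢(R3, ℂ) →L[ℂ] ℂ)
    (hT : ∀ (φ : Test) (ψ : 𝓢(R3, ℂ)), (∀ x, ψ x = (φ x : ℂ)) → T ψ = 0) : T = 0 := by
  -- The real and imaginary parts of a compactly supported Schwartz function are test functions.
  have hcpt : ∀ ψ : 𝓢(R3, ℂ), HasCompactSupport ψ → T ψ = 0 := by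
    intro ψ hψ
    have hs := ψ.smooth ⊤
    let φ₁ : Test := ⟨fun x => (ψ x).re, Complex.reCLM.contDiff.comp hs,
      hψ.comp_left (g := Complex.re) rfl, fun _ _ => trivial⟩
    let φ₂ : Test := ⟨fun x => (ψ x).im, Complex.imCLM.contDiff.comp hs,
      hψ.comp_left (g := Complex.im) rfl, fun _ _ => trivial⟩
    have hc : ∀ φ : Test, HasCompactSupport (fun x => (φ x : ℂ)) := fun φ =>
      φ.hasCompactSupport.comp_left (g := fun r : ℝ => (r : ℂ)) (by simp)
    have hd : ∀ φ : Test, ContDiff ℝ ∞ (fun x => (φ x : ℂ)) := fun φ =>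
      Complex.ofRealCLM.contDiff.comp φ.contDiff
    have h : ψ = (hc φ₁).toSchwartzMap (hd φ₁) + Complex.I • (hc φ₂).toSchwartzMap (hd φ₂) := by
      ext x
      change ψ x = ((ψ x).re : ℂ) + Complex.I • ((ψ x).im : ℂ)
      rw [smul_eq_mul, mul_comm, Complex.re_add_im]
    rw [h, map_add, map_smul, hT φ₁ _ fun x => rfl, hT φ₂ _ fun x => rfl]
    simp
  -- With the cutoff equal to 1 on the unit ball, h = 1 - f satisfies |h(x)| ≤ ‖x‖. The truncation
  -- errors ψ - f(·/(m+1))ψ = h(·/(m+1))ψ then tend to 0 in Schwartz space.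
  let f : ContDiffBump (0 : R3) := ⟨1, 2, one_pos, one_lt_two⟩
  let h : R3 → ℂ := fun x => 1 - (f x : ℂ)
  have hf : ContDiff ℝ ∞ (fun x => (f x : ℂ)) := Complex.ofRealCLM.contDiff.comp f.contDiff
  have hfc : HasCompactSupport (fun x => (f x : ℂ)) :=
    f.hasCompactSupport.comp_left (g := fun r : ℝ => (r : ℂ)) (by simp)
  have hh : ContDiff ℝ ∞ h := contDiff_const.sub hf
  have h0 : ∀ x, ‖h x‖ ≤ ‖x‖ := by
    intro x
    rcases le_or_gt ‖x‖ 1 with hx | hx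
    · have : f x = 1 := f.one_of_mem_closedBall (by simpa [f] using hx)
      simp [h, this]
    · refine le_trans ?_ hx.le
      have h1 : h x = ((1 - f x : ℝ) : ℂ) := by simp [h]
      rw [h1, Complex.norm_real, Real.norm_eq_abs, abs_le]
      constructor <;> linarith [f.le_one (x := x), f.nonneg (x := x)]
  have hb : ∀ i : ℕ, 1 ≤ i → ∃ M : ℝ, ∀ x, ‖iteratedFDeriv ℝ i h x‖ ≤ M := by
    intro i hi
    have h1 : iteratedFDeriv ℝ i h = fun x => -iteratedFDeriv ℝ i (fun x => (f x : ℂ)) x := by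
      ext1 x
      have : h = (fun _ => (1 : ℂ)) - fun x => (f x : ℂ) := rfl
      rw [this, iteratedFDeriv_sub_apply contDiff_const.contDiffAt
        (hf.of_le (by exact_mod_cast le_top)).contDiffAt,
        iteratedFDeriv_const_of_ne (by omega)]
      simp
    obtain ⟨M, hM⟩ := (hfc.iteratedFDeriv (𝕜 := ℝ) i).exists_bound_of_continuous
      (hf.continuous_iteratedFDeriv (by exact_mod_cast le_top))
    exact ⟨M, fun x => by rw [h1]; simpa using hM x⟩
  ext ψ
  have hcc : ∀ m : ℕ, HasCompactSupport fun x => (f ((1 / ((m : ℝ) + 1)) • x) : ℂ) := fun m =>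
    hfc.comp_smul (by positivity)
  have hcs : ∀ m : ℕ, HasCompactSupport fun x => (f ((1 / ((m : ℝ) + 1)) • x) : ℂ) * ψ x :=
    fun m => (hcc m).mul_right
  have hcd : ∀ m : ℕ, ContDiff ℝ ∞ fun x => (f ((1 / ((m : ℝ) + 1)) • x) : ℂ) * ψ x :=
    fun m => (hf.comp (contDiff_const_smul _)).mul (ψ.smooth ⊤)
  have hlim := tendsto_smul_dilation hh h0 hb ψ
    (fun m => ψ - (hcs m).toSchwartzMap (hcd m)) (fun m x => by
      change ψ x - (f ((1 / ((m : ℝ) + 1)) • x) : ℂ) * ψ x = _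
      simp only [h]; ring)
  have hlim' := (T.continuous.tendsto 0).comp hlim
  have hconst : (T ∘ fun m => ψ - (hcs m).toSchwartzMap (hcd m)) = fun _ : ℕ => T ψ := by
    ext m
    simp only [Function.comp, map_sub]
    rw [hcpt ((hcs m).toSchwartzMap (hcd m)) (hcs m), sub_zero]
  rw [hconst, map_zero] at hlim'
  exact tendsto_nhds_unique tendsto_const_nhds hlim'

end Density

/-! ### Fourier symbols of distributional derivatives of scalar functions -/

section Symbols

open SchwartzMap FourierTransform LineDeriv
open scoped ContDiff

/-- The Fourier transform of a real-valued square integrable function. -/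
noncomputable def ft : L2 ℝ →L[ℝ] L2 ℂ :=
  ((Lp.fourierTransformₗᵢ R3 ℂ).toContinuousLinearEquiv.toContinuousLinearMap.restrictScalars ℝ) ∘L
    (Complex.ofRealCLM.compLpL 2 volume)

theorem ft_apply (f : L2 ℝ) : ft f = 𝓕 (Complex.ofRealCLM.compLpL 2 volume f) := rfl

theorem norm_ft (f : L2 ℝ) : ‖ft f‖ = ‖f‖ := by
  rw [ft_apply, Lp.norm_fourier_eq]
  refine le_antisymm (Lp.norm_le_norm_of_ae_le ?_) (Lp.norm_le_norm_of_ae_le ?_) <;>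
  · filter_upwards [Complex.ofRealCLM.coeFn_compLpL f] with x hx
    simp [hx]

/-- The multiplication formula for the Fourier transform, which is the case without derivatives of
the pairing required in `HasSymbol`. -/
theorem integral_mul_fourier (f : L2 ℝ) (η : 𝓢(R3, ℂ)) :
    ∫ x, (𝓕 η) x * (f x : ℂ) = ∫ k, η k * ft f k := by
  have h := congrArg (fun T => T η)
    (Lp.fourier_toTemperedDistribution_eq (Complex.ofRealCLM.compLpL 2 volume f))
  simp only [TemperedDistribution.fourier_apply, Lp.toTemperedDistribution_apply,
    smul_eq_mul] at h
  rw [ft_apply, ← h]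
  refine integral_congr_ae ?_
  filter_upwards [Complex.ofRealCLM.coeFn_compLpL f] with x hx
  simp [hx]

/-- The functional `L` on test functions extends to a tempered distribution whose Fourier transform
is the function `m`. -/
structure HasSymbol (L : Test → ℝ) (m : R3 → ℂ) : Prop where
  locallyIntegrable : LocallyIntegrable m
  exists_clm : ∃ T : 𝓢(R3, ℂ) →L[ℂ] ℂ,
    (∀ (φ : Test) (ψ : 𝓢(R3, ℂ)), (∀ x, ψ x = (φ x : ℂ)) → T ψ = L φ) ∧
    ∀ η : 𝓢(R3, ℂ), Integrable (fun x => η x * m x) ∧ T (𝓕 η) = ∫ x, η x * m x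

namespace HasSymbol

variable {L L' : Test → ℝ} {m m' : R3 → ℂ}

theorem add (h : HasSymbol L m) (h' : HasSymbol L' m') :
    HasSymbol (fun φ => L φ + L' φ) (fun k => m k + m' k) := by
  obtain ⟨T, hT, hm⟩ := h.exists_clm
  obtain ⟨T', hT', hm'⟩ := h'.exists_clm
  refine ⟨h.locallyIntegrable.add h'.locallyIntegrable, T + T', fun φ ψ hψ => ?_, fun η => ?_⟩
  · simp [hT φ ψ hψ, hT' φ ψ hψ]
  · simp only [mul_add]
    refine ⟨(hm η).1.add (hm' η).1, ?_⟩
    rw [integral_add (hm η).1 (hm' η).1, ← (hm η).2, ← (hm' η).2]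
    rfl

theorem const_mul (c : ℝ) (h : HasSymbol L m) :
    HasSymbol (fun φ => c * L φ) (fun k => c * m k) := by
  obtain ⟨T, hT, hm⟩ := h.exists_clm
  refine ⟨h.locallyIntegrable.smul (c : ℂ), (c : ℂ) • T, fun φ ψ hψ => ?_, fun η => ?_⟩
  · simp [hT φ ψ hψ]
  · simp only [mul_left_comm _ (c : ℂ)]
    refine ⟨(hm η).1.const_mul _, ?_⟩
    rw [integral_const_mul, ← (hm η).2]
    rfl

theorem congr (h : HasSymbol L m) (hL : ∀ φ, L φ = L' φ) (hm : ∀ᵐ k, m k = m' k) :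
    HasSymbol L' m' := by
  obtain ⟨T, hT, hT'⟩ := h.exists_clm
  have hm' : ∀ η : 𝓢(R3, ℂ), (fun x => η x * m x) =ᵐ[volume] fun x => η x * m' x := fun η => by
    filter_upwards [hm] with x hx
    rw [hx]
  refine ⟨h.locallyIntegrable.congr hm, T, fun φ ψ hψ => by rw [hT φ ψ hψ, hL], fun η =>
    ⟨(hT' η).1.congr (hm' η), ?_⟩⟩
  rw [(hT' η).2, integral_congr_ae (hm' η)]

theorem neg (h : HasSymbol L m) : HasSymbol (fun φ => -L φ) (fun k => -m k) :=
  (h.const_mul (-1)).congr (fun φ => by simp) (by simp)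

theorem sub (h : HasSymbol L m) (h' : HasSymbol L' m') :
    HasSymbol (fun φ => L φ - L' φ) (fun k => m k - m' k) :=
  (h.add h'.neg).congr (fun φ => by ring) (by simp [sub_eq_add_neg])

theorem zero : HasSymbol (fun _ => 0) (fun _ => 0) :=
  ⟨locallyIntegrable_zero, 0, by simp, by simp⟩

theorem sum {ι : Type*} (s : Finset ι) {L : ι → Test → ℝ} {m : ι → R3 → ℂ}
    (h : ∀ i, HasSymbol (L i) (m i)) :
    HasSymbol (fun φ => ∑ i ∈ s, L i φ) (fun k => ∑ i ∈ s, m i k) := by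
  classical
  induction s using Finset.induction_on with
  | empty => simpa using zero
  | insert a s ha ih => simpa [Finset.sum_insert ha] using (h a).add ih

/-- Uniqueness of symbols: a functional vanishing on all test functions extends only by 0, so its
symbol integrates to 0 against every test function. This turns distributional equations into
identities at almost every frequency. -/
theorem ae_eq_zero (h : HasSymbol L m) (hL : ∀ φ, L φ = 0) : ∀ᵐ k, m k = 0 := by
  obtain ⟨T, hT, hm⟩ := h.exists_clm
  have hT0 : T = 0 := clm_eq_zero_of_test T fun φ ψ hψ => by simp [hT φ ψ hψ, hL]
  refine ae_eq_zero_of_integral_contDiff_smul_eq_zero h.locallyIntegrable fun g hg hgc => ?_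
  have hc : HasCompactSupport (fun x => (g x : ℂ)) :=
    hgc.comp_left (g := fun r : ℝ => (r : ℂ)) (by simp)
  have := (hm (hc.toSchwartzMap (Complex.ofRealCLM.contDiff.comp hg))).2
  rw [hT0] at this
  exact this.symm

/-- The symbol of an operator acting on Schwartz functions through the Fourier transform. -/
theorem of_operator (f : L2 ℝ) (D : 𝓢(R3, ℂ) →L[ℂ] 𝓢(R3, ℂ)) {p : R3 → ℂ} (hp : Continuous p)
    (hD : ∀ η : 𝓢(R3, ℂ), ∃ η' : 𝓢(R3, ℂ), D (𝓕 η) = 𝓕 η' ∧ ∀ x, η' x = p x * η x) {d : Test → R3 → ℝ}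
    (hd : ∀ (φ : Test) (ψ : 𝓢(R3, ℂ)), (∀ x, ψ x = (φ x : ℂ)) → ∀ x, D ψ x = (d φ x : ℂ)) :
    HasSymbol (fun φ => ∫ x, f x * d φ x) (fun k => p k * ft f k) := by
  have hloc : LocallyIntegrable (ft f : R3 → ℂ) := (Lp.memLp (ft f)).locallyIntegrable (by norm_num)
  refine ⟨hloc.continuous_mul hp,
    (Lp.toTemperedDistribution (Complex.ofRealCLM.compLpL 2 volume f) : 𝓢(R3, ℂ) →L[ℂ] ℂ) ∘L D,
    fun φ ψ hψ => ?_, fun η => ?_⟩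
  · change (Lp.toTemperedDistribution (Complex.ofRealCLM.compLpL 2 volume f)) (D ψ) = _
    rw [Lp.toTemperedDistribution_apply, ← integral_complex_ofReal]
    refine integral_congr_ae ?_
    filter_upwards [Complex.ofRealCLM.coeFn_compLpL f] with x hx
    rw [hx, hd φ ψ hψ x]
    simp [mul_comm]
  · obtain ⟨η', h1, h2⟩ := hD η
    have h3 : (fun x => η x * (p x * ft f x)) = fun x => η' x * ft f x := by
      ext x; rw [h2]; ring
    rw [h3]
    refine ⟨(η'.memLp 2).integrable_mul (Lp.memLp (ft f)), ?_⟩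
    change (Lp.toTemperedDistribution (Complex.ofRealCLM.compLpL 2 volume f)) (D (𝓕 η)) = _
    rw [Lp.toTemperedDistribution_apply, h1, ← integral_mul_fourier]
    refine integral_congr_ae ?_
    filter_upwards [Complex.ofRealCLM.coeFn_compLpL f] with x hx
    rw [hx]
    simp

end HasSymbol

/-- Each derivative falls on the kernel of the transform, which gives the factor -2πi. The
derivative here acts on the test function; passing to the distributional derivative of odd order
restores the sign +2πi. -/
theorem iteratedLineDerivOp_fourier {j : ℕ} (s : Fin j → R3) (η : 𝓢(R3, ℂ)) :
    ∃ η' : 𝓢(R3, ℂ), ∂^{s} (𝓕 η) = 𝓕 η' ∧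
      ∀ x, η' x = (∏ a, -(2 * Real.pi * Complex.I * (inner ℝ x (s a) : ℝ))) * η x := by
  induction j with
  | zero => exact ⟨η, rfl, by simp⟩
  | succ j ih =>
    obtain ⟨η₁, h1, h2⟩ := ih (Fin.tail s)
    refine ⟨-(2 * Real.pi * Complex.I) • smulLeftCLM ℂ (inner ℝ · (s 0)) η₁, ?_, fun x => ?_⟩
    · rw [iteratedLineDerivOp_succ_left, h1, SchwartzMap.lineDerivOp_fourier_eq]
    · have : (inner ℝ · (s 0) : R3 → ℝ).HasTemperateGrowth := by fun_prop
      rw [Fin.prod_univ_succ]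
      change -(2 * Real.pi * Complex.I) • (smulLeftCLM ℂ (inner ℝ · (s 0)) η₁) x = _
      rw [smulLeftCLM_apply_apply this, h2]
      simp only [smul_eq_mul, Complex.real_smul, Fin.tail]
      ring

theorem inner_e (x : R3) (i : Fin 3) : inner ℝ x (e i) = x i := by
  simp [e, EuclideanSpace.inner_single_right]

theorem iteratedFDeriv_ofReal_test {j : ℕ} (s : Fin j → R3) (φ : Test) (ψ : 𝓢(R3, ℂ))
    (h : ∀ x, ψ x = (φ x : ℂ)) (x : R3) :
    (∂^{s} ψ) x = ((iteratedFDeriv ℝ j φ x s : ℝ) : ℂ) := by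
  rw [iteratedLineDerivOp_eq_iteratedFDeriv]
  have h1 : (ψ : R3 → ℂ) = Complex.ofRealCLM ∘ φ := funext h
  rw [h1, ContinuousLinearMap.iteratedFDeriv_comp_left (i := j) _ φ.contDiff.contDiffAt
    (by exact_mod_cast le_top)]
  rfl

/-- The symbol of an iterated distributional derivative. -/
theorem hasSymbol_iteratedFDeriv (f : L2 ℝ) {j : ℕ} (s : Fin j → Fin 3) :
    HasSymbol (fun φ => ∫ x, f x * iteratedFDeriv ℝ j φ x (fun a => e (s a)))
      (fun k => (∏ a, -(2 * Real.pi * Complex.I * (k (s a) : ℝ))) * ft f k) := by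
  refine HasSymbol.of_operator f (iteratedLineDerivOpCLM ℂ 𝓢(R3, ℂ) fun a => e (s a))
    (by fun_prop) (fun η => ?_) (fun φ ψ h x => iteratedFDeriv_ofReal_test _ φ ψ h x)
  simpa only [inner_e, iteratedLineDerivOpCLM_apply] using iteratedLineDerivOp_fourier (fun a => e (s a)) η

theorem hasSymbol_pair (f : L2 ℝ) : HasSymbol (pair f) (ft f) :=
  (hasSymbol_iteratedFDeriv f (j := 0) (fun a => a.elim0)).congr (fun φ => by simp [pair])
    (by simp)

theorem hasSymbol_distPartial (i : Fin 3) (f : L2 ℝ) :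
    HasSymbol (distPartial i f) (fun k => 2 * Real.pi * Complex.I * (k i : ℝ) * ft f k) :=
  (hasSymbol_iteratedFDeriv f (j := 1) (fun _ => i)).neg.congr
    (fun φ => by simp [distPartial, iteratedFDeriv_one_apply]) (by simp)

theorem hasSymbol_distLaplacian (f : L2 ℝ) :
    HasSymbol (distLaplacian f) (fun k => -(2 * Real.pi * ‖k‖ : ℝ) ^ 2 * ft f k) := by
  have h := HasSymbol.of_operator f
    (∑ i : Fin 3, iteratedLineDerivOpCLM ℂ 𝓢(R3, ℂ) ![e i, e i])
    (p := fun k => ∑ i : Fin 3, (-(2 * Real.pi * Complex.I * (k i : ℝ))) ^ 2)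
    (d := fun φ => (Laplacian.laplacian (φ : R3 → ℝ) : R3 → ℝ)) (by fun_prop) (fun η => ?_) ?_
  · refine h.congr (fun φ => rfl) (.of_forall fun k => ?_)
    have : (‖k‖ : ℂ) ^ 2 = ∑ i, (k i : ℂ) ^ 2 := by
      exact_mod_cast EuclideanSpace.real_norm_sq_eq k
    simp only [neg_sq, mul_pow, Complex.I_sq, ← Finset.mul_sum, ← this]
    push_cast
    ring
  · choose η' h1 h2 using fun i => iteratedLineDerivOp_fourier ![e i, e i] η
    refine ⟨∑ i, η' i, ?_, fun x => ?_⟩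
    · have h3 : 𝓕 (∑ i, η' i) = ∑ i, 𝓕 (η' i) := map_sum (fourierCLM ℂ 𝓢(R3, ℂ)) _ _
      simp [h1, h3, iteratedLineDerivOpCLM_apply]
    · rw [sum_apply, Finset.sum_mul]
      refine Finset.sum_congr rfl fun i _ => ?_
      rw [h2]
      simp [Fin.prod_univ_two, inner_e, sq]
  · intro φ ψ hψ x
    rw [InnerProductSpace.laplacian_eq_iteratedFDeriv_orthonormalBasis (φ : R3 → ℝ)
      (EuclideanSpace.basisFun (Fin 3) ℝ)]
    simp only [sum_apply, iteratedLineDerivOpCLM_apply,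
      Complex.ofReal_sum]
    refine Finset.sum_congr rfl fun i _ => ?_
    rw [iteratedFDeriv_ofReal_test _ φ ψ hψ x]
    simp [e]

end Symbols

/-! ### Fourier symbols of vector fields -/

section VectorSymbols

open SchwartzMap FourierTransform LineDeriv
open scoped ContDiff

/-- The `i`-th component of a square integrable vector field. -/
noncomputable def comp (i : Fin 3) : L2 R3 →L[ℝ] L2 ℝ :=
  (EuclideanSpace.proj i : R3 →L[ℝ] ℝ).compLpL 2 volume

theorem coeFn_comp (i : Fin 3) (v : L2 R3) : ∀ᵐ x, comp i v x = v x i :=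
  (EuclideanSpace.proj i : R3 →L[ℝ] ℝ).coeFn_compLpL v

theorem norm_comp_le (i : Fin 3) (v : L2 R3) : ‖comp i v‖ ≤ ‖v‖ := by
  refine Lp.norm_le_norm_of_ae_le ?_
  filter_upwards [coeFn_comp i v] with x hx
  rw [hx]
  exact PiLp.norm_apply_le _ i

/-- The embedding of a coordinate axis. -/
noncomputable def axis (𝕜 : Type) [RCLike 𝕜] (i : Fin 3) : 𝕜 →L[𝕜] EuclideanSpace 𝕜 (Fin 3) :=
  ContinuousLinearMap.toSpanSingleton 𝕜 (EuclideanSpace.single i 1)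

theorem sum_axis {𝕜 : Type} [RCLike 𝕜] (z : Fin 3 → 𝕜) (j : Fin 3) :
    (∑ i, axis 𝕜 i (z i)) j = z j := by
  simp [axis, Finset.sum_apply, Pi.single_apply]

/-- The vector field with given square integrable components. -/
noncomputable def assemble {𝕜 : Type} [RCLike 𝕜] (f : Fin 3 → L2 𝕜) :
    L2 (EuclideanSpace 𝕜 (Fin 3)) :=
  ∑ i, (axis 𝕜 i).compLpL 2 volume (f i)

theorem coeFn_assemble {𝕜 : Type} [RCLike 𝕜] (f : Fin 3 → L2 𝕜) :
    ∀ᵐ x, ∀ i, assemble f x i = f i x := by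
  have h1 := Lp.coeFn_finsetSum Finset.univ fun i => (axis 𝕜 i).compLpL 2 volume (f i)
  have h2 : ∀ᵐ x, ∀ i, (axis 𝕜 i).compLpL 2 volume (f i) x = axis 𝕜 i (f i x) :=
    ae_all_iff.2 fun i => (axis 𝕜 i).coeFn_compLpL (f i)
  filter_upwards [h1, h2] with x h1 h2 i
  rw [assemble, h1, Finset.sum_apply]
  simp only [h2]
  exact sum_axis (fun i => f i x) i

theorem norm_assemble_le {𝕜 : Type} [RCLike 𝕜] (f : Fin 3 → L2 𝕜) :
    ‖assemble f‖ ≤ ∑ i, ‖f i‖ := by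
  refine (norm_sum_le _ _).trans (Finset.sum_le_sum fun i _ => Lp.norm_le_norm_of_ae_le ?_)
  filter_upwards [(axis 𝕜 i).coeFn_compLpL (f i)] with x hx
  rw [hx]
  simp [axis, norm_smul]

/-- The Fourier transform of a square integrable vector field. -/
noncomputable def ftv : L2 R3 →L[ℝ] L2 C3 :=
  ∑ i, ((axis ℂ i).compLpL 2 volume).restrictScalars ℝ ∘L ft ∘L comp i

theorem ftv_eq (v : L2 R3) : ftv v = assemble fun i => ft (comp i v) := by
  simp [ftv, assemble]

theorem coeFn_ftv (v : L2 R3) : ∀ᵐ k, ∀ i, ftv v k i = ft (comp i v) k := by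
  rw [ftv_eq]; exact coeFn_assemble _

theorem norm_ftv_le (v : L2 R3) : ‖ftv v‖ ≤ 3 * ‖v‖ := by
  rw [ftv_eq]
  refine (norm_assemble_le _).trans ?_
  calc ∑ i, ‖ft (comp i v)‖ ≤ ∑ _i : Fin 3, ‖v‖ :=
        Finset.sum_le_sum fun i _ => (norm_ft _).trans_le (norm_comp_le i v)
    _ = 3 * ‖v‖ := by simp

/-- Plancherel's theorem is applied to each component. Together with `norm_ftv_le` this gives
equivalence of norms up to factors 3, which is enough as constants are not tracked. -/
theorem norm_le_norm_ftv (v : L2 R3) : ‖v‖ ≤ 3 * ‖ftv v‖ := by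
  have h1 : v = assemble fun i => comp i v := by
    refine Lp.ext ?_
    filter_upwards [coeFn_assemble (𝕜 := ℝ) fun i => comp i v, ae_all_iff.2 fun i => coeFn_comp i v]
      with x h1 h2
    ext i
    rw [h1, h2]
  have h2 : ∀ i, ‖comp i v‖ ≤ ‖ftv v‖ := fun i => by
    rw [← norm_ft]
    refine Lp.norm_le_norm_of_ae_le ?_
    filter_upwards [coeFn_ftv v] with k hk
    rw [← hk i]
    exact PiLp.norm_apply_le _ i
  calc ‖v‖ = ‖assemble fun i => comp i v‖ := by rw [← h1]
    _ ≤ ∑ i, ‖comp i v‖ := norm_assemble_le _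
    _ ≤ ∑ _i : Fin 3, ‖ftv v‖ := Finset.sum_le_sum fun i _ => h2 i
    _ = 3 * ‖ftv v‖ := by simp

/-- The frequency variable in the normalisation where `∂ᵢ` has symbol `i ξᵢ`. -/
noncomputable def freq (k : R3) : R3 := (2 * Real.pi) • k

theorem freq_apply (k : R3) (i : Fin 3) : (freq k i : ℝ) = 2 * Real.pi * k i := rfl

theorem norm_freq (k : R3) : ‖freq k‖ = 2 * Real.pi * ‖k‖ := by
  rw [freq, norm_smul, Real.norm_of_nonneg (by positivity)]

theorem integral_comp_mul (v : L2 R3) (i : Fin 3) (g : R3 → ℝ) :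
    ∫ x, comp i v x * g x = ∫ x, v x i * g x := by
  refine integral_congr_ae ?_
  filter_upwards [coeFn_comp i v] with x hx
  rw [hx]

theorem hasSymbol_pair_coord (v : L2 R3) (i : Fin 3) :
    HasSymbol (pair fun x => v x i) (fun k => ftv v k i) :=
  (hasSymbol_pair (comp i v)).congr (fun _ => integral_comp_mul v i _)
    ((coeFn_ftv v).mono fun _ hk => (hk i).symm)

theorem hasSymbol_distPartial_scalar (f : L2 ℝ) (i : Fin 3) :
    HasSymbol (distPartial i f) (fun k => ((Complex.I * ft f k) • cvec (freq k)) i) :=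
  (hasSymbol_distPartial i f).congr (fun _ => rfl) (.of_forall fun _ => by
    simp [cvec, freq_apply]; ring)

theorem hasSymbol_distPartial_coord (v : L2 R3) (i j : Fin 3) :
    HasSymbol (distPartial i fun x => v x j) (fun k => Complex.I * ((freq k i : ℝ) * ftv v k j)) :=
  (hasSymbol_distPartial i (comp j v)).congr
    (fun φ => congrArg Neg.neg (integral_comp_mul v j _))
    ((coeFn_ftv v).mono fun k hk => by rw [hk j, freq_apply]; push_cast; ring)

theorem hasSymbol_distLaplacian_coord (v : L2 R3) (i : Fin 3) :
    HasSymbol (distLaplacian fun x => v x i) (fun k => -(‖freq k‖ ^ 2 : ℝ) * ftv v k i) :=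
  (hasSymbol_distLaplacian (comp i v)).congr (fun φ => integral_comp_mul v i _)
    ((coeFn_ftv v).mono fun k hk => by rw [hk i, norm_freq]; push_cast; ring)

theorem hasSymbol_distDiv (v : L2 R3) :
    HasSymbol (distDiv v) (fun k => Complex.I * dot (freq k) (ftv v k)) :=
  (HasSymbol.sum Finset.univ fun i => hasSymbol_distPartial_coord v i i).congr (fun φ => rfl)
    (.of_forall fun k => by rw [dot_apply, Finset.mul_sum])

theorem hasSymbol_distCurl (v : L2 R3) (i : Fin 3) :
    HasSymbol (distCurl v i) (fun k => Complex.I * cross (freq k) (ftv v k) i) :=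
  ((hasSymbol_distPartial_coord v (i + 1) (i + 2)).sub
    (hasSymbol_distPartial_coord v (i + 2) (i + 1))).congr (fun φ => rfl)
    (.of_forall fun k => by rw [cross_apply]; ring)

/-! ### Integrable functions -/

/-- For an integrable function the L² Fourier transform agrees almost everywhere with the integral
formula, because both satisfy the multiplication formula against test functions; the integral is
bounded by the L¹ norm. -/
theorem enorm_ft_le (f : L2 ℝ) : ∀ᵐ k, ‖ft f k‖ₑ ≤ norm1 f := by
  by_cases hf : norm1 f = ⊤
  · exact .of_forall fun k => by simp [hf]
  have hint : Integrable (fun x => (f x : ℂ)) :=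
    (memLp_one_iff_integrable.1
      ⟨(Lp.memLp f).aestronglyMeasurable, lt_top_iff_ne_top.2 hf⟩).ofReal
  set F : R3 → ℂ := 𝓕 (fun x => (f x : ℂ)) with hF
  have hFc : Continuous F := VectorFourier.fourierIntegral_continuous Real.continuous_fourierChar
    (by exact continuous_inner) hint
  have hFb : ∀ k, ‖F k‖ₑ ≤ norm1 f := by
    intro k
    have h1 : ‖F k‖ ≤ ∫ x, ‖(f x : ℂ)‖ :=
      VectorFourier.norm_fourierIntegral_le_integral_norm Real.fourierChar volume (innerₗ R3) _ k
    rw [← ofReal_norm]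
    refine (ENNReal.ofReal_le_ofReal h1).trans (le_of_eq ?_)
    rw [ofReal_integral_norm_eq_lintegral_enorm hint, norm1, eLpNorm_one_eq_lintegral_enorm]
    simp [enorm_eq_nnnorm]
  have heq : ∀ᵐ k, ft f k = F k := by
    refine ae_eq_of_integral_contDiff_smul_eq
      ((Lp.memLp (ft f)).locallyIntegrable (by norm_num)) hFc.locallyIntegrable fun g hg hgc => ?_
    have hc : HasCompactSupport (fun x => (g x : ℂ)) :=
      hgc.comp_left (g := fun r : ℝ => (r : ℂ)) (by simp)
    let η : 𝓢(R3, ℂ) := hc.toSchwartzMap (Complex.ofRealCLM.contDiff.comp hg)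
    have h1 := integral_mul_fourier f η
    have h2 := VectorFourier.integral_fourierIntegral_smul_eq_flip (L := innerₗ R3)
      Real.continuous_fourierChar continuous_inner (η.integrable (μ := volume)) hint
    have h3 : ∫ x, (𝓕 η) x * (f x : ℂ) = ∫ x, η x * F x := by
      simpa [flip_innerₗ] using! h2
    exact h1.symm.trans h3
  filter_upwards [heq] with k hk
  rw [hk]
  exact hFb k

theorem norm1_comp_le (i : Fin 3) (v : L2 R3) : norm1 (comp i v) ≤ norm1 v := by
  refine eLpNorm_mono_ae ?_
  filter_upwards [coeFn_comp i v] with x hx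
  rw [hx]
  exact PiLp.norm_apply_le _ i

theorem enorm_le_sum_coord (v : C3) : ‖v‖ₑ ≤ ∑ i, ‖v i‖ₑ := by
  have h := ENNReal.ofReal_le_ofReal (norm_le_sum_coord v)
  rw [ENNReal.ofReal_sum_of_nonneg fun i _ => norm_nonneg _] at h
  simpa [ofReal_norm] using h

theorem enorm_ftv_le (v : L2 R3) : ∀ᵐ k, ‖ftv v k‖ₑ ≤ 3 * norm1 v := by
  filter_upwards [coeFn_ftv v, ae_all_iff.2 fun i => enorm_ft_le (comp i v)] with k h1 h2
  calc ‖ftv v k‖ₑ ≤ ∑ i, ‖ftv v k i‖ₑ := enorm_le_sum_coord _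
    _ ≤ ∑ _i : Fin 3, norm1 v :=
        Finset.sum_le_sum fun i _ => by rw [h1 i]; exact (h2 i).trans (norm1_comp_le i v)
    _ = 3 * norm1 v := by simp

end VectorSymbols

/-! ### Weak derivatives and powers of the frequency -/

section WeakDerivatives

open SchwartzMap FourierTransform LineDeriv
open scoped ContDiff

theorem memLp_test_iteratedFDeriv {j : ℕ} (s : Fin j → R3) (φ : Test) :
    MemLp (fun x => iteratedFDeriv ℝ j φ x s) 2 volume := by
  have hc : HasCompactSupport fun x => iteratedFDeriv ℝ j φ x s :=
    (φ.hasCompactSupport.iteratedFDeriv (𝕜 := ℝ) j).comp_left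
      (g := fun A : ContinuousMultilinearMap ℝ (fun _ : Fin j => R3) ℝ => A s) rfl
  have hcont : Continuous fun x => iteratedFDeriv ℝ j φ x s :=
    (ContinuousMultilinearMap.apply ℝ (fun _ : Fin j => R3) ℝ s).continuous.comp
      (φ.contDiff.continuous_iteratedFDeriv (by exact_mod_cast le_top))
  exact hcont.memLp_of_hasCompactSupport hc

/-- The definition is split into scalar components, and the right-hand side is written with a
derivative of order 0, so that `hasSymbol_iteratedFDeriv` applies to both terms. -/
theorem isWeakDeriv_iff {j : ℕ} (s : Fin j → Fin 3) (v g : L2 R3) :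
    IsWeakDeriv s v g ↔ ∀ (i : Fin 3) (φ : Test),
      (∫ x, comp i v x * iteratedFDeriv ℝ j φ x (fun a => e (s a)))
        - (-1 : ℝ) ^ j * ∫ x, comp i g x * iteratedFDeriv ℝ 0 φ x (fun a => a.elim0) = 0 := by
  have key : ∀ (w : L2 R3) (h : R3 → ℝ), MemLp h 2 volume → ∀ i,
      (∫ x, h x • w x) i = ∫ x, comp i w x * h x := by
    intro w h hh i
    have hi : ∀ i, Integrable (fun x => (h x • w x) i) := fun i => by
      have h1 : Integrable (fun x => h x * comp i w x) := hh.integrable_mul (Lp.memLp (comp i w))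
      refine h1.congr ?_
      filter_upwards [coeFn_comp i w] with x hx
      simp [hx]
    rw [eval_integral_piLp hi, integral_comp_mul]
    simp [mul_comm]
  have hp : ∀ φ : Test, MemLp (fun x => φ x) 2 volume := fun φ => by
    simpa using memLp_test_iteratedFDeriv (j := 0) (fun a => a.elim0) φ
  have hcomp : ∀ (φ : Test) (i : Fin 3),
      ((∫ x, iteratedFDeriv ℝ j φ x (fun a => e (s a)) • v x) i
        = ((-1 : ℝ) ^ j • ∫ x, φ x • g x) i) ↔
      (∫ x, comp i v x * iteratedFDeriv ℝ j φ x (fun a => e (s a)))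
        - (-1 : ℝ) ^ j * ∫ x, comp i g x * iteratedFDeriv ℝ 0 φ x (fun a => a.elim0) = 0 := by
    intro φ i
    rw [PiLp.smul_apply, key v _ (memLp_test_iteratedFDeriv _ φ), key g _ (hp φ), smul_eq_mul,
      sub_eq_zero]
    simp only [iteratedFDeriv_zero_apply]
  constructor
  · intro h i φ
    rw [← hcomp, h φ]
  · intro h φ
    ext i
    exact (hcomp φ i).2 (h i φ)

/-- By uniqueness of symbols; the factor (-1)^j in the definition cancels the signs of the symbols
-2πi k. -/
theorem IsWeakDeriv.ftv_eq {j : ℕ} {s : Fin j → Fin 3} {v g : L2 R3} (h : IsWeakDeriv s v g) :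
    ∀ᵐ k, ftv g k = (∏ a, Complex.I * (freq k (s a) : ℝ)) • ftv v k := by
  rw [isWeakDeriv_iff] at h
  have h1 : ∀ᵐ k, ∀ i, ft (comp i g) k = (∏ a, Complex.I * (freq k (s a) : ℝ)) * ft (comp i v) k := by
    refine ae_all_iff.2 fun i => ?_
    have h2 := ((hasSymbol_iteratedFDeriv (comp i v) s).sub
      ((hasSymbol_iteratedFDeriv (comp i g) (j := 0) (fun a => a.elim0)).const_mul
        ((-1 : ℝ) ^ j))).ae_eq_zero (fun φ => by
          simpa only [iteratedFDeriv_zero_apply] using h i φ)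
    filter_upwards [h2] with k hk
    rw [sub_eq_zero] at hk
    have h3 : (∏ a, -(2 * Real.pi * Complex.I * (k (s a) : ℝ)))
        = (-1 : ℂ) ^ j * ∏ a, Complex.I * (freq k (s a) : ℝ) := by
      rw [← Fin.prod_const, ← Finset.prod_mul_distrib]
      refine Finset.prod_congr rfl fun a _ => ?_
      rw [freq_apply]; push_cast; ring
    rw [h3] at hk
    have h4 : ((-1 : ℂ) ^ j) * (-1) ^ j = 1 := by rw [← mul_pow]; simp
    have h5 := congrArg (fun z => (-1 : ℂ) ^ j * z) hk
    simp only [← mul_assoc, h4, one_mul] at h5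
    simpa [h4] using h5.symm
  filter_upwards [h1, coeFn_ftv v, coeFn_ftv g] with k h1 h2 h3
  ext i
  rw [h3, h1, PiLp.smul_apply, h2, smul_eq_mul]

theorem norm_le_sum_abs (ξ : R3) : ‖ξ‖ ≤ ∑ i, |ξ i| := by
  rw [EuclideanSpace.norm_eq]
  refine Real.sqrt_le_iff.2 ⟨by positivity, ?_⟩
  exact Finset.sum_sq_le_sq_sum_of_nonneg fun i _ => norm_nonneg _

/-- Bound ‖ξ‖ by Σ|ξᵢ| and expand the power: the terms are the absolute values of the symbols of all
derivatives of order j. -/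
theorem norm_pow_le_sum_prod (ξ : R3) (j : ℕ) :
    ‖ξ‖ ^ j ≤ ∑ s : Fin j → Fin 3, ‖∏ a, Complex.I * (ξ (s a) : ℂ)‖ := by
  calc ‖ξ‖ ^ j ≤ (∑ i, |ξ i|) ^ j := by gcongr; exact norm_le_sum_abs ξ
    _ = ∑ s : Fin j → Fin 3, ∏ a, |ξ (s a)| := by
        exact Fintype.sum_pow (fun i => |ξ i|) j
    _ = _ := by
        refine Finset.sum_congr rfl fun s _ => ?_
        rw [norm_prod]
        simp

/-- The constant counts the 3^j multi-indices, times 3 from `norm_ftv_le`. If the weak derivatives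
do not exist, the infimum is over an empty family and the right side is infinite. -/
theorem enorm_pow_freq_mul_le (j : ℕ) (v : L2 R3) :
    eLpNorm (fun k => ‖freq k‖ ^ j • ftv v k) 2 volume ≤ 3 * 3 ^ j * gradNorm j v := by
  rw [gradNorm, ENNReal.mul_iInf_of_ne (by positivity) (by finiteness)]
  refine le_iInf fun g => ?_
  rw [ENNReal.mul_iInf_of_ne (by positivity) (by finiteness)]
  refine le_iInf fun hg => ?_
  have h1 : ∀ᵐ k, ∀ s, ftv (g s) k = (∏ a, Complex.I * (freq k (s a) : ℝ)) • ftv v k :=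
    ae_all_iff.2 fun s => (hg s).ftv_eq
  have h2 : eLpNorm (fun k => ‖freq k‖ ^ j • ftv v k) 2 volume
      ≤ eLpNorm (fun k => ∑ s : Fin j → Fin 3, ‖ftv (g s) k‖) 2 volume := by
    refine eLpNorm_mono_ae ?_
    filter_upwards [h1] with k hk
    rw [norm_smul, norm_pow, norm_norm, Real.norm_of_nonneg (by positivity)]
    simp only [hk, norm_smul, ← Finset.sum_mul]
    gcongr
    exact norm_pow_le_sum_prod _ _
  refine h2.trans ?_
  have h3 : eLpNorm (fun k => ∑ s : Fin j → Fin 3, ‖ftv (g s) k‖) 2 volume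
      ≤ ∑ s : Fin j → Fin 3, eLpNorm (fun k => ‖ftv (g s) k‖) 2 volume := by
    have := eLpNorm_sum_le (μ := volume) (p := 2) (s := Finset.univ)
      (f := fun (s : Fin j → Fin 3) (k : R3) => ‖ftv (g s) k‖)
      (fun s _ => (Lp.aestronglyMeasurable (ftv (g s))).norm) (by norm_num)
    simpa only [Finset.sum_fn] using this
  refine h3.trans ?_
  have h4 : ∀ s, eLpNorm (fun k => ‖ftv (g s) k‖) 2 volume
      ≤ 3 * (∑ s, ‖g s‖ₑ ^ 2) ^ (1 / 2 : ℝ) := by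
    intro s
    rw [eLpNorm_norm, ← Lp.enorm_def]
    have h5 : ‖ftv (g s)‖ₑ ≤ 3 * ‖g s‖ₑ := by
      have := ENNReal.ofReal_le_ofReal (norm_ftv_le (g s))
      rw [ENNReal.ofReal_mul (by norm_num)] at this
      simpa [ofReal_norm] using this
    refine h5.trans ?_
    gcongr
    have h6 : ‖g s‖ₑ ^ 2 ≤ ∑ s, ‖g s‖ₑ ^ 2 :=
      Finset.single_le_sum (f := fun s => ‖g s‖ₑ ^ 2) (fun _ _ => zero_le) (Finset.mem_univ s)
    calc ‖g s‖ₑ = (‖g s‖ₑ ^ 2) ^ (1 / 2 : ℝ) := by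
          rw [← ENNReal.rpow_natCast, ← ENNReal.rpow_mul]; norm_num
      _ ≤ _ := by gcongr
  refine (Finset.sum_le_sum fun s _ => h4 s).trans (le_of_eq ?_)
  rw [Finset.sum_const]
  simp [nsmul_eq_mul, ← mul_assoc, mul_comm]

/-- A functional whose symbol is square integrable is the pairing with a square integrable
function. -/
theorem HasSymbol.exists_eq_integral {L : Test → ℝ} {m : R3 → ℂ} (h : HasSymbol L m)
    (hm : MemLp m 2 volume) :
    ∃ g : L2 ℝ, ‖g‖ₑ ≤ eLpNorm m 2 volume ∧ ∀ φ : Test, L φ = ∫ x, g x * φ x := by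
  obtain ⟨T, hT, hT'⟩ := h.exists_clm
  set G : L2 ℂ := 𝓕⁻ (hm.toLp m) with hG
  have hGm : ‖G‖ₑ = eLpNorm m 2 volume := by
    have h1 : ‖G‖ = ‖hm.toLp m‖ := by
      rw [← Lp.norm_fourier_eq G, hG, fourier_fourierInv_eq]
    rw [← ofReal_norm, h1, ofReal_norm, Lp.enorm_toLp]
  have hTG : ∀ ψ : 𝓢(R3, ℂ), T ψ = ∫ x, ψ x * G x := by
    intro ψ
    have h3 : 𝓕 (𝓕⁻ ψ : 𝓢(R3, ℂ)) = ψ := fourier_fourierInv_eq ψ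
    have h1 := congrArg (fun T => T ψ)
      (Lp.fourierInv_toTemperedDistribution_eq (hm.toLp m))
    simp only [TemperedDistribution.fourierInv_apply, Lp.toTemperedDistribution_apply,
      smul_eq_mul] at h1
    conv_lhs => rw [← h3]
    rw [(hT' _).2, hG, ← h1]
    refine integral_congr_ae ?_
    filter_upwards [hm.coeFn_toLp] with x hx
    rw [hx]
  -- As `L` takes real values on real test functions, the real part of `G` represents it too.
  refine ⟨Complex.reCLM.compLpL 2 volume G, ?_, fun φ => ?_⟩
  · rw [← hGm, ← ofReal_norm, ← ofReal_norm]
    refine ENNReal.ofReal_le_ofReal (Lp.norm_le_norm_of_ae_le ?_)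
    filter_upwards [Complex.reCLM.coeFn_compLpL G] with x hx
    rw [hx]
    exact Complex.abs_re_le_norm _
  · have hc : HasCompactSupport (fun x => (φ x : ℂ)) :=
      φ.hasCompactSupport.comp_left (g := fun r : ℝ => (r : ℂ)) (by simp)
    let ψ : 𝓢(R3, ℂ) := hc.toSchwartzMap (Complex.ofRealCLM.contDiff.comp φ.contDiff)
    have h1 : (L φ : ℂ) = ∫ x, ψ x * G x := by rw [← hT φ ψ fun x => rfl, hTG]
    have hint : Integrable (fun x => ψ x * G x) := (ψ.memLp 2).integrable_mul (Lp.memLp G)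
    have h2 : L φ = ∫ x, (ψ x * G x).re := by
      rw [← Complex.ofReal_re (L φ), h1]
      exact (Complex.reCLM.integral_comp_comm hint).symm
    rw [h2]
    refine integral_congr_ae ?_
    filter_upwards [Complex.reCLM.coeFn_compLpL G] with x hx
    rw [hx]
    change ((φ x : ℂ) * G x).re = (G x).re * φ x
    simp [mul_comm]

/-- Existence of the weak gradient is part of the claim, for it is applied to the solution `B`. Each
∂ₛvᵢ has a square integrable symbol and so is an L² function of norm at most N. The three components
give at most 3N, and the three directions give √27·N ≤ 9N. -/
theorem gradNorm_one_le (v : L2 R3) :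
    gradNorm 1 v ≤ 9 * eLpNorm (fun k => ‖freq k‖ • ftv v k) 2 volume := by
  set N := eLpNorm (fun k => ‖freq k‖ • ftv v k) 2 volume with hN
  by_cases htop : N = ⊤
  · rw [htop]; simp
  have hex : ∀ (s : Fin 1 → Fin 3) (i : Fin 3), ∃ g : L2 ℝ, ‖g‖ₑ ≤ N ∧
      ∀ φ : Test, ∫ x, comp i v x * iteratedFDeriv ℝ 1 φ x (fun a => e (s a))
        = ∫ x, g x * φ x := by
    intro s i
    have hle : eLpNorm (fun k => (∏ a, -(2 * Real.pi * Complex.I * (k (s a) : ℝ)))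
        * ft (comp i v) k) 2 volume ≤ N := by
      refine eLpNorm_mono_ae ?_
      filter_upwards [coeFn_ftv v] with k hk
      rw [← hk i, norm_mul, norm_smul, norm_norm]
      gcongr
      · have := norm_coord_le k (s 0)
        simp only [Fin.prod_univ_one, norm_neg, norm_mul, Complex.norm_real, Complex.norm_I,
          mul_one, norm_freq, Real.norm_of_nonneg Real.pi_pos.le, Complex.norm_ofNat]
        gcongr
        exact this
      · exact PiLp.norm_apply_le _ i
    have hmeas : AEStronglyMeasurable (fun k => (∏ a, -(2 * Real.pi * Complex.I * (k (s a) : ℝ)))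
        * ft (comp i v) k) volume := by
      refine AEStronglyMeasurable.mul ?_ (Lp.aestronglyMeasurable _)
      exact Continuous.aestronglyMeasurable (by fun_prop)
    obtain ⟨g, h1, h2⟩ := (hasSymbol_iteratedFDeriv (comp i v) s).exists_eq_integral
      ⟨hmeas, hle.trans_lt (lt_top_iff_ne_top.2 htop)⟩
    exact ⟨g, h1.trans hle, h2⟩
  choose g hg1 hg2 using hex
  have hcomp : ∀ s i, ∀ᵐ x, comp i (assemble fun i => -g s i) x = -g s i x := by
    intro s i
    filter_upwards [coeFn_comp i (assemble fun i => -g s i),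
      coeFn_assemble (𝕜 := ℝ) fun i => -g s i, Lp.coeFn_neg (g s i)] with x h1 h2 h3
    rw [h1, h2, h3]; rfl
  refine (iInf₂_le (fun s => assemble fun i => -g s i) fun s =>
    (isWeakDeriv_iff s v _).2 fun i φ => ?_).trans ?_
  · rw [hg2 s i φ, sub_eq_zero, pow_one, neg_one_mul, ← integral_neg]
    refine integral_congr_ae ?_
    filter_upwards [hcomp s i] with x hx
    rw [hx]
    simp
  · have h1 : ∀ s, ‖assemble fun i => -g s i‖ₑ ≤ 3 * N := by
      intro s
      have h2 := ENNReal.ofReal_le_ofReal (norm_assemble_le (𝕜 := ℝ) fun i => -g s i)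
      rw [ofReal_norm, ENNReal.ofReal_sum_of_nonneg fun i _ => norm_nonneg _] at h2
      refine h2.trans ?_
      calc ∑ i, ENNReal.ofReal ‖-g s i‖ ≤ ∑ _i : Fin 3, N :=
            Finset.sum_le_sum fun i _ => by rw [norm_neg, ofReal_norm]; exact hg1 s i
        _ = 3 * N := by simp
    calc (∑ s : Fin 1 → Fin 3, ‖assemble fun i => -g s i‖ₑ ^ 2) ^ (1 / 2 : ℝ)
        ≤ (∑ _s : Fin 1 → Fin 3, (3 * N) ^ 2) ^ (1 / 2 : ℝ) := by
          gcongr with s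
          exact h1 s
      _ ≤ ((9 * N) ^ 2) ^ (1 / 2 : ℝ) := by
          gcongr
          simp only [Finset.sum_const, Finset.card_univ, Fintype.card_fun, Fintype.card_fin, mul_pow,
            nsmul_eq_mul, ← mul_assoc]
          gcongr
          norm_num
      _ = 9 * N := by
          rw [← ENNReal.rpow_natCast, ← ENNReal.rpow_mul]; norm_num

end WeakDerivatives

/-! ### Operator-valued multipliers and their evolution equation -/

section Multipliers

open scoped BoundedContinuousFunction

variable {W : Type} [NormedAddCommGroup W] [NormedSpace ℝ W]
  {𝔸 : Type} [NormedRing 𝔸] [NormedAlgebra ℝ 𝔸]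

theorem memLp_bcf_apply (ρ : 𝔸 →L[ℝ] W →L[ℝ] W) (a : R3 →ᵇ 𝔸) (f : L2 W) :
    MemLp (fun k => ρ (a k) (f k)) 2 volume :=
  (Lp.memLp f).of_le_mul (c := ‖ρ‖ * ‖a‖)
    (ρ.aestronglyMeasurable_comp₂ a.continuous.aestronglyMeasurable (Lp.aestronglyMeasurable f))
    (.of_forall fun k => (ρ (a k)).le_of_opNorm_le
      (ρ.le_opNorm_of_le (a.norm_coe_le_norm k)) _)

/-- Multiplication by a bounded continuous operator-valued function, acting on `L²`. -/
noncomputable def mulOp (ρ : 𝔸 →L[ℝ] W →L[ℝ] W) : (R3 →ᵇ 𝔸) →L[ℝ] (L2 W →L[ℝ] L2 W) :=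
  LinearMap.mkContinuous₂
    (LinearMap.mk₂ ℝ (fun (a : R3 →ᵇ 𝔸) (f : L2 W) => (memLp_bcf_apply ρ a f).toLp _)
      (fun a b f => by
        refine Lp.ext ?_
        filter_upwards [(memLp_bcf_apply ρ (a + b) f).coeFn_toLp,
          (memLp_bcf_apply ρ a f).coeFn_toLp, (memLp_bcf_apply ρ b f).coeFn_toLp,
          Lp.coeFn_add ((memLp_bcf_apply ρ a f).toLp _) ((memLp_bcf_apply ρ b f).toLp _)]
          with k h1 h2 h3 h4
        rw [h1, h4, Pi.add_apply, h2, h3, BoundedContinuousFunction.add_apply, map_add]; rfl)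
      (fun c a f => by
        refine Lp.ext ?_
        filter_upwards [(memLp_bcf_apply ρ (c • a) f).coeFn_toLp,
          (memLp_bcf_apply ρ a f).coeFn_toLp,
          Lp.coeFn_smul c ((memLp_bcf_apply ρ a f).toLp _)] with k h1 h2 h3
        rw [h1, h3, Pi.smul_apply, h2, BoundedContinuousFunction.smul_apply, map_smul]; rfl)
      (fun a f g => by
        refine Lp.ext ?_
        filter_upwards [(memLp_bcf_apply ρ a (f + g)).coeFn_toLp,
          (memLp_bcf_apply ρ a f).coeFn_toLp, (memLp_bcf_apply ρ a g).coeFn_toLp, Lp.coeFn_add f g,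
          Lp.coeFn_add ((memLp_bcf_apply ρ a f).toLp _) ((memLp_bcf_apply ρ a g).toLp _)]
          with k h1 h2 h3 h4 h5
        rw [h1, h5, Pi.add_apply, h2, h3, h4, Pi.add_apply, map_add])
      (fun c a f => by
        refine Lp.ext ?_
        filter_upwards [(memLp_bcf_apply ρ a (c • f)).coeFn_toLp,
          (memLp_bcf_apply ρ a f).coeFn_toLp, Lp.coeFn_smul c f,
          Lp.coeFn_smul c ((memLp_bcf_apply ρ a f).toLp _)] with k h1 h2 h3 h4
        rw [h1, h4, Pi.smul_apply, h2, h3, Pi.smul_apply, map_smul]))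
    ‖ρ‖ (fun a f => by
      refine Lp.norm_le_mul_norm_of_ae_le_mul ?_
      filter_upwards [(memLp_bcf_apply ρ a f).coeFn_toLp] with k hk
      rw [LinearMap.mk₂_apply, hk]
      exact (ρ (a k)).le_of_opNorm_le (ρ.le_opNorm_of_le (a.norm_coe_le_norm k)) _)

theorem coeFn_mulOp (ρ : 𝔸 →L[ℝ] W →L[ℝ] W) (a : R3 →ᵇ 𝔸) (f : L2 W) :
    ∀ᵐ k, mulOp ρ a f k = ρ (a k) (f k) :=
  (memLp_bcf_apply ρ a f).coeFn_toLp

theorem mulOp_mul {ρ : 𝔸 →L[ℝ] W →L[ℝ] W} (hρ : ∀ x y, ρ (x * y) = ρ x * ρ y)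
    (a b : R3 →ᵇ 𝔸) (f : L2 W) : mulOp ρ (a * b) f = mulOp ρ a (mulOp ρ b f) := by
  refine Lp.ext ?_
  filter_upwards [coeFn_mulOp ρ (a * b) f, coeFn_mulOp ρ a (mulOp ρ b f), coeFn_mulOp ρ b f]
    with k h1 h2 h3
  rw [h1, h2, h3, BoundedContinuousFunction.mul_apply, hρ]; rfl

theorem mulOp_one {ρ : 𝔸 →L[ℝ] W →L[ℝ] W} (hρ : ρ 1 = 1) (f : L2 W) :
    mulOp ρ (1 : R3 →ᵇ 𝔸) f = f := by
  refine Lp.ext ?_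
  filter_upwards [coeFn_mulOp ρ (1 : R3 →ᵇ 𝔸) f] with k h1
  rw [h1, BoundedContinuousFunction.coe_one, Pi.one_apply, hρ]; rfl

/-- A solution of the integrated equation `y(t) = y(0) + a ∫₀ᵗ y` is given by the exponential. -/
theorem mulOp_exp_eq [CompleteSpace W] [CompleteSpace 𝔸] {ρ : 𝔸 →L[ℝ] W →L[ℝ] W}
    (hρ : ∀ x y, ρ (x * y) = ρ x * ρ y) (hρ1 : ρ 1 = 1) (a : R3 →ᵇ 𝔸) {y : ℝ → L2 W} (hy : Continuous y)
    (h : ∀ t, 0 ≤ t → y t = y 0 + mulOp ρ a (∫ s in (0 : ℝ)..t, y s)) {t : ℝ} (ht : 0 ≤ t) :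
    y t = mulOp ρ (NormedSpace.exp (t • a)) (y 0) := by
  set J : ℝ → L2 W := fun t => ∫ s in (0 : ℝ)..t, y s with hJ
  have hJd : ∀ t, HasDerivAt J (y t) t := fun t =>
    intervalIntegral.integral_hasDerivAt_right (hy.intervalIntegrable _ _)
      hy.stronglyMeasurable.stronglyMeasurableAtFilter hy.continuousAt
  have hP : ∀ s, HasDerivAt (fun s : ℝ => mulOp ρ (NormedSpace.exp ((t - s) • a)))
      (mulOp ρ (-(NormedSpace.exp ((t - s) • a) * a))) s := fun s =>
    (mulOp ρ).hasFDerivAt.comp_hasDerivAt s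
      ((hasDerivAt_exp_smul_const a (t - s)).comp_const_sub t s)
  -- Duhamel's device: e^{(t-s)a} applied to y(0) + a∫₀ˢ y has zero derivative in s, since y(0) +
  -- a∫₀ˢ y = y(s). It equals e^{ta}y(0) at s = 0 and y(t) at s = t.
  set F : ℝ → L2 W := fun s => mulOp ρ (NormedSpace.exp ((t - s) • a)) (y 0 + mulOp ρ a (J s))
    with hF
  have hFd : ∀ s, HasDerivAt F
      (mulOp ρ (-(NormedSpace.exp ((t - s) • a) * a)) (y 0 + mulOp ρ a (J s))
      + mulOp ρ (NormedSpace.exp ((t - s) • a)) (mulOp ρ a (y s))) s := fun s =>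
    (hP s).clm_apply (((mulOp ρ a).hasFDerivAt.comp_hasDerivAt s (hJd s)).const_add (y 0))
  have hconst : F t = F 0 := by
    refine constant_of_has_deriv_right_zero (a := 0) (b := t)
      (fun s _ => (hFd s).continuousAt.continuousWithinAt) (fun s hs => ?_) t ⟨ht, le_rfl⟩
    convert! (hFd s).hasDerivWithinAt using 1
    rw [← h s hs.1, map_neg, neg_apply, mulOp_mul hρ, neg_add_cancel]
  have h0 : F 0 = mulOp ρ (NormedSpace.exp (t • a)) (y 0) := by simp [hF, hJ]
  have h1 : F t = y t := by
    rw [hF]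
    simp only [sub_self, zero_smul, NormedSpace.exp_zero, mulOp_one hρ1]
    exact (h t ht).symm
  rw [← h0, ← hconst, h1]

/-- Evaluation at a point is a continuous ring homomorphism and therefore commutes with the
exponential series. -/
theorem exp_bcf_apply [CompleteSpace 𝔸] (a : R3 →ᵇ 𝔸) (k : R3) :
    NormedSpace.exp a k = NormedSpace.exp (a k) := by
  let ev : (R3 →ᵇ 𝔸) →+* 𝔸 :=
    { toFun := fun a => a k, map_one' := rfl, map_mul' := fun _ _ => rfl, map_zero' := rfl,
      map_add' := fun _ _ => rfl }
  exact NormedSpace.map_exp_of_mem_ball (𝕂 := ℝ) ev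
    (BoundedContinuousFunction.evalCLM ℝ k).continuous a
    ((NormedSpace.expSeries_radius_eq_top ℝ (R3 →ᵇ 𝔸)).symm ▸ edist_lt_top _ _)

/-- Solutions of `y(t) = y(0) + A ∫₀ᵗ y` for a continuous, possibly unbounded symbol `A`. -/
theorem ae_eq_exp_of_integrated [CompleteSpace W] [CompleteSpace 𝔸] {ρ : 𝔸 →L[ℝ] W →L[ℝ] W}
    (hρ : ∀ x y, ρ (x * y) = ρ x * ρ y) (hρ1 : ρ 1 = 1) {A : R3 → 𝔸} (hA : Continuous A)
    {y : ℝ → L2 W} (hy : Continuous y)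
    (h : ∀ t, 0 ≤ t → ∀ᵐ k, y t k - y 0 k = ρ (A k) ((∫ s in (0 : ℝ)..t, y s : L2 W) k))
    {t : ℝ} (ht : 0 ≤ t) : ∀ᵐ k, y t k = ρ (NormedSpace.exp (t • A k)) (y 0 k) := by
  have key : ∀ R : ℕ, ∀ᵐ k, ‖k‖ ≤ R → y t k = ρ (NormedSpace.exp (t • A k)) (y 0 k) := by
    intro R
    -- This cutoff equals 1 on the ball of radius ρ and vanishes outside the ball of radius ρ + 1.
    -- It makes the symbol bounded, so that the Banach algebra exponential is available.
    let χ : ℝ → R3 → ℝ := fun ρ k => max 0 (min 1 (ρ + 1 - ‖k‖))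
    have hχc : ∀ ρ, Continuous (χ ρ) := fun ρ => by fun_prop
    have hχ1 : ∀ ρ k, ‖k‖ ≤ ρ → χ ρ k = 1 := fun ρ k hk => by
      have : (1 : ℝ) ≤ ρ + 1 - ‖k‖ := by linarith
      simp [χ, this]
    have hχ0 : ∀ ρ k, ρ + 1 ≤ ‖k‖ → χ ρ k = 0 := fun ρ k hk => by
      have : ρ + 1 - ‖k‖ ≤ (0 : ℝ) := by linarith
      simp only [χ]
      exact max_eq_left ((min_le_right _ _).trans this)
    have hbdd : ∀ (ρ : ℝ) (B : R3 → 𝔸), Continuous B →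
        ∃ b : R3 →ᵇ 𝔸, ∀ k, b k = χ ρ k • B k := by
      intro ρ B hB
      have hc : Continuous fun k => χ ρ k • B k := (hχc ρ).smul hB
      have hs : HasCompactSupport fun k => χ ρ k • B k := by
        refine HasCompactSupport.of_support_subset_isCompact
          (isCompact_closedBall (0 : R3) (ρ + 1)) fun k hk => ?_
        by_contra hk'
        rw [mem_closedBall_zero_iff, not_le] at hk'
        exact hk (by simp [hχ0 ρ k hk'.le])
      obtain ⟨C, hC⟩ := hs.exists_bound_of_continuous hc
      exact ⟨BoundedContinuousFunction.ofNormedAddCommGroup _ hc C hC, fun k => rfl⟩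
    obtain ⟨c, hc⟩ := hbdd R (fun _ => 1) continuous_const
    -- The symbol is cut off one unit further out than the solution, so the truncated symbol
    -- coincides with `A` wherever the truncated solution may be nonzero.
    obtain ⟨a, ha⟩ := hbdd (R + 1) A hA
    have heq := mulOp_exp_eq hρ hρ1 a (y := fun t => mulOp ρ c (y t)) ((mulOp ρ c).continuous.comp hy)
      (fun t ht => by
        rw [(mulOp ρ c).intervalIntegral_comp_comm (hy.intervalIntegrable _ _)]
        refine Lp.ext ?_
        filter_upwards [h t ht, coeFn_mulOp ρ c (y t), coeFn_mulOp ρ c (y 0),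
          coeFn_mulOp ρ c (∫ s in (0 : ℝ)..t, y s), coeFn_mulOp ρ a (mulOp ρ c (∫ s in (0 : ℝ)..t, y s)),
          Lp.coeFn_add (mulOp ρ c (y 0)) (mulOp ρ a (mulOp ρ c (∫ s in (0 : ℝ)..t, y s)))]
          with k h1 h2 h3 h4 h5 h6
        rw [h2, h6, Pi.add_apply, h3, h5, h4, ← sub_eq_iff_eq_add', ← map_sub, h1, hc, ha]
        rcases le_or_gt (R + 1 : ℝ) ‖k‖ with hk | hk
        · simp [hχ0 R k hk]
        · simp [hχ1 (R + 1) k hk.le, hρ1]) ht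
    filter_upwards [coeFn_mulOp ρ c (y t), coeFn_mulOp ρ c (y 0),
      coeFn_mulOp ρ (NormedSpace.exp (t • a)) (mulOp ρ c (y 0))] with k h1 h2 h3 hk
    have h4 : mulOp ρ c (y t) k = y t k := by rw [h1, hc, hχ1 R k hk, one_smul, hρ1]; rfl
    have h5 : mulOp ρ c (y 0) k = y 0 k := by rw [h2, hc, hχ1 R k hk, one_smul, hρ1]; rfl
    rw [← h4, ← h5, heq, h3, exp_bcf_apply]
    congr 3
    change t • a k = _
    rw [ha, hχ1 (R + 1) k (by linarith), one_smul]
  filter_upwards [ae_all_iff.2 key] with k hk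
  obtain ⟨R, hR⟩ := exists_nat_ge ‖k‖
  exact hk R hR

end Multipliers

/-! ### From the distributional system to an ODE at almost every frequency -/

section Evolution

/-- The values of the Fourier transform of a state of the system. -/
abbrev FiberState : Type := ℂ × C3 × C3 × C3

/-- The states of the system. -/
abbrev State : Type := L2 ℝ × L2 R3 × L2 R3 × L2 R3

/-- The Fourier transform of a state. -/
noncomputable def ftState : State →L[ℝ] L2 FiberState :=
  (ContinuousLinearMap.inl ℝ ℂ (C3 × C3 × C3)).compLpL 2 volume ∘L ft ∘L
      ContinuousLinearMap.fst ℝ _ _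
    + (ContinuousLinearMap.inr ℝ ℂ (C3 × C3 × C3) ∘L
        ContinuousLinearMap.inl ℝ C3 (C3 × C3)).compLpL 2 volume ∘L ftv ∘L
      ContinuousLinearMap.fst ℝ _ _ ∘L ContinuousLinearMap.snd ℝ _ _
    + (ContinuousLinearMap.inr ℝ ℂ (C3 × C3 × C3) ∘L ContinuousLinearMap.inr ℝ C3 (C3 × C3) ∘L
        ContinuousLinearMap.inl ℝ C3 C3).compLpL 2 volume ∘L ftv ∘L
      ContinuousLinearMap.fst ℝ _ _ ∘L ContinuousLinearMap.snd ℝ _ _ ∘L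
      ContinuousLinearMap.snd ℝ _ _
    + (ContinuousLinearMap.inr ℝ ℂ (C3 × C3 × C3) ∘L ContinuousLinearMap.inr ℝ C3 (C3 × C3) ∘L
        ContinuousLinearMap.inr ℝ C3 C3).compLpL 2 volume ∘L ftv ∘L
      ContinuousLinearMap.snd ℝ _ _ ∘L ContinuousLinearMap.snd ℝ _ _ ∘L
      ContinuousLinearMap.snd ℝ _ _

theorem coeFn_ftState (Z : State) :
    ∀ᵐ k, ftState Z k = (ft Z.1 k, ftv Z.2.1 k, ftv Z.2.2.1 k, ftv Z.2.2.2 k) := by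
  have h1 := (ContinuousLinearMap.inl ℝ ℂ (C3 × C3 × C3)).coeFn_compLpL (p := 2) (ft Z.1)
  have h2 := (ContinuousLinearMap.inr ℝ ℂ (C3 × C3 × C3) ∘L
    ContinuousLinearMap.inl ℝ C3 (C3 × C3)).coeFn_compLpL (p := 2) (ftv Z.2.1)
  have h3 := (ContinuousLinearMap.inr ℝ ℂ (C3 × C3 × C3) ∘L
    ContinuousLinearMap.inr ℝ C3 (C3 × C3) ∘L
    ContinuousLinearMap.inl ℝ C3 C3).coeFn_compLpL (p := 2) (ftv Z.2.2.1)
  have h4 := (ContinuousLinearMap.inr ℝ ℂ (C3 × C3 × C3) ∘L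
    ContinuousLinearMap.inr ℝ C3 (C3 × C3) ∘L
    ContinuousLinearMap.inr ℝ C3 C3).coeFn_compLpL (p := 2) (ftv Z.2.2.2)
  have e : ∀ a b c d : L2 FiberState, ∀ᵐ k, (a + b + c + d) k = a k + b k + c k + d k := by
    intro a b c d
    filter_upwards [Lp.coeFn_add (a + b + c) d, Lp.coeFn_add (a + b) c, Lp.coeFn_add a b]
      with k h1 h2 h3
    rw [h1, Pi.add_apply, h2, Pi.add_apply, h3, Pi.add_apply]
  filter_upwards [e _ _ _ _, h1, h2, h3, h4] with k h h1 h2 h3 h4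
  refine Eq.trans h ?_
  erw [h1, h2, h3, h4]
  simp

/-- The symbol of the system: the right-hand side of the evolution equations at frequency `ξ`. -/
noncomputable def fiberOp (γ β μ : ℝ) (ξ : R3) : FiberState →L[ℝ] FiberState :=
  (LinearMap.restrictScalars ℝ
    { toFun := fun w => (-(γ * (Complex.I * dot ξ w.2.1)),
        -(γ * (Complex.I * w.1)) • cvec ξ - (β : ℂ) • w.2.2.1 - ((μ * ‖ξ‖ ^ 2 : ℝ) : ℂ) • w.2.1,
        Complex.I • cross ξ w.2.2.2 + (β : ℂ) • w.2.1,
        -(Complex.I • cross ξ w.2.2.1))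
      map_add' := fun v w => by
        simp only [Prod.fst_add, Prod.snd_add, map_add, Prod.mk_add_mk, Prod.mk.injEq]
        refine ⟨by ring, ?_, ?_, ?_⟩ <;> module
      map_smul' := fun c w => by
        simp only [Prod.smul_fst, Prod.smul_snd, map_smul, Prod.smul_mk, Prod.mk.injEq,
          RingHom.id_apply, smul_eq_mul]
        refine ⟨by ring, ?_, ?_, ?_⟩ <;> module : FiberState →ₗ[ℂ] FiberState }).toContinuousLinearMap

theorem fiberOp_apply (γ β μ : ℝ) (ξ : R3) (w : FiberState) :
    fiberOp γ β μ ξ w = (-(γ * (Complex.I * dot ξ w.2.1)),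
        -(γ * (Complex.I * w.1)) • cvec ξ - (β : ℂ) • w.2.2.1 - ((μ * ‖ξ‖ ^ 2 : ℝ) : ℂ) • w.2.1,
        Complex.I • cross ξ w.2.2.2 + (β : ℂ) • w.2.1,
        -(Complex.I • cross ξ w.2.2.1)) := rfl

theorem continuous_fiberOp (γ β μ : ℝ) : Continuous (fiberOp γ β μ) := by
  refine continuous_clm_apply.2 fun w => ?_
  have h1 : ∀ v, Continuous fun ξ : R3 => dot ξ v := fun v => by
    simp only [dot_apply]; fun_prop
  have h2 : ∀ v, Continuous fun ξ : R3 => cross ξ v := fun v => by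
    refine (PiLp.continuous_toLp 2 _).comp (continuous_pi fun i => ?_)
    fun_prop
  have h3 : Continuous fun ξ : R3 => cvec ξ := by
    refine (PiLp.continuous_toLp 2 _).comp (continuous_pi fun i => ?_)
    fun_prop
  simp only [fiberOp_apply]
  have := h1 w.2.1
  have := h2 w.2.2.2
  have := h2 w.2.2.1
  fun_prop

theorem continuous_freq : Continuous freq := continuous_const_smul _

/-- The fundamental theorem of calculus for functionals of a continuous curve. -/
theorem sub_eq_apply_integral {X : Type} [NormedAddCommGroup X] [NormedSpace ℝ X] [CompleteSpace X]
    {Z : ℝ → X} (hZ : Continuous Z) (Λ Λ' : X →L[ℝ] ℝ)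
    (h : ∀ t, 0 < t → HasDerivAt (fun s => Λ (Z s)) (Λ' (Z t)) t) {t : ℝ} (ht : 0 ≤ t) :
    Λ (Z t) - Λ (Z 0) = Λ' (∫ s in (0 : ℝ)..t, Z s) := by
  rw [← Λ'.intervalIntegral_comp_comm (hZ.intervalIntegrable _ _)]
  exact (intervalIntegral.integral_eq_sub_of_hasDerivAt_of_le ht
    (Λ.continuous.comp hZ).continuousOn (fun s hs => h s hs.1)
    ((Λ'.continuous.comp hZ).intervalIntegrable _ _)).symm

/-- Integration against a square integrable function. -/
theorem exists_clm_integral_mul {h : R3 → ℝ} (hh : MemLp h 2 volume) :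
    ∃ Λ : L2 ℝ →L[ℝ] ℝ, ∀ f, Λ f = ∫ x, f x * h x := by
  refine ⟨innerSL ℝ (hh.toLp h), fun f => ?_⟩
  rw [innerSL_apply_apply, L2.inner_def]
  refine integral_congr_ae ?_
  filter_upwards [hh.coeFn_toLp] with x hx
  rw [hx]; rfl

theorem exists_clm_pair (φ : Test) : ∃ Λ : L2 ℝ →L[ℝ] ℝ, ∀ f, Λ f = pair f φ :=
  exists_clm_integral_mul (φ.continuous.memLp_of_hasCompactSupport φ.hasCompactSupport)

theorem exists_clm_distPartial (i : Fin 3) (φ : Test) :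
    ∃ Λ : L2 ℝ →L[ℝ] ℝ, ∀ f, Λ f = distPartial i f φ := by
  have h := memLp_test_iteratedFDeriv (j := 1) (fun _ => e i) φ
  simp only [iteratedFDeriv_one_apply] at h
  obtain ⟨Λ, hΛ⟩ := exists_clm_integral_mul h
  exact ⟨-Λ, fun f => congrArg Neg.neg (hΛ f)⟩

theorem exists_clm_distLaplacian (φ : Test) :
    ∃ Λ : L2 ℝ →L[ℝ] ℝ, ∀ f, Λ f = distLaplacian f φ := by
  refine exists_clm_integral_mul ?_
  rw [InnerProductSpace.laplacian_eq_iteratedFDeriv_orthonormalBasis (φ : R3 → ℝ)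
    (EuclideanSpace.basisFun (Fin 3) ℝ)]
  exact memLp_finsetSum _ fun i _ => memLp_test_iteratedFDeriv _ φ

theorem exists_clm_pair_coord (i : Fin 3) (φ : Test) :
    ∃ Λ : L2 R3 →L[ℝ] ℝ, ∀ v, Λ v = pair (fun x => v x i) φ := by
  obtain ⟨Λ, hΛ⟩ := exists_clm_pair φ
  exact ⟨Λ ∘L comp i, fun v => (hΛ _).trans (integral_comp_mul v i _)⟩

theorem exists_clm_distPartial_coord (i j : Fin 3) (φ : Test) :
    ∃ Λ : L2 R3 →L[ℝ] ℝ, ∀ v, Λ v = distPartial i (fun x => v x j) φ := by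
  obtain ⟨Λ, hΛ⟩ := exists_clm_distPartial i φ
  exact ⟨Λ ∘L comp j, fun v => (hΛ _).trans (congrArg Neg.neg (integral_comp_mul v j _))⟩

theorem exists_clm_distLaplacian_coord (i : Fin 3) (φ : Test) :
    ∃ Λ : L2 R3 →L[ℝ] ℝ, ∀ v, Λ v = distLaplacian (fun x => v x i) φ := by
  obtain ⟨Λ, hΛ⟩ := exists_clm_distLaplacian φ
  exact ⟨Λ ∘L comp i, fun v => (hΛ _).trans (integral_comp_mul v i _)⟩

theorem exists_clm_distDiv (φ : Test) : ∃ Λ : L2 R3 →L[ℝ] ℝ, ∀ v, Λ v = distDiv v φ := by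
  choose Λ hΛ using fun i => exists_clm_distPartial_coord i i φ
  exact ⟨∑ i, Λ i, fun v => by simp [hΛ, distDiv]⟩

theorem exists_clm_distCurl (i : Fin 3) (φ : Test) :
    ∃ Λ : L2 R3 →L[ℝ] ℝ, ∀ v, Λ v = distCurl v i φ := by
  obtain ⟨Λ, hΛ⟩ := exists_clm_distPartial_coord (i + 1) (i + 2) φ
  obtain ⟨Λ', hΛ'⟩ := exists_clm_distPartial_coord (i + 2) (i + 1) φ
  exact ⟨Λ - Λ', fun v => by simp [hΛ, hΛ', distCurl]⟩

theorem exp_zero_smul {𝔸 : Type} [NormedRing 𝔸] [NormedAlgebra ℝ 𝔸] (a : 𝔸) :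
    NormedSpace.exp ((0 : ℝ) • a) = 1 := by
  rw [zero_smul, NormedSpace.exp_zero]

section Solution

variable {γ β μ : ℝ} {n : ℝ → L2 ℝ} {u E B : ℝ → L2 R3} {n₀ : L2 ℝ} {u₀ E₀ B₀ : L2 R3}

/-- Each tested equation is a derivative of continuous linear functionals along a continuous curve,
so integrating it in time gives an identity for the single state `∫ Z`. Uniqueness of symbols makes
it pointwise in the frequency. The integrated form only needs a null set for each fixed time. -/
theorem IsSolution.integrated (h : IsSolution γ β μ n u E B n₀ u₀ E₀ B₀) {Z : ℝ → State}
    (hZ : Continuous Z) (hZe : ∀ t, 0 ≤ t → Z t = (n t, u t, E t, B t)) {t : ℝ} (ht : 0 ≤ t) :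
    ∀ᵐ k, ftState (Z t) k - ftState (Z 0) k
      = fiberOp γ β μ (freq k) (ftState (∫ s in (0 : ℝ)..t, Z s) k) := by
  obtain ⟨I, hI⟩ : ∃ I, I = ∫ s in (0 : ℝ)..t, Z s := ⟨_, rfl⟩
  have hZt := hZe t ht
  have hZ0 := hZe 0 le_rfl
  have hev : ∀ t, 0 < t → ∀ᶠ s in 𝓝 t, Z s = (n s, u s, E s, B s) := fun t ht => by
    filter_upwards [lt_mem_nhds ht] with s hs using hZe s hs.le
  have main : ∀ Λ Λ' : State →L[ℝ] ℝ, (∀ t, 0 < t →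
      HasDerivAt (fun s => Λ (n s, u s, E s, B s)) (Λ' (n t, u t, E t, B t)) t) →
      Λ (n t, u t, E t, B t) - Λ (n 0, u 0, E 0, B 0) = Λ' I := by
    intro Λ Λ' hd
    rw [hI, ← sub_eq_apply_integral hZ Λ Λ' (fun s hs => ?_) ht, hZt, hZ0]
    rw [hZe s hs.le]
    exact (hd s hs).congr_of_eventuallyEq ((hev s hs).mono fun r hr => by simp only [hr])
  let p1 : State →L[ℝ] L2 ℝ := ContinuousLinearMap.fst ℝ _ _
  let p2 : State →L[ℝ] L2 R3 := ContinuousLinearMap.fst ℝ _ _ ∘L ContinuousLinearMap.snd ℝ _ _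
  let p3 : State →L[ℝ] L2 R3 := ContinuousLinearMap.fst ℝ _ _ ∘L ContinuousLinearMap.snd ℝ _ _ ∘L
    ContinuousLinearMap.snd ℝ _ _
  let p4 : State →L[ℝ] L2 R3 := ContinuousLinearMap.snd ℝ _ _ ∘L ContinuousLinearMap.snd ℝ _ _ ∘L
    ContinuousLinearMap.snd ℝ _ _
  have e1 : ∀ φ : Test, pair (n t) φ - pair (n 0) φ = -(γ * distDiv I.2.1 φ) := by
    intro φ
    obtain ⟨P, hP⟩ := exists_clm_pair φ
    obtain ⟨D, hD⟩ := exists_clm_distDiv φ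
    have := main (P ∘L p1) (-(γ • D ∘L p2)) (fun t ht => by
      simpa [p1, p2, hP, hD] using h.eq_n φ t ht)
    simpa [p1, p2, hP, hD] using this
  have e2 : ∀ (φ : Test) (i : Fin 3), pair (fun x => u t x i) φ - pair (fun x => u 0 x i) φ
      = -(γ * distPartial i I.1 φ) - β * pair (fun x => I.2.2.1 x i) φ
        + μ * distLaplacian (fun x => I.2.1 x i) φ := by
    intro φ i
    obtain ⟨P, hP⟩ := exists_clm_pair_coord i φ
    obtain ⟨D, hD⟩ := exists_clm_distPartial i φ
    obtain ⟨L, hL⟩ := exists_clm_distLaplacian_coord i φ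
    have := main (P ∘L p2) (-(γ • D ∘L p1) - β • P ∘L p3 + μ • L ∘L p2) (fun t ht => by
      simpa [p1, p2, p3, hP, hD, hL] using h.eq_u φ i t ht)
    simpa [p1, p2, p3, hP, hD, hL] using this
  have e3 : ∀ (φ : Test) (i : Fin 3), pair (fun x => E t x i) φ - pair (fun x => E 0 x i) φ
      = distCurl I.2.2.2 i φ + β * pair (fun x => I.2.1 x i) φ := by
    intro φ i
    obtain ⟨P, hP⟩ := exists_clm_pair_coord i φ
    obtain ⟨D, hD⟩ := exists_clm_distCurl i φ
    have := main (P ∘L p3) (D ∘L p4 + β • P ∘L p2) (fun t ht => by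
      simpa [p2, p3, p4, hP, hD] using h.eq_E φ i t ht)
    simpa [p2, p3, p4, hP, hD] using this
  have e4 : ∀ (φ : Test) (i : Fin 3), pair (fun x => B t x i) φ - pair (fun x => B 0 x i) φ
      = -distCurl I.2.2.1 i φ := by
    intro φ i
    obtain ⟨P, hP⟩ := exists_clm_pair_coord i φ
    obtain ⟨D, hD⟩ := exists_clm_distCurl i φ
    have := main (P ∘L p4) (-(D ∘L p3)) (fun t ht => by
      simpa [p3, p4, hP, hD] using h.eq_B φ i t ht)
    simpa [p3, p4, hP, hD] using this
  have a1 := (((hasSymbol_pair (n t)).sub (hasSymbol_pair (n 0))).sub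
    ((hasSymbol_distDiv I.2.1).const_mul γ).neg).ae_eq_zero fun φ => sub_eq_zero.2 (e1 φ)
  have a2 := fun i => (((hasSymbol_pair_coord (u t) i).sub (hasSymbol_pair_coord (u 0) i)).sub
    ((((hasSymbol_distPartial_scalar I.1 i).const_mul γ).neg.sub
      ((hasSymbol_pair_coord I.2.2.1 i).const_mul β)).add
      ((hasSymbol_distLaplacian_coord I.2.1 i).const_mul μ))).ae_eq_zero
      fun φ => sub_eq_zero.2 (e2 φ i)
  have a3 := fun i => (((hasSymbol_pair_coord (E t) i).sub (hasSymbol_pair_coord (E 0) i)).sub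
    ((hasSymbol_distCurl I.2.2.2 i).add ((hasSymbol_pair_coord I.2.1 i).const_mul β))).ae_eq_zero
      fun φ => sub_eq_zero.2 (e3 φ i)
  have a4 := fun i => (((hasSymbol_pair_coord (B t) i).sub (hasSymbol_pair_coord (B 0) i)).sub
    (hasSymbol_distCurl I.2.2.1 i).neg).ae_eq_zero fun φ => sub_eq_zero.2 (e4 φ i)
  rw [← hI, hZt, hZ0]
  filter_upwards [a1, ae_all_iff.2 a2, ae_all_iff.2 a3, ae_all_iff.2 a4,
    coeFn_ftState (n t, u t, E t, B t), coeFn_ftState (n 0, u 0, E 0, B 0), coeFn_ftState I]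
    with k a1 a2 a3 a4 c1 c2 c3
  rw [c1, c2, c3, fiberOp_apply]
  simp only [Prod.mk_sub_mk, Prod.mk.injEq]
  refine ⟨sub_eq_zero.1 a1, ?_, ?_, ?_⟩
  · ext i
    simpa [sub_eq_add_neg, mul_assoc, mul_left_comm] using sub_eq_zero.1 (a2 i)
  · ext i
    simpa using sub_eq_zero.1 (a3 i)
  · ext i
    simpa using sub_eq_zero.1 (a4 i)

/-- For almost every frequency, the Fourier transform of the solution is a solution of the ordinary
differential equation given by the symbol of the system. -/
theorem IsSolution.exists_symbolSol (hγ : 0 < γ) (h : IsSolution γ β μ n u E B n₀ u₀ E₀ B₀) {t : ℝ}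
    (ht : 0 ≤ t) : ∀ᵐ k, ∃ (N : ℝ → ℂ) (U F G : ℝ → C3), SymbolSol γ β μ (freq k) N U F G ∧
      N 0 = ft n₀ k ∧ U 0 = ftv u₀ k ∧ F 0 = ftv E₀ k ∧ G 0 = ftv B₀ k ∧
      N t = ft (n t) k ∧ U t = ftv (u t) k ∧ F t = ftv (E t) k ∧ G t = ftv (B t) k := by
  -- The solution is frozen at negative times, to have a curve that is continuous on the whole line.
  let Z : ℝ → State := fun s => (n (max 0 s), u (max 0 s), E (max 0 s), B (max 0 s))
  have hm : Continuous fun s : ℝ => max 0 s := by fun_prop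
  have hm0 : ∀ s : ℝ, max 0 s ∈ Ici (0 : ℝ) := fun s => mem_Ici.2 (le_max_left _ _)
  have hZ : Continuous Z := by
    refine Continuous.prodMk (h.continuousOn_n.comp_continuous hm hm0)
      (Continuous.prodMk (h.continuousOn_u.comp_continuous hm hm0)
      (Continuous.prodMk (h.continuousOn_E.comp_continuous hm hm0)
        (h.continuousOn_B.comp_continuous hm hm0)))
  have hZe : ∀ t, 0 ≤ t → Z t = (n t, u t, E t, B t) := fun t ht => by simp [Z, ht]
  have hexp := ae_eq_exp_of_integrated
    (ρ := ContinuousLinearMap.id ℝ (FiberState →L[ℝ] FiberState)) (fun _ _ => rfl) rfl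
    (A := fun k => fiberOp γ β μ (freq k)) ((continuous_fiberOp γ β μ).comp continuous_freq)
    (y := fun t => ftState (Z t)) (ftState.continuous.comp hZ) (fun t ht => by
      rw [ftState.intervalIntegral_comp_comm (hZ.intervalIntegrable _ _)]
      exact h.integrated hZ hZe ht) ht
  simp only [hZe t ht, hZe 0 le_rfl, h.init_n, h.init_u, h.init_E, h.init_B] at hexp
  have d1 := ((hasSymbol_distDiv E₀).sub ((hasSymbol_pair n₀).const_mul (-(β / γ)))).ae_eq_zero
    fun φ => sub_eq_zero.2 (by simpa [h.init_n, h.init_E] using h.div_E φ 0 le_rfl)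
  have d2 := (hasSymbol_distDiv B₀).ae_eq_zero
    fun φ => by simpa [h.init_B] using h.div_B φ 0 le_rfl
  filter_upwards [hexp, d1, d2, coeFn_ftState (n t, u t, E t, B t),
    coeFn_ftState (n₀, u₀, E₀, B₀)] with k hk d1 d2 c1 c2
  rw [c1, c2] at hk
  obtain ⟨w, hw⟩ : ∃ w : FiberState, w = (ft n₀ k, ftv u₀ k, ftv E₀ k, ftv B₀ k) := ⟨_, rfl⟩
  rw [← hw] at hk
  -- The matrix exponential solves the ODE for all times at this frequency; `hk` identifies it with
  -- the transformed solution at the given time t, which is all that is needed.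
  let Y : ℝ → FiberState := fun s => NormedSpace.exp (s • fiberOp γ β μ (freq k)) w
  have hY : ∀ s, HasDerivAt Y (fiberOp γ β μ (freq k) (Y s)) s := fun s =>
    ((ContinuousLinearMap.apply ℝ FiberState w).hasFDerivAt.comp_hasDerivAt s
      (hasDerivAt_exp_smul_const' (fiberOp γ β μ (freq k)) s))
  have hY0 : Y 0 = w := 
    congrArg (fun T : FiberState →L[ℝ] FiberState => T w) (exp_zero_smul _)
  have hYt : Y t = (ft (n t) k, ftv (u t) k, ftv (E t) k, ftv (B t) k) := hk.symm
  have hN := fun s => (ContinuousLinearMap.fst ℝ ℂ (C3 × C3 × C3)).hasFDerivAt.comp_hasDerivAt s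
    (hY s)
  have hU := fun s => (ContinuousLinearMap.fst ℝ C3 (C3 × C3) ∘L
    ContinuousLinearMap.snd ℝ ℂ (C3 × C3 × C3)).hasFDerivAt.comp_hasDerivAt s (hY s)
  have hF := fun s => (ContinuousLinearMap.fst ℝ C3 C3 ∘L ContinuousLinearMap.snd ℝ C3 (C3 × C3) ∘L
    ContinuousLinearMap.snd ℝ ℂ (C3 × C3 × C3)).hasFDerivAt.comp_hasDerivAt s (hY s)
  have hG := fun s => (ContinuousLinearMap.snd ℝ C3 C3 ∘L ContinuousLinearMap.snd ℝ C3 (C3 × C3) ∘L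
    ContinuousLinearMap.snd ℝ ℂ (C3 × C3 × C3)).hasFDerivAt.comp_hasDerivAt s (hY s)
  refine ⟨fun s => (Y s).1, fun s => (Y s).2.1, fun s => (Y s).2.2.1, fun s => (Y s).2.2.2,
    ⟨hN, hU, hF, hG, ?_, ?_⟩, ?_⟩
  · simp only [hY0, hw]
    have hγ' : (γ : ℂ) ≠ 0 := by exact_mod_cast hγ.ne'
    have h1 := sub_eq_zero.1 d1
    rw [h1]
    push_cast
    field_simp
  · simp only [hY0, hw]
    exact (mul_eq_zero.1 d2).resolve_left Complex.I_ne_zero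
  · simp only [hY0, hYt, hw, and_self]

end Solution

end Evolution

/-! ### Decay rates of the frequency kernels -/

section Decay

/-- Polynomials are controlled by exponentials, uniformly on the half-line. -/
theorem exists_pow_mul_exp_le {c : ℝ} (hc : 0 < c) (a p : ℕ) (hp : 1 ≤ p) :
    ∃ K : ℝ, ∀ r : ℝ, 0 ≤ r → (1 + r) ^ 2 * (r ^ a * Real.exp (-(c * r ^ p))) ≤ K := by
  -- From r^p ≥ r - 1 the exponent is at most 2c - c(1+r), and one term of the exponential series
  -- bounds (1+r)^{a+2}e^{-c(1+r)}.
  refine ⟨Real.exp (2 * c) * ((a + 2).factorial / c ^ (a + 2)), fun r hr => ?_⟩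
  have h1 : r - 1 ≤ r ^ p := by
    rcases le_total r 1 with h | h
    · linarith [pow_nonneg hr p]
    · linarith [le_self_pow₀ h (by omega : p ≠ 0)]
  have h2 : Real.exp (-(c * r ^ p)) ≤ Real.exp (2 * c) * Real.exp (-(c * (1 + r))) := by
    rw [← Real.exp_add]
    refine Real.exp_le_exp.2 ?_
    have := mul_le_mul_of_nonneg_left h1 hc.le
    linarith
  have h3 : (1 + r) ^ (a + 2) * Real.exp (-(c * (1 + r)))
      ≤ (a + 2).factorial / c ^ (a + 2) := by
    have h4 := Real.pow_div_factorial_le_exp (x := c * (1 + r)) (by positivity) (a + 2)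
    rw [Real.exp_neg, ← div_eq_mul_inv, div_le_div_iff₀ (by positivity) (by positivity)]
    rw [div_le_iff₀ (by positivity), mul_pow] at h4
    linarith
  calc (1 + r) ^ 2 * (r ^ a * Real.exp (-(c * r ^ p)))
      ≤ (1 + r) ^ 2 * ((1 + r) ^ a * (Real.exp (2 * c) * Real.exp (-(c * (1 + r))))) := by
        gcongr; linarith
    _ = Real.exp (2 * c) * ((1 + r) ^ (a + 2) * Real.exp (-(c * (1 + r)))) := by ring
    _ ≤ _ := by gcongr

/-- The kernel is dominated by (1+‖k‖)^{-2}, which is square integrable in dimension 3 because 4 >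
3. -/
theorem memLp_kernel {c : ℝ} (hc : 0 < c) (a p : ℕ) (hp : 1 ≤ p) :
    MemLp (fun k => ‖freq k‖ ^ a * Real.exp (-(c * ‖freq k‖ ^ p))) 2 volume := by
  obtain ⟨K, hK⟩ := exists_pow_mul_exp_le hc a p hp
  have h1 : MemLp (fun k : R3 => (1 + ‖k‖) ^ (-2 : ℝ)) 2 volume := by
    have hc : Continuous fun k : R3 => (1 + ‖k‖) ^ (-2 : ℝ) :=
      (continuous_const.add continuous_norm).rpow_const fun k =>
        Or.inl (add_pos_of_pos_of_nonneg one_pos (norm_nonneg k)).ne'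
    refine (memLp_two_iff_integrable_sq hc.aestronglyMeasurable).2 ?_
    refine (integrable_one_add_norm (E := R3) (μ := volume) (r := 4) (by simp; norm_num)).congr
      (.of_forall fun k => ?_)
    change _ = ((1 + ‖k‖) ^ (-2 : ℝ)) ^ 2
    rw [← Real.rpow_natCast, ← Real.rpow_mul (by positivity)]
    norm_num
  have hm := continuous_freq
  refine h1.of_le_mul (c := K) (by fun_prop) (.of_forall fun k => ?_)
  have h2 : ‖k‖ ≤ ‖freq k‖ := by
    rw [norm_freq]
    have := Real.pi_gt_three
    nlinarith [norm_nonneg k]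
  rw [Real.norm_of_nonneg (by positivity), Real.norm_of_nonneg (by positivity),
    Real.rpow_neg (by positivity), Real.rpow_ofNat, ← div_eq_mul_inv, le_div_iff₀ (by positivity),
    mul_comm]
  refine le_trans ?_ (hK ‖freq k‖ (norm_nonneg _))
  gcongr

/-- Decay of the low frequency kernels. -/
theorem exists_eLpNorm_kernel_le {c : ℝ} (hc : 0 < c) (a p : ℕ) (hp : 1 ≤ p) :
    ∃ K : ℝ≥0, ∀ t : ℝ, 0 ≤ t →
      eLpNorm (fun k => ‖freq k‖ ^ a * Real.exp (-(c * ‖freq k‖ ^ p) * (1 + t))) 2 volume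
        ≤ K * rate ((2 * a + 3) / (2 * p)) t := by
  have hg := memLp_kernel hc a p hp
  set g : R3 → ℝ := fun k => ‖freq k‖ ^ a * Real.exp (-(c * ‖freq k‖ ^ p)) with hgdef
  refine ⟨(eLpNorm g 2 volume).toNNReal, fun t ht => ?_⟩
  rw [ENNReal.coe_toNNReal hg.eLpNorm_ne_top]
  have ht1 : 0 < 1 + t := by linarith
  have hp0 : (p : ℝ) ≠ 0 := by positivity
  -- With s^p = 1 + t, dilation by s turns the kernel at time t into the kernel without time. The
  -- prefactor s^{-a} and the factor s^{-3/2} from the Lebesgue measure give the exponent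
  -- (2a+3)/(2p).
  obtain ⟨s, hs⟩ : ∃ s, s = (1 + t) ^ (1 / p : ℝ) := ⟨_, rfl⟩
  have hs0 : 0 < s := hs ▸ Real.rpow_pos_of_pos ht1 _
  have hsp : s ^ p = 1 + t := by
    rw [hs, ← Real.rpow_natCast, ← Real.rpow_mul ht1.le, one_div_mul_cancel hp0, Real.rpow_one]
  have h1 : (fun k => ‖freq k‖ ^ a * Real.exp (-(c * ‖freq k‖ ^ p) * (1 + t)))
      = (s ^ a)⁻¹ • (g ∘ fun k => s • k) := by
    ext k
    have : ‖freq (s • k)‖ = s * ‖freq k‖ := by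
      rw [norm_freq, norm_freq, norm_smul, Real.norm_of_nonneg hs0.le]; ring
    simp only [Pi.smul_apply, Function.comp, hgdef, this, smul_eq_mul, mul_pow, hsp]
    rw [show -(c * ‖freq k‖ ^ p) * (1 + t) = -(c * ((1 + t) * ‖freq k‖ ^ p)) by ring]
    field_simp
  have hmap := Measure.map_addHaar_smul (volume : Measure R3) hs0.ne'
  have hgm : Continuous g := by have := continuous_freq; fun_prop
  rw [h1, eLpNorm_const_smul, ← eLpNorm_map_measure hgm.aestronglyMeasurable (by fun_prop), hmap,
    eLpNorm_smul_measure_of_ne_top (by norm_num), smul_eq_mul, ← mul_assoc, mul_comm]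
  gcongr
  rw [rate, Real.enorm_of_nonneg (by positivity), finrank_euclideanSpace_fin,
    abs_of_nonneg (by positivity), ENNReal.ofReal_rpow_of_nonneg (by positivity) (by positivity),
    ← ENNReal.ofReal_mul (by positivity)]
  refine le_of_eq (congrArg ENNReal.ofReal ?_)
  have h2 : ∀ m : ℕ, (s ^ m)⁻¹ = (1 + t) ^ (-(m / p) : ℝ) := fun m => by
    rw [Real.rpow_neg ht1.le, hs, ← Real.rpow_natCast, ← Real.rpow_mul ht1.le]
    congr 2; ring
  rw [h2, h2, ← Real.rpow_mul ht1.le, ← Real.rpow_add ht1]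
  congr 1
  simp only [ENNReal.toReal_div, ENNReal.toReal_one, ENNReal.toReal_ofNat]
  field_simp
  push_cast
  ring

/-- Exponential decay dominates algebraic decay. -/
theorem exists_exp_neg_le_rpow {c b : ℝ} (hc : 0 < c) (hb : 0 < b) :
    ∃ K > 0, ∀ y : ℝ, 0 < y → Real.exp (-(c * y)) ≤ K * y ^ (-b) := by
  -- This is (b/c)^b e^{-b}, the maximum of y^b e^{-cy}, attained at y = b/c; the proof is log z ≤ z
  -- - 1 at z = cy/b.
  refine ⟨Real.exp (b * Real.log (b / c) - b), Real.exp_pos _, fun y hy => ?_⟩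
  rw [Real.rpow_def_of_pos hy, ← Real.exp_add]
  refine Real.exp_le_exp.2 ?_
  have h1 := Real.log_le_sub_one_of_pos (x := c * y / b) (by positivity)
  have h2 : Real.log (c * y / b) = Real.log y - Real.log (b / c) := by
    rw [← Real.log_div hy.ne' (by positivity)]
    congr 1; field_simp
  rw [h2] at h1
  have h3 := mul_le_mul_of_nonneg_left h1 hb.le
  have h4 : b * (c * y / b - 1) = c * y - b := by field_simp
  rw [h4] at h3
  linarith

theorem exists_exp_neg_mul_le {c : ℝ} (hc : 0 < c) {d : ℝ} (hd : 0 < d) :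
    ∃ K > 0, ∀ t : ℝ, 0 ≤ t → ∀ b ≤ d, Real.exp (-c * t) ≤ K * (1 + t) ^ (-b) := by
  obtain ⟨K, hK, h⟩ := exists_exp_neg_le_rpow hc hd
  refine ⟨Real.exp c * K, by positivity, fun t ht b hb => ?_⟩
  have h1 : Real.exp (-c * t) = Real.exp c * Real.exp (-(c * (1 + t))) := by
    rw [← Real.exp_add]; congr 1; ring
  rw [h1, mul_assoc]
  have h2 : (1 + t) ^ (-d) ≤ (1 + t) ^ (-b) :=
    Real.rpow_le_rpow_of_exponent_le (by linarith) (by linarith)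
  have h3 := h (1 + t) (by linarith)
  gcongr
  exact h3.trans (by gcongr)

/-- Loss of regularity: high frequencies decay algebraically at the price of derivatives. -/
theorem exists_exp_neg_div_le {c r₀ : ℝ} (hc : 0 < c) (hr₀ : 0 < r₀) (m : ℕ) (hm : 1 ≤ m) :
    ∃ K > 0, ∀ r : ℝ, r₀ ≤ r → ∀ t : ℝ, 0 ≤ t → ∀ b : ℝ, b ≤ m / 2 →
      Real.exp (-(c / r ^ 2) * t) ≤ K * (r ^ m * (1 + t) ^ (-b)) := by
  obtain ⟨K, hK, h⟩ := exists_exp_neg_le_rpow hc (b := m / 2) (by positivity)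
  refine ⟨Real.exp (c / r₀ ^ 2) * K, by positivity, fun r hr t ht b hb => ?_⟩
  have hr0 : 0 < r := hr₀.trans_le hr
  have h1 : Real.exp (-(c / r ^ 2) * t)
      ≤ Real.exp (c / r₀ ^ 2) * Real.exp (-(c * ((1 + t) / r ^ 2))) := by
    rw [← Real.exp_add]
    refine Real.exp_le_exp.2 ?_
    have : c / r ^ 2 ≤ c / r₀ ^ 2 := by gcongr
    have h2 : -(c / r ^ 2) * t = c / r ^ 2 + -(c * ((1 + t) / r ^ 2)) := by field_simp; ring
    linarith
  -- Taking y = (1+t)/r² with exponent m/2 trades m powers of r for m/2 powers of time.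
  have h2 := h ((1 + t) / r ^ 2) (by positivity)
  have h3 : ((1 + t) / r ^ 2) ^ (-(m / 2 : ℝ)) = r ^ m * (1 + t) ^ (-(m / 2 : ℝ)) := by
    rw [Real.div_rpow (by linarith) (by positivity), ← Real.rpow_natCast r 2,
      ← Real.rpow_mul hr0.le, show ((2 : ℕ) : ℝ) * -(m / 2 : ℝ) = -(m : ℝ) by push_cast; ring,
      Real.rpow_neg hr0.le, Real.rpow_natCast, div_inv_eq_mul, mul_comm]
  have h4 : (1 + t) ^ (-(m / 2 : ℝ)) ≤ (1 + t) ^ (-b) :=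
    Real.rpow_le_rpow_of_exponent_le (by linarith) (by linarith)
  rw [h3] at h2
  calc _ ≤ _ := h1
    _ ≤ Real.exp (c / r₀ ^ 2) * (K * (r ^ m * (1 + t) ^ (-(m / 2 : ℝ)))) := by gcongr
    _ ≤ Real.exp (c / r₀ ^ 2) * (K * (r ^ m * (1 + t) ^ (-b))) := by gcongr
    _ = _ := by ring

end Decay

/-! ### Bounds at a fixed frequency in terms of kernels and algebraic rates -/

section Pointwise

/-- The low frequency kernels. -/
noncomputable def low (c : ℝ) (a p : ℕ) (ξ : R3) (t : ℝ) : ℝ :=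
  ‖ξ‖ ^ a * Real.exp (-(c * ‖ξ‖ ^ p) * (1 + t))

/-- Algebraic decay of order `b`. -/
noncomputable def alg (b t : ℝ) : ℝ := (1 + t) ^ (-b)

theorem low_nonneg (c : ℝ) (a p : ℕ) (ξ : R3) (t : ℝ) : 0 ≤ low c a p ξ t := by
  unfold low; positivity

theorem alg_nonneg (b : ℝ) {t : ℝ} (ht : 0 ≤ t) : 0 ≤ alg b t := by
  unfold alg; positivity

/-- The bounds for the Fourier transform of the solution at the frequency `ξ` and the time `t`
in terms of the sizes of the Fourier transforms of the initial data. -/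
structure FiberBound (c C : ℝ) (ξ : R3) (t n₀ u₀ E₀ B₀ n u E B : ℝ) : Prop where
  bound_n : n ≤ C * (low c 1 2 ξ t * E₀ + low c 1 2 ξ t * u₀ + alg (5 / 4) t * n₀
    + alg (5 / 4) t * u₀)
  bound_u : u ≤ C * (low c 1 4 ξ t * B₀ + low c 2 4 ξ t * E₀ + low c 2 4 ξ t * u₀
    + low c 0 2 ξ t * E₀ + low c 0 2 ξ t * u₀ + alg (5 / 8) t * B₀ + alg (3 / 4) t * E₀
    + alg (3 / 4) t * u₀ + alg (5 / 4) t * n₀)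
  bound_E : E ≤ C * (low c 3 4 ξ t * B₀ + low c 3 4 ξ t * E₀ + low c 3 4 ξ t * u₀
    + low c 1 2 ξ t * B₀ + low c 0 2 ξ t * E₀ + low c 0 2 ξ t * u₀
    + alg (9 / 8) t * (‖ξ‖ ^ 3 * B₀) + alg (3 / 4) t * (‖ξ‖ ^ 2 * E₀) + alg (3 / 4) t * E₀
    + alg (3 / 4) t * u₀)
  bound_B : B ≤ C * (low c 0 4 ξ t * B₀ + low c 3 4 ξ t * E₀ + low c 1 4 ξ t * u₀
    + low c 1 2 ξ t * E₀ + alg (3 / 8) t * (‖ξ‖ ^ 1 * B₀) + alg (9 / 8) t * (‖ξ‖ ^ 3 * E₀)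
    + alg (5 / 8) t * u₀)
  bound_gradB : ‖ξ‖ * B ≤ C * (low c 1 4 ξ t * B₀ + low c 4 4 ξ t * E₀ + low c 2 4 ξ t * u₀
    + low c 2 2 ξ t * E₀ + alg (5 / 8) t * (‖ξ‖ ^ 3 * B₀) + alg (5 / 8) t * (‖ξ‖ ^ 3 * E₀)
    + alg (7 / 8) t * (‖ξ‖ ^ 1 * u₀))

theorem FiberBound.mono {c C C' : ℝ} {ξ : R3} {t n₀ u₀ E₀ B₀ n u E B : ℝ}
    (h : FiberBound c C ξ t n₀ u₀ E₀ B₀ n u E B) (hC : C ≤ C') (ht : 0 ≤ t) (hn : 0 ≤ n₀)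
    (hu : 0 ≤ u₀) (hE : 0 ≤ E₀) (hB : 0 ≤ B₀) : FiberBound c C' ξ t n₀ u₀ E₀ B₀ n u E B := by
  have hl := fun a p => low_nonneg c a p ξ t
  have ha := fun b => alg_nonneg b ht
  have h1 := hl 1 2
  have h2 := hl 1 4
  have h3 := hl 2 4
  have h4 := hl 0 2
  have h5 := hl 3 4
  have h6 := hl 0 4
  have h7 := hl 4 4
  have h8 := hl 2 2
  have a1 := ha (5 / 4)
  have a2 := ha (5 / 8)
  have a3 := ha (3 / 4)
  have a4 := ha (9 / 8)
  have a5 := ha (3 / 8)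
  have a6 := ha (7 / 8)
  exact ⟨h.1.trans (mul_le_mul_of_nonneg_right hC (by positivity)),
    h.2.trans (mul_le_mul_of_nonneg_right hC (by positivity)),
    h.3.trans (mul_le_mul_of_nonneg_right hC (by positivity)),
    h.4.trans (mul_le_mul_of_nonneg_right hC (by positivity)),
    h.5.trans (mul_le_mul_of_nonneg_right hC (by positivity))⟩

variable {γ β μ : ℝ}

/-- Replacing t by 1 + t in the exponentials costs a factor e^c, as ‖ξ‖ ≤ 1. The algebraic terms of
`FiberBound` are nonnegative and simply discarded. -/
theorem SymbolSol.fiberBound_low (hγ : 0 < γ) (hβ : 0 < β) (hμ : 0 < μ) :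
    ∃ r₀ > 0, ∃ c > 0, ∃ C > 0, ∀ ξ : R3, 0 < ‖ξ‖ → ‖ξ‖ ≤ r₀ →
      ∀ (n : ℝ → ℂ) (u E B : ℝ → C3), SymbolSol γ β μ ξ n u E B → ∀ t, 0 ≤ t →
      FiberBound c C ξ t ‖n 0‖ ‖u 0‖ ‖E 0‖ ‖B 0‖ ‖n t‖ ‖u t‖ ‖E t‖ ‖B t‖ := by
  obtain ⟨r₀, pr₀, hr₀, c, pc, C, pC, H⟩ := SymbolSol.low_freq hγ hβ hμ
  refine ⟨r₀, pr₀, c, pc, C * Real.exp c, by positivity, fun ξ hξ hξr n u E B h t ht => ?_⟩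
  obtain ⟨hn, hu, hE, hB⟩ := H ξ hξ hξr n u E B h t ht
  have hexp : ∀ p : ℕ, Real.exp (-(c * ‖ξ‖ ^ p) * t)
      ≤ Real.exp c * Real.exp (-(c * ‖ξ‖ ^ p) * (1 + t)) := fun p => by
    rw [← Real.exp_add]
    refine Real.exp_le_exp.2 ?_
    have : c * ‖ξ‖ ^ p ≤ c * 1 :=
      mul_le_mul_of_nonneg_left (pow_le_one₀ (norm_nonneg _) (hξr.trans hr₀)) pc.le
    linarith
  have g2 := hexp 2
  have g4 := hexp 4
  have a1 := alg_nonneg (5 / 4) ht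
  have a2 := alg_nonneg (5 / 8) ht
  have a3 := alg_nonneg (3 / 4) ht
  have a4 := alg_nonneg (9 / 8) ht
  have a5 := alg_nonneg (3 / 8) ht
  have a6 := alg_nonneg (7 / 8) ht
  have hl2 : ∀ a, low c a 2 ξ t = ‖ξ‖ ^ a * Real.exp (-(c * ‖ξ‖ ^ 2) * (1 + t)) := fun _ => rfl
  have hl4 : ∀ a, low c a 4 ξ t = ‖ξ‖ ^ a * Real.exp (-(c * ‖ξ‖ ^ 4) * (1 + t)) := fun _ => rfl
  obtain ⟨E2, hE2⟩ : ∃ x, x = Real.exp (-(c * ‖ξ‖ ^ 2) * t) := ⟨_, rfl⟩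
  obtain ⟨E4, hE4⟩ : ∃ x, x = Real.exp (-(c * ‖ξ‖ ^ 4) * t) := ⟨_, rfl⟩
  obtain ⟨e2, he2⟩ : ∃ x, x = Real.exp (-(c * ‖ξ‖ ^ 2) * (1 + t)) := ⟨_, rfl⟩
  obtain ⟨e4, he4⟩ : ∃ x, x = Real.exp (-(c * ‖ξ‖ ^ 4) * (1 + t)) := ⟨_, rfl⟩
  obtain ⟨D, hD⟩ : ∃ x, x = Real.exp c := ⟨_, rfl⟩
  have pD : 0 < D := hD ▸ Real.exp_pos _
  obtain ⟨r, hr⟩ : ∃ x, x = ‖ξ‖ := ⟨_, rfl⟩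
  rw [← hE2, ← he2, ← hD] at g2
  rw [← hE4, ← he4, ← hD] at g4
  simp only [← hE2, ← hE4] at hn hu hE hB
  simp only [← hr] at hn hu hE hB
  have pr : 0 ≤ r := hr ▸ norm_nonneg _
  have n0 := norm_nonneg (n 0)
  have u0 := norm_nonneg (u 0)
  have E0 := norm_nonneg (E 0)
  have B0 := norm_nonneg (B 0)
  have extra : ∀ {x y P Q : ℝ}, x ≤ C * y → y ≤ D * P → P ≤ Q → x ≤ C * D * Q := by
    intro x y P Q h1 h2 h3
    calc x ≤ C * (D * P) := h1.trans (mul_le_mul_of_nonneg_left h2 pC.le)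
      _ = C * D * P := by ring
      _ ≤ C * D * Q := mul_le_mul_of_nonneg_left h3 (by positivity)
  have hBy : E4 * (‖B 0‖ + r ^ 3 * ‖E 0‖ + r * ‖u 0‖) + E2 * (r * ‖E 0‖)
      ≤ D * (r ^ 0 * e4 * ‖B 0‖ + r ^ 3 * e4 * ‖E 0‖ + r ^ 1 * e4 * ‖u 0‖
        + r ^ 1 * e2 * ‖E 0‖) := by
    calc _ ≤ (D * e4) * (‖B 0‖ + r ^ 3 * ‖E 0‖ + r * ‖u 0‖) + (D * e2) * (r * ‖E 0‖) := by gcongr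
      _ = _ := by ring
  constructor
  · rw [← hD]
    refine extra hn (P := r ^ 1 * e2 * ‖E 0‖ + r ^ 1 * e2 * ‖u 0‖) ?_ ?_
    · calc _ ≤ (D * e2) * (r * ‖E 0‖ + r * ‖u 0‖) := by gcongr
        _ = _ := by ring
    · simp only [hl2, ← he2]
      simp only [← hr]
      have : 0 ≤ alg (5 / 4) t * ‖n 0‖ + alg (5 / 4) t * ‖u 0‖ := by positivity
      linarith
  · rw [← hD]
    refine extra hu (P := r ^ 1 * e4 * ‖B 0‖ + r ^ 2 * e4 * ‖E 0‖ + r ^ 2 * e4 * ‖u 0‖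
      + r ^ 0 * e2 * ‖E 0‖ + r ^ 0 * e2 * ‖u 0‖) ?_ ?_
    · calc _ ≤ (D * e4) * (r * ‖B 0‖ + r ^ 2 * ‖E 0‖ + r ^ 2 * ‖u 0‖)
            + (D * e2) * (‖E 0‖ + ‖u 0‖) := by gcongr
        _ = _ := by ring
    · simp only [hl2, hl4, ← he2, ← he4]
      simp only [← hr]
      have : 0 ≤ alg (5 / 8) t * ‖B 0‖ + alg (3 / 4) t * ‖E 0‖
        + alg (3 / 4) t * ‖u 0‖ + alg (5 / 4) t * ‖n 0‖ := by positivity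
      linarith
  · rw [← hD]
    refine extra hE (P := r ^ 3 * e4 * ‖B 0‖ + r ^ 3 * e4 * ‖E 0‖ + r ^ 3 * e4 * ‖u 0‖
      + r ^ 1 * e2 * ‖B 0‖ + r ^ 0 * e2 * ‖E 0‖ + r ^ 0 * e2 * ‖u 0‖) ?_ ?_
    · calc _ ≤ (D * e4) * (r ^ 3 * ‖B 0‖ + r ^ 3 * ‖E 0‖ + r ^ 3 * ‖u 0‖)
            + (D * e2) * (r * ‖B 0‖ + ‖E 0‖ + ‖u 0‖) := by gcongr
        _ = _ := by ring
    · simp only [hl2, hl4, ← he2, ← he4]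
      simp only [← hr]
      have : 0 ≤ alg (9 / 8) t * (r ^ 3 * ‖B 0‖) + alg (3 / 4) t * (r ^ 2 * ‖E 0‖)
        + alg (3 / 4) t * ‖E 0‖ + alg (3 / 4) t * ‖u 0‖ := by positivity
      linarith
  · rw [← hD]
    refine extra hB hBy ?_
    simp only [hl2, hl4, ← he2, ← he4]
    simp only [← hr]
    have : 0 ≤ alg (3 / 8) t * (r ^ 1 * ‖B 0‖) + alg (9 / 8) t * (r ^ 3 * ‖E 0‖)
        + alg (5 / 8) t * ‖u 0‖ := by positivity
    linarith
  · rw [← hD, ← hr]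
    -- The bound for the gradient is the bound for `B` multiplied by r, which raises every kernel
    -- exponent by one.
    have h1 := mul_le_mul_of_nonneg_left (hB.trans (mul_le_mul_of_nonneg_left hBy pC.le)) pr
    refine extra (P := r ^ 1 * e4 * ‖B 0‖ + r ^ 4 * e4 * ‖E 0‖ + r ^ 2 * e4 * ‖u 0‖
      + r ^ 2 * e2 * ‖E 0‖) (le_of_le_of_eq h1 ?_) le_rfl ?_
    · ring
    · simp only [hl2, hl4, ← he2, ← he4]
      simp only [← hr]
      have : 0 ≤ alg (5 / 8) t * (r ^ 3 * ‖B 0‖) + alg (5 / 8) t * (r ^ 3 * ‖E 0‖)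
        + alg (7 / 8) t * (r ^ 1 * ‖u 0‖) := by positivity
      linarith

/-- Each e^{-ct/r²} is traded for r^m(1+t)^{-m/2}, with m chosen for each datum to reach the
prescribed rate. Powers of r left after dividing by the weight r² or r⁴ are the derivatives in the
estimate. The rate `c'` is arbitrary because the kernel terms are only added as nonnegative
quantities. -/
theorem SymbolSol.fiberBound_high (hγ : 0 < γ) (hβ : 0 < β) (hμ : 0 < μ) {r₀ : ℝ} (hr₀ : 0 < r₀)
    (c' : ℝ) :
    ∃ C > 0, ∀ ξ : R3, r₀ ≤ ‖ξ‖ →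
      ∀ (n : ℝ → ℂ) (u E B : ℝ → C3), SymbolSol γ β μ ξ n u E B → ∀ t, 0 ≤ t →
      FiberBound c' C ξ t ‖n 0‖ ‖u 0‖ ‖E 0‖ ‖B 0‖ ‖n t‖ ‖u t‖ ‖E t‖ ‖B t‖ := by
  obtain ⟨c, pc, C, pC, H⟩ := SymbolSol.away_from_zero hγ hβ hμ hr₀
  obtain ⟨K₀, pK₀, hK₀⟩ := exists_exp_neg_mul_le pc (d := 5 / 4) (by norm_num)
  obtain ⟨K₁, pK₁, hK₁⟩ := exists_exp_neg_div_le pc hr₀ 1 (by norm_num)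
  obtain ⟨K₂, pK₂, hK₂⟩ := exists_exp_neg_div_le pc hr₀ 2 (by norm_num)
  obtain ⟨K₃, pK₃, hK₃⟩ := exists_exp_neg_div_le pc hr₀ 3 (by norm_num)
  obtain ⟨K₄, pK₄, hK₄⟩ := exists_exp_neg_div_le pc hr₀ 4 (by norm_num)
  obtain ⟨K, hK⟩ : ∃ x, x = K₀ + K₁ + K₂ + K₃ + K₄ := ⟨_, rfl⟩
  have pK : 0 < K := by rw [hK]; positivity
  -- The factor 2 is needed since the same datum can occur twice with the same rate, once from
  -- e^{-ct/r²} and once from e^{-ct}.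
  refine ⟨C * (2 * K), by positivity, fun ξ hξr n u E B h t ht => ?_⟩
  obtain ⟨hn, hu, hE, hB⟩ := H ξ hξr n u E B h t ht
  have hl := fun a p => low_nonneg c' a p ξ t
  have ha := fun b => alg_nonneg b ht
  have n0 := norm_nonneg (n 0)
  have u0 := norm_nonneg (u 0)
  have E0 := norm_nonneg (E 0)
  have B0 := norm_nonneg (B 0)
  obtain ⟨Ee, hEe⟩ : ∃ x, x = Real.exp (-c * t) := ⟨_, rfl⟩
  obtain ⟨Eh, hEh⟩ : ∃ x, x = Real.exp (-(c / ‖ξ‖ ^ 2) * t) := ⟨_, rfl⟩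
  have pEe : 0 ≤ Ee := hEe ▸ (Real.exp_pos _).le
  have ge : ∀ b ≤ (5 / 4 : ℝ), Ee ≤ K * alg b t := fun b hb => by
    rw [hEe]
    exact (hK₀ t ht b hb).trans (mul_le_mul_of_nonneg_right (by rw [hK]; linarith) (ha b))
  have gh : ∀ (m : ℕ) (K' : ℝ), K' ≤ K → (∀ r : ℝ, r₀ ≤ r → ∀ t : ℝ, 0 ≤ t → ∀ b : ℝ, b ≤ m / 2 →
      Real.exp (-(c / r ^ 2) * t) ≤ K' * (r ^ m * (1 + t) ^ (-b))) → ∀ b ≤ (m / 2 : ℝ),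
      Eh ≤ K * (‖ξ‖ ^ m * alg b t) := fun m K' hK' h b hb => by
    rw [hEh]
    exact (h _ hξr t ht b hb).trans (mul_le_mul_of_nonneg_right hK'
      (mul_nonneg (by positivity) (ha b)))
  have g1 := gh 1 K₁ (by rw [hK]; linarith) hK₁
  have g2 := gh 2 K₂ (by rw [hK]; linarith) hK₂
  have g3 := gh 3 K₃ (by rw [hK]; linarith) hK₃
  have g4 := gh 4 K₄ (by rw [hK]; linarith) hK₄
  simp only [← hEe, ← hEh] at hn hu hE hB
  obtain ⟨r, hr⟩ : ∃ x, x = ‖ξ‖ := ⟨_, rfl⟩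
  have pr : 0 < r := hr ▸ hr₀.trans_le hξr
  simp only [← hr] at hn hu hE hB g1 g2 g3 g4
  have a54 := ha (5 / 4)
  have a58 := ha (5 / 8)
  have a34 := ha (3 / 4)
  have a98 := ha (9 / 8)
  have a38 := ha (3 / 8)
  have a78 := ha (7 / 8)
  -- passing from a weighted bound to the bound itself
  have finish : ∀ {w x y P L : ℝ}, 0 < w → w * x ≤ C * y → y ≤ w * (2 * K * P) → 0 ≤ L →
      x ≤ C * (2 * K) * (L + P) := by
    intro w x y P L hw h1 h2 h3
    have h4 : w * x ≤ w * (C * (2 * K) * P) :=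
      calc w * x ≤ C * (w * (2 * K * P)) := h1.trans (mul_le_mul_of_nonneg_left h2 pC.le)
        _ = _ := by ring
    refine (le_of_mul_le_mul_left h4 hw).trans ?_
    exact mul_le_mul_of_nonneg_left (by linarith) (by positivity)
  constructor
  · have e1 := mul_le_mul_of_nonneg_right (ge (5 / 4) le_rfl) n0
    have e2 := mul_le_mul_of_nonneg_right (ge (5 / 4) le_rfl) u0
    have q1 : 0 ≤ K * alg (5 / 4) t * ‖n 0‖ := by positivity
    have q2 : 0 ≤ K * alg (5 / 4) t * ‖u 0‖ := by positivity
    refine (finish (P := alg (5 / 4) t * ‖n 0‖ + alg (5 / 4) t * ‖u 0‖)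
      (L := low c' 1 2 ξ t * ‖E 0‖ + low c' 1 2 ξ t * ‖u 0‖) one_pos
      (by rw [one_mul]; exact hn) ?_ ?_).trans_eq (by ring)
    · linarith
    · have := hl 1 2; positivity
  · have e1 := mul_le_mul_of_nonneg_right (g2 (5 / 8) (by norm_num))
      (by positivity : 0 ≤ r ^ 2 * ‖B 0‖)
    have e2 := mul_le_mul_of_nonneg_right (g2 (3 / 4) (by norm_num))
      (by positivity : 0 ≤ r ^ 2 * ‖E 0‖)
    have e3 := mul_le_mul_of_nonneg_right (g4 (3 / 4) (by norm_num)) u0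
    have e4 := mul_le_mul_of_nonneg_right (ge (5 / 4) le_rfl) (by positivity : 0 ≤ r ^ 4 * ‖n 0‖)
    have e5 := mul_le_mul_of_nonneg_right (ge (3 / 4) (by norm_num))
      (by positivity : 0 ≤ r ^ 4 * ‖u 0‖)
    have q1 : 0 ≤ K * r ^ 4 * (alg (5 / 8) t * ‖B 0‖) := by positivity
    have q2 : 0 ≤ K * r ^ 4 * (alg (3 / 4) t * ‖E 0‖) := by positivity
    have q3 : 0 ≤ K * r ^ 4 * (alg (5 / 4) t * ‖n 0‖) := by positivity
    refine (finish (P := alg (5 / 8) t * ‖B 0‖ + alg (3 / 4) t * ‖E 0‖ + alg (3 / 4) t * ‖u 0‖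
        + alg (5 / 4) t * ‖n 0‖)
      (L := low c' 1 4 ξ t * ‖B 0‖ + low c' 2 4 ξ t * ‖E 0‖ + low c' 2 4 ξ t * ‖u 0‖
        + low c' 0 2 ξ t * ‖E 0‖ + low c' 0 2 ξ t * ‖u 0‖) (by positivity : 0 < r ^ 4)
      hu ?_ ?_).trans_eq (by ring)
    · linarith
    · have := hl 1 4; have := hl 2 4; have := hl 0 2; positivity
  · have e1 := mul_le_mul_of_nonneg_right (g3 (9 / 8) (by norm_num))
      (by positivity : 0 ≤ r ^ 2 * ‖B 0‖)
    have e2 := mul_le_mul_of_nonneg_right (g2 (3 / 4) (by norm_num))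
      (by positivity : 0 ≤ r ^ 2 * ‖E 0‖)
    have e3 := mul_le_mul_of_nonneg_right (g2 (3 / 4) (by norm_num)) u0
    have e4 := mul_le_mul_of_nonneg_right (ge (3 / 4) (by norm_num))
      (by positivity : 0 ≤ r ^ 2 * ‖E 0‖)
    have e5 := mul_le_mul_of_nonneg_right (ge (3 / 4) (by norm_num))
      (by positivity : 0 ≤ r ^ 2 * ‖u 0‖)
    have q1 : 0 ≤ K * r ^ 2 * (alg (9 / 8) t * (r ^ 3 * ‖B 0‖)) := by positivity
    have q2 : 0 ≤ K * r ^ 2 * (alg (3 / 4) t * (r ^ 2 * ‖E 0‖)) := by positivity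
    have q3 : 0 ≤ K * r ^ 2 * (alg (3 / 4) t * ‖E 0‖) := by positivity
    rw [← hr]
    refine (finish (P := alg (9 / 8) t * (r ^ 3 * ‖B 0‖) + alg (3 / 4) t * (r ^ 2 * ‖E 0‖)
        + alg (3 / 4) t * ‖E 0‖ + alg (3 / 4) t * ‖u 0‖)
      (L := low c' 3 4 ξ t * ‖B 0‖ + low c' 3 4 ξ t * ‖E 0‖ + low c' 3 4 ξ t * ‖u 0‖
        + low c' 1 2 ξ t * ‖B 0‖ + low c' 0 2 ξ t * ‖E 0‖ + low c' 0 2 ξ t * ‖u 0‖)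
      (by positivity : 0 < r ^ 2) hE ?_ ?_).trans_eq (by ring)
    · linarith
    · have := hl 3 4; have := hl 1 2; have := hl 0 2; positivity
  · have e1 := mul_le_mul_of_nonneg_right (g1 (3 / 8) (by norm_num))
      (by positivity : 0 ≤ r ^ 2 * ‖B 0‖)
    have e2 := mul_le_mul_of_nonneg_right (g3 (9 / 8) (by norm_num))
      (by positivity : 0 ≤ r ^ 2 * ‖E 0‖)
    have e3 := mul_le_mul_of_nonneg_right (g2 (5 / 8) (by norm_num)) u0
    have q1 : 0 ≤ K * r ^ 2 * (alg (3 / 8) t * (r ^ 1 * ‖B 0‖)) := by positivity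
    have q2 : 0 ≤ K * r ^ 2 * (alg (9 / 8) t * (r ^ 3 * ‖E 0‖)) := by positivity
    have q3 : 0 ≤ K * r ^ 2 * (alg (5 / 8) t * ‖u 0‖) := by positivity
    rw [← hr]
    refine (finish (P := alg (3 / 8) t * (r ^ 1 * ‖B 0‖) + alg (9 / 8) t * (r ^ 3 * ‖E 0‖)
        + alg (5 / 8) t * ‖u 0‖)
      (L := low c' 0 4 ξ t * ‖B 0‖ + low c' 3 4 ξ t * ‖E 0‖ + low c' 1 4 ξ t * ‖u 0‖
        + low c' 1 2 ξ t * ‖E 0‖)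
      (by positivity : 0 < r ^ 2) hB ?_ ?_).trans_eq (by ring)
    · linarith
    · have := hl 0 4; have := hl 3 4; have := hl 1 4; have := hl 1 2; positivity
  · have e1 := mul_le_mul_of_nonneg_right (g2 (5 / 8) (by norm_num))
      (by positivity : 0 ≤ r * (r ^ 2 * ‖B 0‖))
    have e2 := mul_le_mul_of_nonneg_right (g2 (5 / 8) (by norm_num))
      (by positivity : 0 ≤ r * (r ^ 2 * ‖E 0‖))
    have e3 := mul_le_mul_of_nonneg_right (g2 (7 / 8) (by norm_num))
      (by positivity : 0 ≤ r * ‖u 0‖)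
    have q1 : 0 ≤ K * r ^ 2 * (alg (5 / 8) t * (r ^ 3 * ‖B 0‖)) := by positivity
    have q2 : 0 ≤ K * r ^ 2 * (alg (5 / 8) t * (r ^ 3 * ‖E 0‖)) := by positivity
    have q3 : 0 ≤ K * r ^ 2 * (alg (7 / 8) t * (r ^ 1 * ‖u 0‖)) := by positivity
    have h1 := mul_le_mul_of_nonneg_left hB pr.le
    rw [← hr]
    refine (finish (P := alg (5 / 8) t * (r ^ 3 * ‖B 0‖) + alg (5 / 8) t * (r ^ 3 * ‖E 0‖)
        + alg (7 / 8) t * (r ^ 1 * ‖u 0‖))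
      (L := low c' 1 4 ξ t * ‖B 0‖ + low c' 4 4 ξ t * ‖E 0‖ + low c' 2 4 ξ t * ‖u 0‖
        + low c' 2 2 ξ t * ‖E 0‖) (y := r * (Eh * (r ^ 2 * ‖B 0‖ + r ^ 2 * ‖E 0‖ + ‖u 0‖)))
      (by positivity : 0 < r ^ 2) (by linarith) ?_ ?_).trans_eq (by ring)
    · linarith
    · have := hl 1 4; have := hl 4 4; have := hl 2 4; have := hl 2 2; positivity

theorem SymbolSol.exists_fiberBound (hγ : 0 < γ) (hβ : 0 < β) (hμ : 0 < μ) :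
    ∃ c > 0, ∃ C > 0, ∀ ξ : R3, 0 < ‖ξ‖ →
      ∀ (n : ℝ → ℂ) (u E B : ℝ → C3), SymbolSol γ β μ ξ n u E B → ∀ t, 0 ≤ t →
      FiberBound c C ξ t ‖n 0‖ ‖u 0‖ ‖E 0‖ ‖B 0‖ ‖n t‖ ‖u t‖ ‖E t‖ ‖B t‖ := by
  obtain ⟨r₀, pr₀, c, pc, C, pC, H⟩ := SymbolSol.fiberBound_low hγ hβ hμ
  obtain ⟨C', pC', H'⟩ := SymbolSol.fiberBound_high hγ hβ hμ pr₀ c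
  refine ⟨c, pc, C + C', by positivity, fun ξ hξ n u E B h t ht => ?_⟩
  rcases le_total ‖ξ‖ r₀ with hr | hr
  · exact (H ξ hξ hr n u E B h t ht).mono (by linarith) ht (norm_nonneg _) (norm_nonneg _)
      (norm_nonneg _) (norm_nonneg _)
  · exact (H' ξ hr n u E B h t ht).mono (by linarith) ht (norm_nonneg _) (norm_nonneg _)
      (norm_nonneg _) (norm_nonneg _)

end Pointwise

/-! ### From bounds at each frequency to L² norms -/

section Transfer

/-- `G` is measurable and its `L²` norm is at most `K T`. -/
def NormLe (G : R3 → ℝ) (K : ℝ≥0) (T : ℝ≥0∞) : Prop :=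
  AEStronglyMeasurable G volume ∧ eLpNorm G 2 volume ≤ K * T

theorem NormLe.add {F G : R3 → ℝ} {K K' : ℝ≥0} {T : ℝ≥0∞} (hF : NormLe F K T)
    (hG : NormLe G K' T) : NormLe (fun k => F k + G k) (K + K') T := by
  refine ⟨hF.1.add hG.1, (eLpNorm_add_le hF.1 hG.1 (by norm_num)).trans ?_⟩
  rw [ENNReal.coe_add, add_mul]
  exact add_le_add hF.2 hG.2

theorem NormLe.mono {F : R3 → ℝ} {K K' : ℝ≥0} {T : ℝ≥0∞} (hF : NormLe F K T) (h : K ≤ K') :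
    NormLe F K' T :=
  ⟨hF.1, hF.2.trans (by gcongr)⟩

/-- Passing from a pointwise bound to a bound of norms. -/
theorem NormLe.eLpNorm_le {W : Type*} [NormedAddCommGroup W] {f : R3 → W} {G : R3 → ℝ} {K : ℝ≥0}
    {T : ℝ≥0∞} (hG : NormLe G K T) {C : ℝ} (hC : 0 ≤ C) (h : ∀ᵐ k, ‖f k‖ ≤ C * G k) :
    eLpNorm f 2 volume ≤ (C.toNNReal * K : ℝ≥0) * T := by
  refine (eLpNorm_le_mul_eLpNorm_of_ae_le_mul (c := C) (g := G) ?_ 2).trans ?_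
  · filter_upwards [h] with k hk
    exact hk.trans (mul_le_mul_of_nonneg_left (Real.le_norm_self _) hC)
  · rw [ENNReal.coe_mul, mul_assoc]
    exact mul_le_mul_right hG.2 _

theorem rate_le_rate {a b t : ℝ} (ht : 0 ≤ t) (h : b ≤ a) : rate a t ≤ rate b t :=
  ENNReal.ofReal_le_ofReal (Real.rpow_le_rpow_of_exponent_le (by linarith) (by linarith))

theorem rate_ne_zero (a : ℝ) {t : ℝ} (ht : 0 ≤ t) : rate a t ≠ 0 :=
  (ENNReal.ofReal_pos.2 (Real.rpow_pos_of_pos (by linarith) _)).ne'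

theorem continuous_low_freq (c : ℝ) (a p : ℕ) (t : ℝ) :
    Continuous fun k => low c a p (freq k) t := by
  have := continuous_freq
  unfold low
  fun_prop

/-- The low frequency kernels map integrable data to square integrable functions, with decay. -/
theorem exists_normLe_low {c : ℝ} (hc : 0 < c) :
    ∃ K : ℝ≥0, ∀ a p : ℕ, a < 5 → p < 5 → 1 ≤ p → ∀ (D : L2 R3) (t : ℝ), 0 ≤ t →
      ∀ (b : ℝ) (X T : ℝ≥0∞), b ≤ (2 * a + 3) / (2 * p) → norm1 D ≤ X → rate b t * X ≤ T →
      NormLe (fun k => low c a p (freq k) t * ‖ftv D k‖) K T := by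
  choose f hf using fun a q : ℕ => exists_eLpNorm_kernel_le hc a (q + 1) (by omega)
  -- The sum makes one constant serve all kernels, and 3 comes from `enorm_ftv_le`. The summand 1
  -- keeps the constant nonzero, so that the bound is also correct when the L¹ norm, and with it
  -- `T`, is infinite.
  refine ⟨3 * (∑ a ∈ Finset.range 5, ∑ q ∈ Finset.range 5, f a q) + 1,
    fun a p ha hp hp1 D t ht b X T hb hD hT => ?_⟩
  obtain ⟨q, rfl⟩ : ∃ q, p = q + 1 := ⟨p - 1, by omega⟩
  refine ⟨(continuous_low_freq c a _ t).aestronglyMeasurable.mul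
    (Lp.aestronglyMeasurable _).norm, ?_⟩
  have hfK : f a q ≤ ∑ a ∈ Finset.range 5, ∑ q ∈ Finset.range 5, f a q :=
    (Finset.single_le_sum (f := fun q => f a q) (fun _ _ => by positivity)
      (Finset.mem_range.2 (by omega : q < 5))).trans
    (Finset.single_le_sum (f := fun a => ∑ q ∈ Finset.range 5, f a q) (fun _ _ => by positivity)
      (Finset.mem_range.2 ha))
  have hT' : rate ((2 * a + 3) / (2 * ((q + 1 : ℕ) : ℝ))) t * norm1 D ≤ T :=
    (mul_le_mul' (rate_le_rate ht hb) hD).trans hT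
  rcases eq_or_ne (norm1 D) ⊤ with h | h
  · rw [h, ENNReal.mul_top (rate_ne_zero _ ht), top_le_iff] at hT'
    rw [hT', ENNReal.mul_top (by simp)]
    exact le_top
  · have h1 : ∀ᵐ k, ‖low c a (q + 1) (freq k) t * ‖ftv D k‖‖₊
        ≤ (3 * (norm1 D).toNNReal) * ‖low c a (q + 1) (freq k) t‖₊ := by
      filter_upwards [enorm_ftv_le D] with k hk
      rw [nnnorm_mul, nnnorm_norm, mul_comm]
      gcongr
      rw [← ENNReal.coe_le_coe, ENNReal.coe_mul, ENNReal.coe_toNNReal h]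
      exact_mod_cast hk
    refine (eLpNorm_le_nnreal_smul_eLpNorm_of_ae_le_mul h1 2).trans ?_
    change ((3 * (norm1 D).toNNReal : ℝ≥0) : ℝ≥0∞) * _ ≤ _
    rw [ENNReal.coe_mul, ENNReal.coe_toNNReal h]
    calc _ ≤ (3 : ℝ≥0) * norm1 D * (f a q * rate ((2 * a + 3) / (2 * ((q + 1 : ℕ) : ℝ))) t) :=
          mul_le_mul_right (hf a q t ht) _
      _ = (3 * f a q : ℝ≥0) * (rate ((2 * a + 3) / (2 * ((q + 1 : ℕ) : ℝ))) t * norm1 D) := by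
          rw [ENNReal.coe_mul]; ring
      _ ≤ _ := by
          refine mul_le_mul' (ENNReal.coe_le_coe.2 ?_) hT'
          exact le_add_right (mul_le_mul_right hfK _)

theorem eLpNorm_alg_mul {t : ℝ} (ht : 0 ≤ t) (b : ℝ) (G : R3 → ℝ) :
    eLpNorm (fun k => alg b t * G k) 2 volume = rate b t * eLpNorm G 2 volume := by
  have := eLpNorm_const_smul (alg b t) G 2 volume
  rw [Real.enorm_of_nonneg (alg_nonneg b ht)] at this
  exact this

theorem eLpNorm_ft (f : L2 ℝ) : eLpNorm (ft f) 2 volume = ‖f‖ₑ := by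
  rw [← Lp.enorm_def, ← ofReal_norm, norm_ft, ofReal_norm]

theorem eLpNorm_ftv_le (v : L2 R3) : eLpNorm (ftv v) 2 volume ≤ 3 * ‖v‖ₑ := by
  rw [← Lp.enorm_def, ← ofReal_norm, ← ofReal_norm]
  refine (ENNReal.ofReal_le_ofReal (norm_ftv_le v)).trans_eq ?_
  rw [ENNReal.ofReal_mul (by norm_num)]
  simp

theorem enorm_le_eLpNorm_ftv (v : L2 R3) : ‖v‖ₑ ≤ 3 * eLpNorm (ftv v) 2 volume := by
  rw [← Lp.enorm_def, ← ofReal_norm, ← ofReal_norm]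
  refine (ENNReal.ofReal_le_ofReal (norm_le_norm_ftv v)).trans_eq ?_
  rw [ENNReal.ofReal_mul (by norm_num)]
  simp

theorem normLe_alg_ft {K : ℝ≥0} (hK : 81 ≤ K) (D : L2 ℝ) {t : ℝ} (ht : 0 ≤ t) (b : ℝ) {X T : ℝ≥0∞}
    (hD : ‖D‖ₑ ≤ X) (hT : rate b t * X ≤ T) :
    NormLe (fun k => alg b t * ‖ft D k‖) K T := by
  refine ⟨(Lp.aestronglyMeasurable _).norm.const_mul _, ?_⟩
  rw [eLpNorm_alg_mul ht, eLpNorm_norm, eLpNorm_ft]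
  refine ((mul_le_mul_right hD _).trans hT).trans (le_mul_of_one_le_left' ?_)
  exact_mod_cast le_trans (by norm_num) hK

theorem normLe_alg_ftv {K : ℝ≥0} (hK : 81 ≤ K) (D : L2 R3) {t : ℝ} (ht : 0 ≤ t) (b : ℝ)
    {X T : ℝ≥0∞} (hD : ‖D‖ₑ ≤ X) (hT : rate b t * X ≤ T) :
    NormLe (fun k => alg b t * ‖ftv D k‖) K T := by
  refine ⟨(Lp.aestronglyMeasurable _).norm.const_mul _, ?_⟩
  rw [eLpNorm_alg_mul ht, eLpNorm_norm]
  have hK' : (3 : ℝ≥0∞) ≤ K := by exact_mod_cast le_trans (by norm_num) hK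
  calc _ ≤ rate b t * (3 * X) := by gcongr; exact (eLpNorm_ftv_le D).trans (by gcongr)
    _ = 3 * (rate b t * X) := by ring
    _ ≤ _ := mul_le_mul' hK' hT

/-- The threshold 81 = 3·3³ is the constant of `enorm_pow_freq_mul_le` for the highest order j = 3;
it is shared by all the algebraic terms. -/
theorem normLe_alg_pow {K : ℝ≥0} (hK : 81 ≤ K) {j : ℕ} (hj : j ≤ 3) (D : L2 R3) {t : ℝ}
    (ht : 0 ≤ t) (b : ℝ) {X T : ℝ≥0∞} (hD : gradNorm j D ≤ X) (hT : rate b t * X ≤ T) :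
    NormLe (fun k => alg b t * (‖freq k‖ ^ j * ‖ftv D k‖)) K T := by
  have hf := continuous_freq
  refine ⟨(((hf.norm.pow j).aestronglyMeasurable.mul
    (Lp.aestronglyMeasurable _).norm).const_mul _), ?_⟩
  have h1 : eLpNorm (fun k => ‖freq k‖ ^ j * ‖ftv D k‖) 2 volume
      = eLpNorm (fun k => ‖freq k‖ ^ j • ftv D k) 2 volume :=
    eLpNorm_congr_norm_ae (.of_forall fun k => by simp [norm_smul])
  rw [eLpNorm_alg_mul ht, h1]
  have hK' : (3 * 3 ^ j : ℝ≥0∞) ≤ K := by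
    have : (3 * 3 ^ j : ℝ≥0) ≤ K := le_trans (by interval_cases j <;> norm_num) hK
    exact_mod_cast this
  calc _ ≤ rate b t * (3 * 3 ^ j * X) := by
          gcongr; exact (enorm_pow_freq_mul_le j D).trans (by gcongr)
    _ = (3 * 3 ^ j) * (rate b t * X) := by ring
    _ ≤ _ := mul_le_mul' hK' hT

end Transfer

/-! ### Norm estimates for the components of the solution -/

section Decay

variable {γ β μ : ℝ}

/-- The zero frequency, where the split into longitudinal and transverse parts breaks down, is a
null set. -/
theorem IsSolution.exists_fiberBound (hγ : 0 < γ) (hβ : 0 < β) (hμ : 0 < μ) :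
    ∃ c > 0, ∃ C > 0, ∀ (n : ℝ → L2 ℝ) (u E B : ℝ → L2 R3) (n₀ : L2 ℝ) (u₀ E₀ B₀ : L2 R3),
      IsSolution γ β μ n u E B n₀ u₀ E₀ B₀ → ∀ t, 0 ≤ t → ∀ᵐ k,
      FiberBound c C (freq k) t ‖ft n₀ k‖ ‖ftv u₀ k‖ ‖ftv E₀ k‖ ‖ftv B₀ k‖
        ‖ft (n t) k‖ ‖ftv (u t) k‖ ‖ftv (E t) k‖ ‖ftv (B t) k‖ := by
  obtain ⟨c, hc, C, hC, H⟩ := SymbolSol.exists_fiberBound hγ hβ hμ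
  refine ⟨c, hc, C, hC, fun n u E B n₀ u₀ E₀ B₀ h t ht => ?_⟩
  have h0 : ∀ᵐ k : R3, k ≠ 0 := by simp [ae_iff]
  filter_upwards [h.exists_symbolSol hγ ht, h0] with k ⟨N, U, F, G, hs, e1, e2, e3, e4, e5, e6, e7,
    e8⟩ hk
  have hk' : 0 < ‖freq k‖ := by
    rw [norm_freq]
    have := norm_pos_iff.2 hk
    positivity
  have := H (freq k) hk' N U F G hs t ht
  rwa [e1, e2, e3, e4, e5, e6, e7, e8] at this

theorem norm1_le_norm12 {F : Type} [NormedAddCommGroup F] (f : L2 F) : norm1 f ≤ norm12 f :=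
  le_self_add

theorem enorm_le_norm12 {F : Type} [NormedAddCommGroup F] (f : L2 F) : ‖f‖ₑ ≤ norm12 f :=
  le_add_self

variable {c C : ℝ} {K : ℝ≥0} {t : ℝ} {n₀ n : L2 ℝ} {u₀ E₀ B₀ u E B : L2 R3}

/-- `K` bounds the norms of the low frequency kernels, acting on integrable data. -/
def LowBound (c t : ℝ) (K : ℝ≥0) : Prop :=
  ∀ a p : ℕ, a < 5 → p < 5 → 1 ≤ p → ∀ (D : L2 R3) (b : ℝ) (X T : ℝ≥0∞),
    b ≤ (2 * a + 3) / (2 * p) → norm1 D ≤ X → rate b t * X ≤ T →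
      NormLe (fun k => low c a p (freq k) t * ‖ftv D k‖) K T

/-- Here and in the analogous lemmas below, every term of the pointwise bound is compared with the
whole right-hand side, so the constants add up to a multiple of `K`. A kernel with exponents a, p
supplies the rate (2a+3)/(2p), at least the one required. -/
theorem enorm_n_le (hC : 0 ≤ C) (ht : 0 ≤ t) (hK : 81 ≤ K) (hlow : LowBound c t K)
    (h : ∀ᵐ k, FiberBound c C (freq k) t ‖ft n₀ k‖ ‖ftv u₀ k‖ ‖ftv E₀ k‖ ‖ftv B₀ k‖
      ‖ft n k‖ ‖ftv u k‖ ‖ftv E k‖ ‖ftv B k‖) :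
    ‖n‖ₑ ≤ (C.toNNReal * (K + K + K + K) : ℝ≥0)
      * (rate (5 / 4) t * (‖n₀‖ₑ + norm12 u₀ + norm1 E₀)) := by
  rw [← eLpNorm_ft]
  refine NormLe.eLpNorm_le (NormLe.add (NormLe.add (NormLe.add ?_ ?_) ?_) ?_) hC
    (h.mono fun k hk => hk.bound_n)
  · exact hlow 1 2 (by norm_num) (by norm_num) (by norm_num) E₀ (5 / 4) _ _ (by norm_num)
      le_add_self le_rfl
  · exact hlow 1 2 (by norm_num) (by norm_num) (by norm_num) u₀ (5 / 4) _ _ (by norm_num)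
      ((norm1_le_norm12 _).trans (le_add_self.trans le_self_add)) le_rfl
  · exact normLe_alg_ft hK n₀ ht _ (le_self_add.trans le_self_add) le_rfl
  · exact normLe_alg_ftv hK u₀ ht _ ((enorm_le_norm12 _).trans (le_add_self.trans le_self_add))
      le_rfl

theorem enorm_u_le (hC : 0 ≤ C) (ht : 0 ≤ t) (hK : 81 ≤ K) (hlow : LowBound c t K)
    (h : ∀ᵐ k, FiberBound c C (freq k) t ‖ft n₀ k‖ ‖ftv u₀ k‖ ‖ftv E₀ k‖ ‖ftv B₀ k‖
      ‖ft n k‖ ‖ftv u k‖ ‖ftv E k‖ ‖ftv B k‖) :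
    eLpNorm (ftv u) 2 volume ≤ (C.toNNReal * (K + K + K + K + K + K + K + K + K) : ℝ≥0)
      * (rate (5 / 4) t * norm12 n₀ + rate (3 / 4) t * (norm12 u₀ + norm12 E₀)
        + rate (5 / 8) t * norm12 B₀) := by
  have l : ∀ x y z : ℝ≥0∞, x ≤ x + y + z ∧ y ≤ x + y + z ∧ z ≤ x + y + z := fun x y z =>
    ⟨le_self_add.trans le_self_add, le_add_self.trans le_self_add, le_add_self⟩
  obtain ⟨hT1, hT2, hT3⟩ := l (rate (5 / 4) t * norm12 n₀)
    (rate (3 / 4) t * (norm12 u₀ + norm12 E₀)) (rate (5 / 8) t * norm12 B₀)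
  refine NormLe.eLpNorm_le (NormLe.add (NormLe.add (NormLe.add (NormLe.add (NormLe.add (NormLe.add
    (NormLe.add (NormLe.add ?_ ?_) ?_) ?_) ?_) ?_) ?_) ?_) ?_) hC (h.mono fun k hk => hk.bound_u)
  · exact hlow 1 4 (by norm_num) (by norm_num) (by norm_num) B₀ _ _ _ (by norm_num)
      (norm1_le_norm12 _) hT3
  · exact hlow 2 4 (by norm_num) (by norm_num) (by norm_num) E₀ _ _ _ (by norm_num)
      ((norm1_le_norm12 _).trans le_add_self) hT2
  · exact hlow 2 4 (by norm_num) (by norm_num) (by norm_num) u₀ _ _ _ (by norm_num)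
      ((norm1_le_norm12 _).trans le_self_add) hT2
  · exact hlow 0 2 (by norm_num) (by norm_num) (by norm_num) E₀ _ _ _ (by norm_num)
      ((norm1_le_norm12 _).trans le_add_self) hT2
  · exact hlow 0 2 (by norm_num) (by norm_num) (by norm_num) u₀ _ _ _ (by norm_num)
      ((norm1_le_norm12 _).trans le_self_add) hT2
  · exact normLe_alg_ftv hK B₀ ht _ (enorm_le_norm12 _) hT3
  · exact normLe_alg_ftv hK E₀ ht _ ((enorm_le_norm12 _).trans le_add_self) hT2
  · exact normLe_alg_ftv hK u₀ ht _ ((enorm_le_norm12 _).trans le_self_add) hT2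
  · exact normLe_alg_ft hK n₀ ht _ (enorm_le_norm12 _) hT1

theorem enorm_E_le (hC : 0 ≤ C) (ht : 0 ≤ t) (hK : 81 ≤ K) (hlow : LowBound c t K)
    (h : ∀ᵐ k, FiberBound c C (freq k) t ‖ft n₀ k‖ ‖ftv u₀ k‖ ‖ftv E₀ k‖ ‖ftv B₀ k‖
      ‖ft n k‖ ‖ftv u k‖ ‖ftv E k‖ ‖ftv B k‖) :
    eLpNorm (ftv E) 2 volume ≤ (C.toNNReal * (K + K + K + K + K + K + K + K + K + K) : ℝ≥0)
      * (rate (3 / 4) t * norm12 u₀ + rate (3 / 4) t * (norm12 E₀ + gradNorm 2 E₀)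
        + rate (9 / 8) t * (norm12 B₀ + gradNorm 3 B₀)) := by
  have l : ∀ x y z : ℝ≥0∞, x ≤ x + y + z ∧ y ≤ x + y + z ∧ z ≤ x + y + z := fun x y z =>
    ⟨le_self_add.trans le_self_add, le_add_self.trans le_self_add, le_add_self⟩
  obtain ⟨hT1, hT2, hT3⟩ := l (rate (3 / 4) t * norm12 u₀)
    (rate (3 / 4) t * (norm12 E₀ + gradNorm 2 E₀)) (rate (9 / 8) t * (norm12 B₀ + gradNorm 3 B₀))
  refine NormLe.eLpNorm_le (NormLe.add (NormLe.add (NormLe.add (NormLe.add (NormLe.add (NormLe.add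
    (NormLe.add (NormLe.add (NormLe.add ?_ ?_) ?_) ?_) ?_) ?_) ?_) ?_) ?_) ?_) hC
    (h.mono fun k hk => hk.bound_E)
  · exact hlow 3 4 (by norm_num) (by norm_num) (by norm_num) B₀ _ _ _ (by norm_num)
      ((norm1_le_norm12 _).trans le_self_add) hT3
  · exact hlow 3 4 (by norm_num) (by norm_num) (by norm_num) E₀ _ _ _ (by norm_num)
      ((norm1_le_norm12 _).trans le_self_add) hT2
  · exact hlow 3 4 (by norm_num) (by norm_num) (by norm_num) u₀ _ _ _ (by norm_num)
      (norm1_le_norm12 _) hT1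
  · exact hlow 1 2 (by norm_num) (by norm_num) (by norm_num) B₀ _ _ _ (by norm_num)
      ((norm1_le_norm12 _).trans le_self_add) hT3
  · exact hlow 0 2 (by norm_num) (by norm_num) (by norm_num) E₀ _ _ _ (by norm_num)
      ((norm1_le_norm12 _).trans le_self_add) hT2
  · exact hlow 0 2 (by norm_num) (by norm_num) (by norm_num) u₀ _ _ _ (by norm_num)
      (norm1_le_norm12 _) hT1
  · exact normLe_alg_pow hK (by norm_num) B₀ ht _ le_add_self hT3
  · exact normLe_alg_pow hK (by norm_num) E₀ ht _ le_add_self hT2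
  · exact normLe_alg_ftv hK E₀ ht _ ((enorm_le_norm12 _).trans le_self_add) hT2
  · exact normLe_alg_ftv hK u₀ ht _ (enorm_le_norm12 _) hT1

theorem enorm_B_le (hC : 0 ≤ C) (ht : 0 ≤ t) (hK : 81 ≤ K) (hlow : LowBound c t K)
    (h : ∀ᵐ k, FiberBound c C (freq k) t ‖ft n₀ k‖ ‖ftv u₀ k‖ ‖ftv E₀ k‖ ‖ftv B₀ k‖
      ‖ft n k‖ ‖ftv u k‖ ‖ftv E k‖ ‖ftv B k‖) :
    eLpNorm (ftv B) 2 volume ≤ (C.toNNReal * (K + K + K + K + K + K + K) : ℝ≥0)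
      * (rate (5 / 8) t * norm12 u₀ + rate (9 / 8) t * (norm12 E₀ + gradNorm 3 E₀)
        + rate (3 / 8) t * (norm12 B₀ + gradNorm 1 B₀)) := by
  have l : ∀ x y z : ℝ≥0∞, x ≤ x + y + z ∧ y ≤ x + y + z ∧ z ≤ x + y + z := fun x y z =>
    ⟨le_self_add.trans le_self_add, le_add_self.trans le_self_add, le_add_self⟩
  obtain ⟨hT1, hT2, hT3⟩ := l (rate (5 / 8) t * norm12 u₀)
    (rate (9 / 8) t * (norm12 E₀ + gradNorm 3 E₀)) (rate (3 / 8) t * (norm12 B₀ + gradNorm 1 B₀))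
  refine NormLe.eLpNorm_le (NormLe.add (NormLe.add (NormLe.add (NormLe.add (NormLe.add (NormLe.add
    ?_ ?_) ?_) ?_) ?_) ?_) ?_) hC (h.mono fun k hk => hk.bound_B)
  · exact hlow 0 4 (by norm_num) (by norm_num) (by norm_num) B₀ _ _ _ (by norm_num)
      ((norm1_le_norm12 _).trans le_self_add) hT3
  · exact hlow 3 4 (by norm_num) (by norm_num) (by norm_num) E₀ _ _ _ (by norm_num)
      ((norm1_le_norm12 _).trans le_self_add) hT2
  · exact hlow 1 4 (by norm_num) (by norm_num) (by norm_num) u₀ _ _ _ (by norm_num)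
      (norm1_le_norm12 _) hT1
  · exact hlow 1 2 (by norm_num) (by norm_num) (by norm_num) E₀ _ _ _ (by norm_num)
      ((norm1_le_norm12 _).trans le_self_add) hT2
  · exact normLe_alg_pow hK (by norm_num) B₀ ht _ le_add_self hT3
  · exact normLe_alg_pow hK (by norm_num) E₀ ht _ le_add_self hT2
  · exact normLe_alg_ftv hK u₀ ht _ (enorm_le_norm12 _) hT1

theorem enorm_grad_B_le (hC : 0 ≤ C) (ht : 0 ≤ t) (hK : 81 ≤ K) (hlow : LowBound c t K)
    (h : ∀ᵐ k, FiberBound c C (freq k) t ‖ft n₀ k‖ ‖ftv u₀ k‖ ‖ftv E₀ k‖ ‖ftv B₀ k‖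
      ‖ft n k‖ ‖ftv u k‖ ‖ftv E k‖ ‖ftv B k‖) :
    eLpNorm (fun k => ‖freq k‖ • ftv B k) 2 volume
      ≤ (C.toNNReal * (K + K + K + K + K + K + K) : ℝ≥0)
      * (rate (7 / 8) t * (norm12 u₀ + gradNorm 1 u₀)
        + rate (5 / 8) t * (norm12 E₀ + norm12 B₀ + gradNorm 3 E₀ + gradNorm 3 B₀)) := by
  have hT1 := le_self_add (a := rate (7 / 8) t * (norm12 u₀ + gradNorm 1 u₀))
    (b := rate (5 / 8) t * (norm12 E₀ + norm12 B₀ + gradNorm 3 E₀ + gradNorm 3 B₀))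
  have hT2 := le_add_self (a := rate (5 / 8) t * (norm12 E₀ + norm12 B₀ + gradNorm 3 E₀
    + gradNorm 3 B₀)) (b := rate (7 / 8) t * (norm12 u₀ + gradNorm 1 u₀))
  refine NormLe.eLpNorm_le (NormLe.add (NormLe.add (NormLe.add (NormLe.add (NormLe.add (NormLe.add
    ?_ ?_) ?_) ?_) ?_) ?_) ?_) hC (h.mono fun k hk =>
      (norm_smul_of_nonneg (norm_nonneg (freq k)) (ftv B k)).trans_le hk.bound_gradB)
  · exact hlow 1 4 (by norm_num) (by norm_num) (by norm_num) B₀ _ _ _ (by norm_num)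
      ((norm1_le_norm12 _).trans ((le_add_self.trans le_self_add).trans le_self_add)) hT2
  · exact hlow 4 4 (by norm_num) (by norm_num) (by norm_num) E₀ _ _ _ (by norm_num)
      ((norm1_le_norm12 _).trans ((le_self_add.trans le_self_add).trans le_self_add)) hT2
  · exact hlow 2 4 (by norm_num) (by norm_num) (by norm_num) u₀ _ _ _ (by norm_num)
      ((norm1_le_norm12 _).trans le_self_add) hT1
  · exact hlow 2 2 (by norm_num) (by norm_num) (by norm_num) E₀ _ _ _ (by norm_num)
      ((norm1_le_norm12 _).trans ((le_self_add.trans le_self_add).trans le_self_add)) hT2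
  · exact normLe_alg_pow hK (by norm_num) B₀ ht _ le_add_self hT2
  · exact normLe_alg_pow hK (by norm_num) E₀ ht _ (le_add_self.trans le_self_add) hT2
  · exact normLe_alg_pow hK (by norm_num) u₀ ht _ le_add_self hT1

end Decay
end NSMaxwell

/-! ### The decay estimates -/

theorem corollary5p1 (γ β μ : ℝ) (hγ : 0 < γ) (hβ : 0 < β) (hμ : 0 < μ) :
    ∃ C : ℝ≥0, ∀ (n : ℝ → NSMaxwell.L2 ℝ) (u E B : ℝ → NSMaxwell.L2 NSMaxwell.R3)
      (n₀ : NSMaxwell.L2 ℝ) (u₀ E₀ B₀ : NSMaxwell.L2 NSMaxwell.R3),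
      NSMaxwell.IsSolution γ β μ n u E B n₀ u₀ E₀ B₀ →
      ∀ t : ℝ, 0 ≤ t →
        ‖n t‖ₑ ≤ C * (NSMaxwell.rate (5 / 4) t *
          (‖n₀‖ₑ + NSMaxwell.norm12 u₀ + NSMaxwell.norm1 E₀)) ∧
        ‖u t‖ₑ ≤ C * (NSMaxwell.rate (5 / 4) t * NSMaxwell.norm12 n₀
          + NSMaxwell.rate (3 / 4) t * (NSMaxwell.norm12 u₀ + NSMaxwell.norm12 E₀)
          + NSMaxwell.rate (5 / 8) t * NSMaxwell.norm12 B₀) ∧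
        ‖E t‖ₑ ≤ C * (NSMaxwell.rate (3 / 4) t * NSMaxwell.norm12 u₀
          + NSMaxwell.rate (3 / 4) t * (NSMaxwell.norm12 E₀ + NSMaxwell.gradNorm 2 E₀)
          + NSMaxwell.rate (9 / 8) t * (NSMaxwell.norm12 B₀ + NSMaxwell.gradNorm 3 B₀)) ∧
        ‖B t‖ₑ ≤ C * (NSMaxwell.rate (5 / 8) t * NSMaxwell.norm12 u₀
          + NSMaxwell.rate (9 / 8) t * (NSMaxwell.norm12 E₀ + NSMaxwell.gradNorm 3 E₀)
          + NSMaxwell.rate (3 / 8) t * (NSMaxwell.norm12 B₀ + NSMaxwell.gradNorm 1 B₀)) ∧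
        NSMaxwell.gradNorm 1 (B t) ≤ C * (
          NSMaxwell.rate (7 / 8) t * (NSMaxwell.norm12 u₀ + NSMaxwell.gradNorm 1 u₀)
          + NSMaxwell.rate (5 / 8) t * (NSMaxwell.norm12 E₀ + NSMaxwell.norm12 B₀
            + NSMaxwell.gradNorm 3 E₀ + NSMaxwell.gradNorm 3 B₀)) := by
  obtain ⟨c, hc, C, hC, H⟩ := NSMaxwell.IsSolution.exists_fiberBound hγ hβ hμ
  obtain ⟨K', hK'⟩ := NSMaxwell.exists_normLe_low hc
  obtain ⟨K, hKdef⟩ : ∃ K : ℝ≥0, K = K' + 81 := ⟨_, rfl⟩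
  have hK : 81 ≤ K := hKdef ▸ le_add_self
  -- The factor 10 is the largest number of terms in a pointwise bound, reached for `E`. The factor
  -- 9 is the constant of `gradNorm_one_le` and also covers the 3 lost on returning from the Fourier
  -- side.
  refine ⟨9 * (C.toNNReal * (10 * K)), fun n u E B n₀ u₀ E₀ B₀ h t ht => ?_⟩
  have hlow : NSMaxwell.LowBound c t K := fun a p ha hp hp1 D b X T hb hX hT =>
    (hK' a p ha hp hp1 D t ht b X T hb hX hT).mono (hKdef ▸ le_self_add)
  have hf := H n u E B n₀ u₀ E₀ B₀ h t ht
  have const : ∀ {x y T : ℝ≥0∞} {L M : ℝ≥0}, M ≤ 9 → L ≤ 10 * K → x ≤ M * y →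
      y ≤ (C.toNNReal * L : ℝ≥0) * T → x ≤ ((9 * (C.toNNReal * (10 * K)) : ℝ≥0) : ℝ≥0∞) * T := by
    intro x y T L M hM hL h1 h2
    calc x ≤ M * ((C.toNNReal * L : ℝ≥0) * T) := h1.trans (by gcongr)
      _ = (M * (C.toNNReal * L) : ℝ≥0) * T := by rw [ENNReal.coe_mul M, mul_assoc]
      _ ≤ _ := by gcongr
  have hsum : ∀ m : ℕ, m ≤ 10 → m * K ≤ 10 * K := fun m hm => by gcongr; exact_mod_cast hm
  refine ⟨const (M := 1) (by norm_num) ?_ (by simp) (NSMaxwell.enorm_n_le hC.le ht hK hlow hf),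
    const (M := 3) (by norm_num) ?_ (NSMaxwell.enorm_le_eLpNorm_ftv _)
      (NSMaxwell.enorm_u_le hC.le ht hK hlow hf),
    const (M := 3) (by norm_num) ?_ (NSMaxwell.enorm_le_eLpNorm_ftv _)
      (NSMaxwell.enorm_E_le hC.le ht hK hlow hf),
    const (M := 3) (by norm_num) ?_ (NSMaxwell.enorm_le_eLpNorm_ftv _)
      (NSMaxwell.enorm_B_le hC.le ht hK hlow hf),
    const (M := 9) le_rfl ?_ (NSMaxwell.gradNorm_one_le _)
      (NSMaxwell.enorm_grad_B_le hC.le ht hK hlow hf)⟩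
  · exact le_of_eq_of_le (by push_cast; ring) (hsum 4 (by norm_num))
  · exact le_of_eq_of_le (by push_cast; ring) (hsum 9 (by norm_num))
  · exact le_of_eq_of_le (by push_cast; ring) (hsum 10 (by norm_num))
  · exact le_of_eq_of_le (by push_cast; ring) (hsum 7 (by norm_num))
  · exact le_of_eq_of_le (by push_cast; ring) (hsum 7 (by norm_num))
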